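/- Let $\kappa\ge 2$, let $\alpha\neq\alpha'$ be in $\{0,\dots,\kappa-1\}$, let $\beta\in 2\mathbb N$, $\beta>0$, and let $V$ be a complex polynomial of degree $\kappa$ with leading coefficient $1/\kappa$; put $\varphi=\mathrm{Re}\,V$. *Potential theory.* For $\Gamma\subset\mathbb C$ and a Borel probability measure $\mu$ on $\Gamma$ let $I[\mu]=\iint\big(\ln\frac1{|z-w|}+\varphi(z)+\varphi(w)\big)\,d\mu(z)\,d\mu(w)$ and $U[\mu](z)=\int\ln\frac{1}{|z-w|}\,d\mu(w)$. The minimiser $\mu_\Gamma$ of $I$ over the probability measures on $\Gamma$ is the equilibrium measure of $\Gamma$; $C_\Gamma=\inf_{\Gamma}(\varphi+U[\mu_\Gamma])$ is the equilibrium constant and $\varphi_{\Gamma;\mathrm{eff}}=\varphi+U[\mu_\Gamma]-C_\Gamma$ the effective potential. Let $S_j=\{z:|\arg z-\frac{2\pi j}{\kappa}|<\frac{\pi}{2\kappa}\}$ (angles modulo $2\pi$). $\mathcal T(\alpha,\alpha')$ is the class of connected finite unions $\Gamma$ of $C^1$ Jordan arcs (possibly unbounded) such that, for $j\in\{\alpha,\alpha'\}$,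 there are $\epsilon,r_0>0$ for which every circle $|z|=r$, $r>r_0$, contains a point of $\Gamma$ with $|\arg z-\frac{2\pi j}{\kappa}|<\frac{\pi}{2\kappa}-\epsilon$, and such that $\Gamma\cap S_j$ is bounded for every other $j$. A contour $\Gamma_{\rm eq}\in\mathcal T(\alpha,\alpha')$ solves the max-min problem if $\inf_{\mu\in\mathcal P(\Gamma_{\rm eq})}I[\mu]=\sup_{\Gamma\in\mathcal T(\alpha,\alpha')}\inf_{\mu\in\mathcal P(\Gamma)}I[\mu]$. For $\mu=\mu_{\Gamma_{\rm eq}}$ put $\sqrt{R(z)}=\int\frac{d\mu(w)}{w-z}+V'(z)$ for $z\notin\mathrm{supp}\,\mu$. Assume that $V$ is one-cut regular: $\mathrm{supp}\,\mu$ is a (connected) arc, $R$ is a polynomial, and some solution of the max-min problem, with the same equilibrium measure $\mu$, is such that $R$ has simple zeros at the two endpoints of $\mathrm{supp}\,\mu$ and no other zeros on this solution. *The curve.* Let $\gamma:\mathbb R\to\mathbb C$ be $C^\infty$ and injective, with $|\gamma(x)|\to\infty$ as $x\to\pm\infty$ and, for some $K>0$, $\arg\gamma(x)=\frac{2\pi\alpha}\kappa$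 for $x\le -K$ and $\arg\gamma(x)=\frac{2\pi\alpha'}\kappa$ for $x\ge K$, such that $\Gamma_{\rm eq}=\gamma(\mathbb R)$ solves the max-min problem, has equilibrium measure $\mu$, and $\varphi_{\Gamma_{\rm eq};\mathrm{eff}}>0$ on $\Gamma_{\rm eq}\setminus\mathrm{supp}\,\mu$. Assume moreover that $\gamma$ is the analytic parametrisation near the support: $\gamma([0,1])=\mathrm{supp}\,\mu$; for $x\in[0,1]$ $$\int_{\gamma(0)}^{\gamma(x)}\frac{1}{i\pi}\sqrt{R(w)}_+\,dw=\frac8\pi\int_0^x\sqrt{s(1-s)}\,ds$$ (integration along $\mathrm{supp}\,\mu$; $\sqrt{R}_+$ is the boundary value of $\sqrt R$ from the left of $\gamma$); and, for some $\epsilon_0>0$, $\gamma|_{[-\epsilon_0,1+\epsilon_0]}$ extends to a biholomorphic map on a complex neighbourhood of $[-\epsilon_0,1+\epsilon_0]$. *The real model.* For a closed interval $J\subset\mathbb R$ let $$Z_{N,\gamma|_J}[V]=\int_{J^N}\prod_{a<b}|\gamma(x_a)-\gamma(x_b)|^\beta\prod_{a=1}^N|\gamma'(x_a)|\,e^{-N\beta\varphi(\gamma(x_a))}\,d\mathbf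 x ,$$ let $Z_{N,\gamma}=Z_{N,\gamma|_{\mathbb R}}$, and let $\mathbb P_{N,\gamma}$ be the probability measure on $\mathbb R^N$ whose density is $1/Z_{N,\gamma}[V]$ times this integrand. Put $d\nu_{sc}(y)=\frac8\pi\mathbf 1_{[0,1]}(y)\sqrt{y(1-y)}\,dy$ and $$\widetilde\varphi_{\rm eff}(x)=\varphi(\gamma(x))-\int_0^1\ln|\gamma(x)-\gamma(y)|\,d\nu_{sc}(y)-C_{\Gamma_{\rm eq}} .$$ Then $0<Z_{N,\gamma}[V]<\infty$ for all $N$ (so that $\mathbb P_{N,\gamma}$ is a probability measure) and: 1. for every closed $F\subset\mathbb R$, $\displaystyle\limsup_{N\to\infty}\frac1N\ln\mathbb P_{N,\gamma}\big[\exists i:\ x_i\in F\big]\le-\beta\inf_{x\in F}\widetilde\varphi_{\rm eff}(x)$; 2. for every open $U\subset\mathbb R$, $\displaystyle\liminf_{N\to\infty}\frac1N\ln\mathbb P_{N,\gamma}\big[\exists i:\ x_i\in U\big]\ge-\beta\inf_{x\in U}\widetilde\varphi_{\rm eff}(x)$; 3. for every $\epsilon>0$ there is $C>0$ such that $Z_{N,\gamma|_{[-\epsilon,1+\epsilon]}}[V]=Z_{N,\gamma}[V]\,\big(1+O(e^{-CN})\big)$.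 Here $\ln 0=-\infty$ and $\inf\emptyset=+\infty$. -/

import Mathlib

open Complex MeasureTheory Filter Topology Polynomial
open scoped ENNReal ContDiff

noncomputable section

namespace DysonGas

/-! ### Logarithmic potential theory in an external field -/

/-- The integral of an extended-real valued function: integral of the positive part minus
integral of the negative part (no integrability is presupposed; the undefined form `∞ - ∞`
is read as `-∞`). -/
def eintegral {X : Type*} [MeasurableSpace X] (μ : Measure X) (f : X → EReal) : EReal :=
  ((∫⁻ x, (f x).toENNReal ∂μ : ℝ≥0∞) : EReal) - ((∫⁻ x, (-f x).toENNReal ∂μ : ℝ≥0∞) : EReal)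

/-- `ln (1 / |z - w|)`, equal to `+∞` on the diagonal. -/
def logKernel (z w : ℂ) : EReal := -ENNReal.log (edist z w)

/-- The external field `φ = Re V`. -/
def field (V : ℂ[X]) (z : ℂ) : ℝ := (V.eval z).re

/-- The electrostatic potential `U[μ](z) = ∫ ln (1 / |z - w|) dμ(w)`. -/
def potential (μ : Measure ℂ) (z : ℂ) : EReal := eintegral μ (logKernel z)

/-- The energy `I[μ] = ∬ (ln (1 / |z - w|) + φ(z) + φ(w)) dμ(z) dμ(w)`. -/
def energy (V : ℂ[X]) (μ : Measure ℂ) : EReal :=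
  eintegral (μ.prod μ) fun p => logKernel p.1 p.2 + (field V p.1 : EReal) + (field V p.2 : EReal)

/-- The infimum of the energy over the Borel probability measures on `Γ`. -/
def minEnergy (V : ℂ[X]) (Γ : Set ℂ) : EReal :=
  ⨅ (ν : Measure ℂ) (_ : IsProbabilityMeasure ν) (_ : ν Γᶜ = 0), energy V ν

/-- `μ` is the equilibrium measure of `Γ` in the external field `Re V`. -/
structure IsEquilibriumMeasure (V : ℂ[X]) (Γ : Set ℂ) (μ : Measure ℂ) : Prop where
  isProbabilityMeasure : IsProbabilityMeasure μ
  carried : μ Γᶜ = 0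
  energy_eq : energy V μ = minEnergy V Γ

/-- The equilibrium constant `C_Γ`: the infimum over `Γ` of `φ + U[μ]`. -/
def equilibriumConstant (V : ℂ[X]) (Γ : Set ℂ) (μ : Measure ℂ) : EReal :=
  ⨅ z ∈ Γ, ((field V z : EReal) + potential μ z)

/-- The effective potential `φ + U[μ] - C_Γ`. -/
def effectivePotential (V : ℂ[X]) (Γ : Set ℂ) (μ : Measure ℂ) (z : ℂ) : EReal :=
  (field V z : EReal) + potential μ z - equilibriumConstant V Γ μ

/-! ### Admissible contours and the max-min energy problem -/

/-- A `C¹` Jordan arc: the image of a closed interval of `ℝ` (bounded or not) under an injective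
regular `C¹` map, going to infinity along the unbounded ends of the interval. -/
def IsC1JordanArc (A : Set ℂ) : Prop :=
  ∃ (J : Set ℝ) (η : ℝ → ℂ), J.OrdConnected ∧ IsClosed J ∧ J.Nontrivial ∧
    ContDiffOn ℝ 1 η J ∧ Set.InjOn η J ∧ (∀ x ∈ J, derivWithin η J x ≠ 0) ∧
    Tendsto (fun x => ‖η x‖) (cocompact ℝ ⊓ 𝓟 J) atTop ∧ η '' J = A

/-- `|arg z - 2πj/κ|`, the angle being taken modulo `2π`. -/
def angleTo (κ j : ℕ) (z : ℂ) : ℝ :=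
  |Complex.arg (z * Complex.exp (-(2 * Real.pi * j / κ : ℝ) * I))|

/-- The sector of half-opening `π/(2κ)` around the direction `exp(2πij/κ)`. -/
def sector (κ j : ℕ) : Set ℂ := {z | angleTo κ j z < Real.pi / (2 * κ)}

/-- `F` stretches out to infinity in the `j`-th sector. -/
def StretchesOut (κ j : ℕ) (F : Set ℂ) : Prop :=
  ∃ ε > 0, ∃ r₀ > 0, ∀ r > r₀, ∃ z ∈ F, ‖z‖ = r ∧ angleTo κ j z < Real.pi / (2 * κ) - ε

/-- The class `𝒯(α, α')` of admissible contours. -/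
structure IsAdmissible (κ α α' : ℕ) (Γ : Set ℂ) : Prop where
  finite_union : ∃ S : Set (Set ℂ), S.Finite ∧ (∀ A ∈ S, IsC1JordanArc A) ∧ Γ = ⋃₀ S
  connected : IsConnected Γ
  stretches : StretchesOut κ α Γ
  stretches' : StretchesOut κ α' Γ
  avoids : ∀ l < κ, l ≠ α → l ≠ α' → ∃ R > 0, Γ ∩ (sector κ l \ Metric.ball 0 R) = ∅

/-- `Γ` solves the max-min energy problem in `𝒯(α, α')`. -/
def SolvesMaxMin (V : ℂ[X]) (κ α α' : ℕ) (Γ : Set ℂ) : Prop :=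
  IsAdmissible κ α α' Γ ∧
    (⨆ (Γ' : Set ℂ) (_ : IsAdmissible κ α α' Γ'), minEnergy V Γ') = minEnergy V Γ

/-! ### One-cut regularity -/

/-- `√R(z) = 2πi C[μ](z) + V'(z)`, where `2πi C[μ](z) = ∫ (w - z)⁻¹ dμ(w)`. -/
def sqrtR (V : ℂ[X]) (μ : Measure ℂ) (z : ℂ) : ℂ :=
  (∫ w, (w - z)⁻¹ ∂μ) + V.derivative.eval z

/-- One-cut regularity of `V`; `μ` is the equilibrium measure of the contours that solve the
max-min problem. Its support is a connected arc, and some solution `Γ` of the max-min problem, with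
equilibrium measure `μ`, is such that the polynomial `R` has simple zeros at the endpoints of the
support of `μ` and no other zeros on `Γ`. -/
def IsOneCutRegular (V : ℂ[X]) (κ α α' : ℕ) (μ : Measure ℂ) : Prop :=
  IsConnected μ.support ∧
  ∃ Γ : Set ℂ, SolvesMaxMin V κ α α' Γ ∧ IsEquilibriumMeasure V Γ μ ∧
  ∃ R : ℂ[X], (∀ z ∉ μ.support, R.eval z = sqrtR V μ z ^ 2) ∧
  ∃ c : ℝ → ℂ, ContinuousOn c (Set.Icc 0 1) ∧ Set.InjOn c (Set.Icc 0 1) ∧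
    c '' Set.Icc 0 1 = μ.support ∧
    R.rootMultiplicity (c 0) = 1 ∧ R.rootMultiplicity (c 1) = 1 ∧
    ∀ z ∈ Γ, R.IsRoot z → z = c 0 ∨ z = c 1

/-! ### The curve -/

/-- The parametrisation of a "nice" contour: smooth, injective, and running along the rays of
directions `exp(2πiα/κ)` (at `-∞`) and `exp(2πiα'/κ)` (at `+∞`). -/
structure IsNiceCurve (κ α α' : ℕ) (γ : ℝ → ℂ) : Prop where
  smooth : ContDiff ℝ ∞ γ
  injective : Function.Injective γ
  tendsto_atBot : Tendsto (fun x => ‖γ x‖) atBot atTop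
  tendsto_atTop : Tendsto (fun x => ‖γ x‖) atTop atTop
  direction : ∃ K > 0,
    (∀ x ≤ -K, γ x = ‖γ x‖ * Complex.exp ((2 * Real.pi * α / κ : ℝ) * I)) ∧
    (∀ x ≥ K, γ x = ‖γ x‖ * Complex.exp ((2 * Real.pi * α' / κ : ℝ) * I))

/-- The analytic parametrisation of the support: `γ` maps `[0, 1]` onto `supp μ` and satisfies
`Θ₊ ∘ γ = Ψ₊` on `[0, 1]`, where `Θ₊(z) = ∫_{γ(0)}^z (iπ)⁻¹ √R₊(w) dw` along `supp μ`, with `√R₊` the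
boundary value of `√R` from the left of `γ` (below `h s` is its value at `γ s`), and
`Ψ₊(x) = (8/π) ∫₀ˣ √(s(1-s)) ds`. Moreover, for some `ε > 0`, the curve `γ` is on `[-ε, 1+ε]` given by
a biholomorphic map `G` defined on a complex neighbourhood `D` of this interval. -/
def IsAnalyticParametrisation (V : ℂ[X]) (μ : Measure ℂ) (γ : ℝ → ℂ) : Prop :=
  γ '' Set.Icc 0 1 = μ.support ∧
  (∃ h : ℝ → ℂ,
    (∀ s ∈ Set.Ioo (0 : ℝ) 1,
      Tendsto (fun t : ℝ => sqrtR V μ (γ s + t * (I * deriv γ s))) (𝓝[>] 0) (𝓝 (h s))) ∧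
    ∀ x ∈ Set.Icc (0 : ℝ) 1,
      (∫ s in (0 : ℝ)..x, 1 / (I * Real.pi) * h s * deriv γ s) =
        ((8 / Real.pi * ∫ s in (0 : ℝ)..x, Real.sqrt (s * (1 - s)) : ℝ) : ℂ)) ∧
  ∃ ε > (0 : ℝ), ∃ (D : Set ℂ) (G : ℂ → ℂ), IsOpen D ∧ DifferentiableOn ℂ G D ∧ Set.InjOn G D ∧
    ∀ x ∈ Set.Icc (-ε) (1 + ε), (x : ℂ) ∈ D ∧ γ x = G x

/-- The curve `γ : ℝ → ℂ` parametrises an unbounded `S`-curve `Γ_eq = γ(ℝ)` of the required kind,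
with equilibrium measure `μ`: it is nice, solves the max-min energy problem, is the analytic
parametrisation near the support, and has a positive effective potential off the support. -/
structure IsEquilibriumCurve (V : ℂ[X]) (κ α α' : ℕ) (μ : Measure ℂ) (γ : ℝ → ℂ) : Prop where
  nice : IsNiceCurve κ α α' γ
  solves : SolvesMaxMin V κ α α' (Set.range γ)
  equilibrium : IsEquilibriumMeasure V (Set.range γ) μ
  analytic : IsAnalyticParametrisation V μ γ
  effective_pos : ∀ z ∈ Set.range γ \ μ.support, 0 < effectivePotential V (Set.range γ) μ z

/-! ### The real model -/

/-- The unnormalised density of the real model. -/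
def weight (V : ℂ[X]) (β : ℕ) (γ : ℝ → ℂ) (N : ℕ) (x : Fin N → ℝ) : ℝ :=
  (∏ a : Fin N, ∏ b ∈ Finset.Ioi a, ‖γ (x a) - γ (x b)‖ ^ β) *
    ∏ a : Fin N, ‖deriv γ (x a)‖ * Real.exp (-(N * β * field V (γ (x a))))

/-- The unnormalised measure on `J^N`, seen as a measure on `ℝ^N`. -/
def gibbs (V : ℂ[X]) (β : ℕ) (γ : ℝ → ℂ) (J : Set ℝ) (N : ℕ) : Measure (Fin N → ℝ) :=
  (volume.restrict {x | ∀ a, x a ∈ J}).withDensity fun x => ENNReal.ofReal (weight V β γ N x)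

/-- The partition function of the restriction of `γ` to `J`. -/
def partitionFunction (V : ℂ[X]) (β : ℕ) (γ : ℝ → ℂ) (J : Set ℝ) (N : ℕ) : ℝ≥0∞ :=
  ∫⁻ x in {x : Fin N → ℝ | ∀ a, x a ∈ J}, ENNReal.ofReal (weight V β γ N x)

/-- The law `ℙ_{N,γ}` of the real model on the whole curve. -/
def realModel (V : ℂ[X]) (β : ℕ) (γ : ℝ → ℂ) (N : ℕ) : Measure (Fin N → ℝ) :=
  (partitionFunction V β γ Set.univ N)⁻¹ • gibbs V β γ Set.univ N

/-- The semicircle law on `[0, 1]`. -/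
def semicircle : Measure ℝ :=
  (volume.restrict (Set.Icc 0 1)).withDensity fun x =>
    ENNReal.ofReal (8 / Real.pi * Real.sqrt (x * (1 - x)))

/-- The pulled-back effective potential
`φ̃_eff(x) = Re V(γ(x)) - ∫₀¹ ln |γ(x) - γ(y)| dν_sc(y) - C_Γ`, with `Γ = γ(ℝ)`. -/
def pulledBackPotential (V : ℂ[X]) (μ : Measure ℂ) (γ : ℝ → ℂ) (x : ℝ) : EReal :=
  (field V (γ x) : EReal) + eintegral semicircle (fun y => logKernel (γ x) (γ y)) -
    equilibriumConstant V (Set.range γ) μ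

end DysonGas

end

/-! The model is a Coulomb gas on a curve. Let `ν` be the semicircle law, `γ_*ν` its image under the
curve and `E` the pulled-back effective potential. Everything rests on one decomposition, recorded
in `IsEffectiveField`: along the curve the field `Re V` is `E`, plus the logarithmic potential of
`γ_*ν`, plus a constant, where `E ≥ 0`, `E = 0` on `[0, 1]`, and `E` grows at least like `|γ|`.

The decomposition (`exists_isEffectiveField`) needs two facts. First, `μ = γ_*ν`
(`eq_map_semicircle`). The prescribed boundary values give `R(γ(x)) γ'(x)² = 64 x (x - 1)` for
almost every `x` in `(0, 1)`, and the identity theorem extends this relation to a complex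
neighbourhood with `γ` replaced by its holomorphic extension `G`. So `G' · (√R ∘ G)` is a branch of
`8 √(u (u - 1))` on each side of the cut. Up to a bounded kernel its jump is the Poisson transform
of the pullback of `μ`, which is therefore proportional to `√(t (1 - t))`; total mass fixes the
constant. Second, the first variation of the energy makes the total potential constant on `[0, 1]`.
Positivity of the effective potential off the support then places the minimum of the total potential
on the support, so this constant is `C_Γ`.

For the gas, replace `-ln |z|` by the smooth kernel `ell η z = -½ ln (|z|² + η²)`. This kernel is
positive definite on neutral signed measures, because the logarithm of a ratio is a superposition of
Gaussians (`log_ratio_sum_nonneg`). Hence the `discrepancy`, the regularised energy of `∑ δ_{γ(x_a)}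
- N γ_*ν`, is nonnegative. It bounds the Boltzmann factor from above (`boltz_le`), while Jensen's
inequality bounds the partition function from below with the same leading term
(`le_lintegral_weight`). So a discrepancy of order `N²` has probability `e^{-cN²}` up to a factor
`K^N` (`lintegral_discrepancy_ge_le`).

On configurations of small discrepancy one particle is replaced by a smooth charge `ρ`. Positivity
of the quadratic form at `∑ δ_{γ(x_a)} - N γ_*ν + dN (δ_z - ρ)`, a form of Cauchy–Schwarz, shows
that the other particles act on the moved one almost as `N γ_*ν` does (`neg_mixed_le`). The exponent
of the resulting bound is therefore `βN (E(x_i) - ∫ E dρ)` up to `o(N)`. Integrating over the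
position of this particle (`exists_lintegral_weight_le`) yields both bounds: `ρ = ν`, where `E`
vanishes, gives the upper one, and `ρ` concentrated near an almost minimiser of `E` in `U` gives the
lower one. The comparison of partition functions is the upper bound applied outside `[-ε, 1 + ε]`,
where `E` has a positive minimum. -/

namespace DysonGas

/-! ### Positive definiteness of the regularised logarithmic kernel -/

section FeatureKernel

variable {Ω : Type*} [MeasurableSpace Ω] {m : Measure Ω} [SFinite m] {F : ℂ → Ω → ℝ}
  {κ : ℂ → ℂ → ℝ} {C : ℝ}

/-- Fubini for a bounded kernel factored as `κ(z, w) = ∫ F(z, o) F(w, o) dm(o)`. Nonnegativity of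
`F` and boundedness of `κ` give the integrability, even though `m` may be infinite. -/
lemma integrable_and_integral_feature_mul (hF : Measurable (Function.uncurry F))
    (hF0 : ∀ z o, 0 ≤ F z o) (hκ0 : ∀ z w, 0 ≤ κ z w) (hκC : ∀ z w, κ z w ≤ C)
    (hκ : ∀ z w, ∫⁻ o, ENNReal.ofReal (F z o * F w o) ∂m = ENNReal.ofReal (κ z w))
    (P M : Measure ℂ) [IsProbabilityMeasure P] [IsProbabilityMeasure M] :
    Integrable (fun o => (∫ z, F z o ∂P) * ∫ w, F w o ∂M) m ∧
      ∫ o, (∫ z, F z o ∂P) * (∫ w, F w o ∂M) ∂m = ∫ z, ∫ w, κ z w ∂M ∂P := by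
  have hmeas : Measurable fun q : (ℂ × ℂ) × Ω => F q.1.1 q.2 * F q.1.2 q.2 :=
    (hF.comp (measurable_fst.fst.prodMk measurable_snd)).mul
      (hF.comp (measurable_fst.snd.prodMk measurable_snd))
  have hκ' : ∀ z w, ∫ o, F z o * F w o ∂m = κ z w := by
    intro z w
    rw [integral_eq_lintegral_of_nonneg_ae
      (Eventually.of_forall fun o => mul_nonneg (hF0 z o) (hF0 w o)), hκ,
      ENNReal.toReal_ofReal (hκ0 z w)]
    exact (hmeas.comp (measurable_const.prodMk measurable_id :
      Measurable fun o => (((z, w), o) : (ℂ × ℂ) × Ω))).aestronglyMeasurable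
  have hint : Integrable (fun q : (ℂ × ℂ) × Ω => F q.1.1 q.2 * F q.1.2 q.2)
      ((P.prod M).prod m) := by
    refine ⟨hmeas.aestronglyMeasurable, ?_⟩
    rw [hasFiniteIntegral_iff_ofReal
      (Eventually.of_forall fun q => mul_nonneg (hF0 _ _) (hF0 _ _)),
      lintegral_prod _ hmeas.ennreal_ofReal.aemeasurable]
    simp only [hκ]
    calc ∫⁻ p : ℂ × ℂ, ENNReal.ofReal (κ p.1 p.2) ∂(P.prod M)
        ≤ ∫⁻ _p : ℂ × ℂ, ENNReal.ofReal C ∂(P.prod M) :=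
          lintegral_mono fun p => ENNReal.ofReal_le_ofReal (hκC _ _)
      _ < ⊤ := by simp
  have hprod : ∀ o, ∫ p : ℂ × ℂ, F p.1 o * F p.2 o ∂(P.prod M) =
      (∫ z, F z o ∂P) * ∫ w, F w o ∂M := fun o =>
    integral_prod_mul (fun z => F z o) (fun w => F w o)
  constructor
  · have := hint.integral_prod_right
    simpa only [hprod] using this
  · have h1 := hint.integral_prod_left
    simp only [hκ'] at h1
    have h2 := integral_integral_swap (f := fun (p : ℂ × ℂ) o => F p.1 o * F p.2 o) hint
    simp only [hκ', hprod] at h2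
    rw [← h2, integral_prod _ h1]

/-- Once the kernel is factored, the quadratic form is the integral over `o` of the square of `∑ c i
∫ F(z, o) dP i(z)`. -/
lemma feature_kernel_sum_nonneg (hF : Measurable (Function.uncurry F))
    (hF0 : ∀ z o, 0 ≤ F z o) (hκ0 : ∀ z w, 0 ≤ κ z w) (hκC : ∀ z w, κ z w ≤ C)
    (hκ : ∀ z w, ∫⁻ o, ENNReal.ofReal (F z o * F w o) ∂m = ENNReal.ofReal (κ z w))
    {ι : Type*} [Fintype ι] (P : ι → Measure ℂ) [∀ i, IsProbabilityMeasure (P i)] (c : ι → ℝ) :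
    0 ≤ ∑ i, ∑ j, c i * c j * ∫ z, ∫ w, κ z w ∂(P j) ∂(P i) := by
  have key := fun i j => integrable_and_integral_feature_mul hF hF0 hκ0 hκC hκ (P i) (P j)
  have : ∑ i, ∑ j, c i * c j * ∫ z, ∫ w, κ z w ∂(P j) ∂(P i) =
      ∫ o, (∑ i, c i * ∫ z, F z o ∂(P i)) ^ 2 ∂m := by
    have e : ∀ o, (∑ i, c i * ∫ z, F z o ∂(P i)) ^ 2 =
        ∑ i, ∑ j, c i * c j * ((∫ z, F z o ∂(P i)) * ∫ w, F w o ∂(P j)) := by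
      intro o
      rw [sq, Finset.sum_mul_sum]
      exact Finset.sum_congr rfl fun i _ => Finset.sum_congr rfl fun j _ => by ring
    simp only [e]
    rw [integral_finsetSum _ fun i _ => integrable_finsetSum _ fun j _ => (key i j).1.const_mul _]
    refine Finset.sum_congr rfl fun i _ => ?_
    rw [integral_finsetSum _ fun j _ => (key i j).1.const_mul _]
    exact Finset.sum_congr rfl fun j _ => by rw [integral_const_mul, (key i j).2]
  rw [this]
  exact integral_nonneg fun o => sq_nonneg _

end FeatureKernel

/-- By the parallelogram identity the product is a Gaussian in `u` centred at `(z + w) / 2`. This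
factors the Gaussian kernel in `z - w`. -/
lemma lintegral_gaussian_mul {t : ℝ} (ht : 0 < t) (z w : ℂ) :
    ∫⁻ u : ℂ, ENNReal.ofReal (Real.exp (-(2 * t) * ‖z - u‖ ^ 2) * Real.exp (-(2 * t) * ‖w - u‖ ^ 2)) =
      ENNReal.ofReal (Real.pi / (4 * t) * Real.exp (-t * ‖z - w‖ ^ 2)) := by
  have e : ∀ u : ℂ, Real.exp (-(2 * t) * ‖z - u‖ ^ 2) * Real.exp (-(2 * t) * ‖w - u‖ ^ 2) =
      Real.exp (-t * ‖z - w‖ ^ 2) * Real.exp (-(4 * t) * ‖u - (z + w) / 2‖ ^ 2) := by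
    intro u
    rw [← Real.exp_add, ← Real.exp_add]
    congr 1
    simp only [← Complex.normSq_eq_norm_sq, Complex.normSq_apply, Complex.sub_re, Complex.sub_im,
      Complex.div_ofNat_re, Complex.div_ofNat_im, Complex.add_re, Complex.add_im]
    ring
  have h4 : (0 : ℝ) < 4 * t := by positivity
  have hval : ∫ u : ℂ, Real.exp (-(4 * t) * ‖u‖ ^ 2) = Real.pi / (4 * t) := by
    rw [GaussianFourier.integral_rexp_neg_mul_sq_norm h4, Complex.finrank_real_complex]
    norm_num
  have hint : Integrable fun u : ℂ => Real.exp (-(4 * t) * ‖u‖ ^ 2) := by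
    by_contra hn
    rw [integral_undef hn] at hval
    have : (0 : ℝ) < Real.pi / (4 * t) := by positivity
    linarith
  simp only [e]
  rw [← ofReal_integral_eq_lintegral_ofReal ((hint.comp_sub_right ((z + w) / 2)).const_mul _)
    (Eventually.of_forall fun u => by positivity), integral_const_mul,
    integral_sub_right_eq_self (fun u : ℂ => Real.exp (-(4 * t) * ‖u‖ ^ 2)), hval, mul_comm]

lemma lintegral_exp_neg_mul_Ioi {c : ℝ} (hc : 0 < c) :
    ∫⁻ t in Set.Ioi (0 : ℝ), ENNReal.ofReal (Real.exp (-c * t)) = ENNReal.ofReal c⁻¹ := by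
  have hneg : -c < 0 := by linarith
  rw [← ofReal_integral_eq_lintegral_ofReal
    (integrableOn_exp_mul_Ioi hneg 0) (Eventually.of_forall fun u => by positivity),
    integral_exp_mul_Ioi hneg]
  congr 1
  simp

lemma lintegral_inv_add {a b r : ℝ} (ha : 0 < a) (hab : a ≤ b) (hr : 0 ≤ r) :
    ∫⁻ s in Set.Ioc a b, ENNReal.ofReal (r + s)⁻¹ = ENNReal.ofReal (Real.log ((r + b) / (r + a))) := by
  have h1 : ∫ s in a..b, (r + s)⁻¹ = Real.log ((r + b) / (r + a)) := by
    rw [intervalIntegral.integral_comp_add_left (fun s => s⁻¹),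
      integral_inv_of_pos (by linarith) (by linarith)]
  rw [← h1, intervalIntegral.integral_of_le hab, ofReal_integral_eq_lintegral_ofReal]
  · have : ContinuousOn (fun s : ℝ => (r + s)⁻¹) (Set.Icc a b) :=
      (ContinuousOn.add (f := fun _ : ℝ => r) continuousOn_const continuousOn_id).inv₀ fun s hs => by
        have := hs.1
        simp only [Pi.add_apply, id]
        linarith
    exact (this.integrableOn_Icc).mono_set Set.Ioc_subset_Icc_self
  · refine (ae_restrict_iff' measurableSet_Ioc).2 (Eventually.of_forall fun s hs => ?_)
    have := hs.1
    exact inv_nonneg.2 (by linarith)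

/-- The kernel `log ((|z - w|² + b) / (|z - w|² + a))` is positive definite. -/
lemma log_ratio_sum_nonneg {a b : ℝ} (ha : 0 < a) (hab : a ≤ b)
    {ι : Type*} [Fintype ι] (P : ι → Measure ℂ) [∀ i, IsProbabilityMeasure (P i)] (c : ι → ℝ) :
    0 ≤ ∑ i, ∑ j, c i * c j *
      ∫ z, ∫ w, Real.log ((‖z - w‖ ^ 2 + b) / (‖z - w‖ ^ 2 + a)) ∂(P j) ∂(P i) := by
  have hb : 0 < b := ha.trans_le hab
  have hratio : ∀ z w : ℂ, 1 ≤ (‖z - w‖ ^ 2 + b) / (‖z - w‖ ^ 2 + a) := fun z w => by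
    rw [one_le_div (by positivity)]; linarith
  -- The feature space has points `(s, t, u)`. With `r = |z - w|²`, the kernel is `∫_a^b ds ∫_0^∞
  -- e^{-t(r+s)} dt`, and `e^{-tr}` is `4t/π` times an integral over `u` of two Gaussians. Each copy
  -- of `F` takes the square root of the common factors. The bound `log (b / a)` is the value on the
  -- diagonal.
  refine feature_kernel_sum_nonneg
    (m := (volume.restrict (Set.Ioc a b)).prod ((volume.restrict (Set.Ioi (0 : ℝ))).prod volume))
    (F := fun z (o : ℝ × ℝ × ℂ) => √(4 * o.2.1 / Real.pi) * Real.exp (-(o.1 / 2) * o.2.1) *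
      Real.exp (-(2 * o.2.1) * ‖z - o.2.2‖ ^ 2)) (C := Real.log (b / a))
    ?_ ?_ ?_ ?_ ?_ P c
  · unfold Function.uncurry; fun_prop
  · intro z o; positivity
  · intro z w; exact Real.log_nonneg (hratio z w)
  · intro z w
    refine Real.log_le_log (by linarith [hratio z w]) ?_
    rw [div_le_div_iff₀ (by positivity) ha]
    nlinarith [sq_nonneg ‖z - w‖]
  · intro z w
    rw [lintegral_prod _ (by fun_prop)]
    rw [← lintegral_inv_add ha hab (sq_nonneg ‖z - w‖)]
    refine setLIntegral_congr_fun measurableSet_Ioc fun s hs => ?_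
    have hs0 : 0 < s := ha.trans hs.1
    simp only
    rw [lintegral_prod _ (by fun_prop)]
    rw [← lintegral_exp_neg_mul_Ioi (by positivity)]
    refine setLIntegral_congr_fun measurableSet_Ioi fun t ht => ?_
    have ht0 : 0 < t := ht
    simp only
    have e : ∀ u : ℂ, √(4 * t / Real.pi) * Real.exp (-(s / 2) * t) *
          Real.exp (-(2 * t) * ‖z - u‖ ^ 2) *
        (√(4 * t / Real.pi) * Real.exp (-(s / 2) * t) * Real.exp (-(2 * t) * ‖w - u‖ ^ 2)) =
        (4 * t / Real.pi * Real.exp (-s * t)) *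
          (Real.exp (-(2 * t) * ‖z - u‖ ^ 2) * Real.exp (-(2 * t) * ‖w - u‖ ^ 2)) := by
      intro u
      have h1 : √(4 * t / Real.pi) * √(4 * t / Real.pi) = 4 * t / Real.pi :=
        Real.mul_self_sqrt (by positivity)
      have h2 : Real.exp (-(s / 2) * t) * Real.exp (-(s / 2) * t) = Real.exp (-s * t) := by
        rw [← Real.exp_add]; congr 1; ring
      rw [← h2]; nth_rewrite 3 [← h1]; ring
    simp only [e]
    have hc : 0 ≤ 4 * t / Real.pi * Real.exp (-s * t) := by positivity
    simp only [ENNReal.ofReal_mul hc]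
    rw [lintegral_const_mul _ (by fun_prop), lintegral_gaussian_mul ht0, ← ENNReal.ofReal_mul hc]
    congr 1
    have : Real.exp (-(‖z - w‖ ^ 2 + s) * t) = Real.exp (-s * t) * Real.exp (-t * ‖z - w‖ ^ 2) := by
      rw [← Real.exp_add]; congr 1; ring
    rw [this]
    field_simp

/-! ### The regularised logarithmic kernel -/

/-- The regularised logarithmic kernel `ln (1 / √(|z|² + η²))`. -/
noncomputable def ell (η : ℝ) (z : ℂ) : ℝ := -(1 / 2) * Real.log (‖z‖ ^ 2 + η ^ 2)

/-- The potential of `ρ` for the regularised kernel. -/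
noncomputable def ellPot (η : ℝ) (ρ : Measure ℂ) (z : ℂ) : ℝ := ∫ w, ell η (z - w) ∂ρ

/-- The (finite part of the) logarithmic potential `∫ ln |z - w| dρ(w)`. -/
noncomputable def logPot (ρ : Measure ℂ) (z : ℂ) : ℝ := ∫ w, Real.log ‖z - w‖ ∂ρ

lemma continuous_ell {η : ℝ} (hη : 0 < η) : Continuous (ell η) := by
  unfold ell
  refine continuous_const.mul (Continuous.log (by fun_prop) fun z => ?_)
  positivity

lemma ell_neg (η : ℝ) (z : ℂ) : ell η (-z) = ell η z := by simp [ell]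

lemma ell_zero {η : ℝ} : ell η 0 = -Real.log η := by
  simp [ell]

lemma ell_le_neg_log (η : ℝ) {z : ℂ} (hz : z ≠ 0) : ell η z ≤ -Real.log ‖z‖ := by
  have hz' : 0 < ‖z‖ := norm_pos_iff.2 hz
  have : Real.log (‖z‖ ^ 2) ≤ Real.log (‖z‖ ^ 2 + η ^ 2) :=
    Real.log_le_log (by positivity) (by nlinarith [sq_nonneg η])
  rw [Real.log_pow] at this
  unfold ell
  push_cast at this
  linarith

lemma norm_le_exp_neg_ell (η : ℝ) (z : ℂ) : ‖z‖ ≤ Real.exp (-ell η z) := by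
  rcases eq_or_ne z 0 with rfl | hz
  · simp [Real.exp_nonneg]
  · rw [← Real.log_le_iff_le_exp (norm_pos_iff.2 hz)]
    linarith [ell_le_neg_log η hz]

lemma ell_le {η : ℝ} (hη : 0 < η) (z : ℂ) : ell η z ≤ -Real.log η := by
  have : Real.log (η ^ 2) ≤ Real.log (‖z‖ ^ 2 + η ^ 2) :=
    Real.log_le_log (by positivity) (by nlinarith [sq_nonneg ‖z‖])
  rw [Real.log_pow] at this
  unfold ell
  push_cast at this
  linarith

lemma neg_ell_le {η : ℝ} (hη : 0 < η) (z : ℂ) : -ell η z ≤ ‖z‖ + η := by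
  have h0 : 0 ≤ ‖z‖ := norm_nonneg z
  have : Real.log (‖z‖ ^ 2 + η ^ 2) ≤ Real.log ((‖z‖ + η) ^ 2) :=
    Real.log_le_log (by positivity) (by nlinarith)
  rw [Real.log_pow] at this
  have h2 := Real.log_le_self (add_nonneg h0 hη.le)
  unfold ell
  push_cast at this
  linarith

lemma abs_ell_le {η : ℝ} (hη : 0 < η) (z : ℂ) : |ell η z| ≤ |Real.log η| + ‖z‖ + η := by
  have h0 : 0 ≤ ‖z‖ := norm_nonneg z
  rw [abs_le]
  constructor
  · linarith [neg_ell_le hη z, abs_nonneg (Real.log η)]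
  · linarith [ell_le hη z, neg_le_abs (Real.log η)]

/-- The regularisation error is measured by `|z|^(-1/2)`, which is integrable along a curve, so
regular measures feel an error `O(√η)` uniformly. At `z = 0` the convention `log 0 = 0` makes `η ≤
1` necessary. -/
lemma neg_log_le_ell_add {η : ℝ} (hη : 0 < η) (hη1 : η ≤ 1) (z : ℂ) :
    -Real.log ‖z‖ ≤ ell η z + 2 * √η * ‖z‖ ^ (-(1 / 2) : ℝ) := by
  rcases eq_or_ne z 0 with rfl | hz
  · rw [ell_zero]
    have := Real.log_nonpos hη.le hη1
    have h2 : (0 : ℝ) ≤ ‖(0 : ℂ)‖ ^ (-(1 / 2) : ℝ) := Real.rpow_nonneg (norm_nonneg _) _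
    have h3 : 0 ≤ 2 * √η * ‖(0 : ℂ)‖ ^ (-(1 / 2) : ℝ) := by positivity
    simp only [norm_zero, Real.log_zero, neg_zero] at *
    linarith
  · have hr : 0 < ‖z‖ := norm_pos_iff.2 hz
    set r := ‖z‖ with hrdef
    -- With `x = √(η / r)`, `r (1 + x)² = r + η + 2xr` dominates `√(r² + η²)`; then `log (1 + x) ≤
    -- x` gives the error `2x`.
    set x := √η * r ^ (-(1 / 2) : ℝ) with hx
    have hx0 : 0 < x := by positivity
    have hx2 : x ^ 2 * r = η := by
      rw [hx, mul_pow, Real.sq_sqrt hη.le, ← Real.rpow_natCast (r ^ _), ← Real.rpow_mul hr.le]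
      norm_num
      rw [Real.rpow_neg_one]
      field_simp
    have h1 : r ^ 2 + η ^ 2 ≤ (r * (1 + x) ^ 2) ^ 2 := by
      rw [← hx2]
      have : r * (1 + x) ^ 2 = r + x ^ 2 * r + 2 * x * r := by ring
      rw [this]
      have ha : 0 < x ^ 2 * r := by positivity
      have hb : 0 < 2 * x * r := by positivity
      nlinarith [mul_pos hr ha, mul_pos hr hb, mul_pos ha hb]
    have h2 : Real.log (r ^ 2 + η ^ 2) ≤ Real.log ((r * (1 + x) ^ 2) ^ 2) :=
      Real.log_le_log (by positivity) h1
    rw [Real.log_pow, Real.log_mul hr.ne' (by positivity), Real.log_pow] at h2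
    have h3 : Real.log (1 + x) ≤ x := by
      have := Real.log_le_sub_one_of_pos (show 0 < 1 + x by linarith)
      linarith
    unfold ell
    rw [← hrdef]
    push_cast at h2
    rw [show 2 * √η * r ^ (-(1 / 2) : ℝ) = 2 * x by rw [hx]; ring]
    linarith

/-! ### Measures of bounded support and the positivity of the regularised energy -/

/-- `ρ` is a probability measure carried by the closed disc of radius `R`. -/
structure IsProbIn (R : ℝ) (ρ : Measure ℂ) : Prop where
  isProbabilityMeasure : IsProbabilityMeasure ρ
  carried : ∀ᵐ w ∂ρ, ‖w‖ ≤ R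

lemma IsProbIn.mono {R R' : ℝ} {ρ : Measure ℂ} (h : IsProbIn R ρ) (hR : R ≤ R') : IsProbIn R' ρ :=
  ⟨h.1, h.2.mono fun _ hw => hw.trans hR⟩

lemma IsProbIn.dirac {R : ℝ} {z : ℂ} (hz : ‖z‖ ≤ R) : IsProbIn R (Measure.dirac z) :=
  ⟨inferInstance, by rw [ae_dirac_eq]; exact hz⟩

section

variable {R η : ℝ} {ρ : Measure ℂ}

lemma IsProbIn.integrable_ell (h : IsProbIn R ρ) (hη : 0 < η) (z : ℂ) :
    Integrable (fun w => ell η (z - w)) ρ := by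
  have := h.1
  refine Integrable.of_bound
    ((continuous_ell hη).comp (by fun_prop)).aestronglyMeasurable
    (|Real.log η| + (‖z‖ + R) + η) (h.2.mono fun w hw => ?_)
  have := abs_ell_le hη (z - w)
  have := norm_sub_le z w
  rw [Real.norm_eq_abs]
  linarith

lemma IsProbIn.continuous_ellPot (h : IsProbIn R ρ) (hη : 0 < η) : Continuous (ellPot η ρ) := by
  have := h.1
  refine continuous_iff_continuousAt.2 fun z₀ => ?_
  refine continuousAt_of_dominated (bound := fun _ => |Real.log η| + (‖z₀‖ + 1 + R) + η)
    (Eventually.of_forall fun z =>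
      ((continuous_ell hη).comp (by fun_prop)).aestronglyMeasurable) ?_
    (integrable_const _)
    (Eventually.of_forall fun w => ((continuous_ell hη).comp (by fun_prop)).continuousAt)
  filter_upwards [Metric.ball_mem_nhds z₀ one_pos] with z hz
  refine h.2.mono fun w hw => ?_
  have h1 := abs_ell_le hη (z - w)
  have h2 := norm_sub_le z w
  have h3 : ‖z‖ ≤ ‖z₀‖ + 1 := by
    have := norm_le_norm_add_norm_sub' z z₀
    rw [Metric.mem_ball, dist_eq_norm] at hz
    linarith
  rw [Real.norm_eq_abs]
  linarith

lemma IsProbIn.ellPot_le (h : IsProbIn R ρ) (hη : 0 < η) (z : ℂ) : ellPot η ρ z ≤ -Real.log η := by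
  have := h.1
  calc ellPot η ρ z ≤ ∫ _w, -Real.log η ∂ρ :=
        integral_mono (h.integrable_ell hη z) (integrable_const _) fun w => ell_le hη _
    _ = -Real.log η := by simp

lemma IsProbIn.neg_ellPot_le (h : IsProbIn R ρ) (hη : 0 < η) (z : ℂ) :
    -ellPot η ρ z ≤ ‖z‖ + R + η := by
  have := h.1
  calc -ellPot η ρ z = ∫ w, -ell η (z - w) ∂ρ := by rw [integral_neg]; rfl
    _ ≤ ∫ _w, (‖z‖ + R + η) ∂ρ := by
        refine integral_mono_ae (h.integrable_ell hη z).neg (integrable_const _)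
          (h.2.mono fun w hw => ?_)
        have := neg_ell_le hη (z - w)
        have := norm_sub_le z w
        simp only
        linarith
    _ = ‖z‖ + R + η := by simp

lemma IsProbIn.integrable_ellPot (h : IsProbIn R ρ) (hη : 0 < η) {R' : ℝ} {P : Measure ℂ}
    (hP : IsProbIn R' P) : Integrable (ellPot η ρ) P := by
  have := hP.1
  refine Integrable.of_bound (h.continuous_ellPot hη).aestronglyMeasurable
    (|Real.log η| + (R' + |R|) + η) (hP.2.mono fun z hz => ?_)
  rw [Real.norm_eq_abs, abs_le]
  constructor
  · linarith [h.neg_ellPot_le hη z, le_abs_self R, abs_nonneg (Real.log η)]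
  · linarith [h.ellPot_le hη z, neg_le_abs (Real.log η), norm_nonneg z, abs_nonneg R]

/-- The mutual regularised energy of two measures. -/
noncomputable def ellEnergy (η : ℝ) (P M : Measure ℂ) : ℝ := ∫ z, ellPot η M z ∂P

lemma ellEnergy_comm (hη : 0 < η) {R R' : ℝ} {P M : Measure ℂ} (hP : IsProbIn R P)
    (hM : IsProbIn R' M) : ellEnergy η P M = ellEnergy η M P := by
  have := hP.1
  have := hM.1
  unfold ellEnergy ellPot
  rw [integral_integral_swap]
  · refine integral_congr_ae (Eventually.of_forall fun z => ?_)
    refine integral_congr_ae (Eventually.of_forall fun w => ?_)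
    simp only
    rw [← ell_neg, neg_sub]
  · refine Integrable.of_bound
      ((continuous_ell hη).comp (by fun_prop)).aestronglyMeasurable
      (|Real.log η| + (R + R') + η) ?_
    have h1 : ∀ᵐ p ∂(P.prod M), ‖p.1‖ ≤ R := Measure.quasiMeasurePreserving_fst.ae hP.2
    have h2 : ∀ᵐ p ∂(P.prod M), ‖p.2‖ ≤ R' := Measure.quasiMeasurePreserving_snd.ae hM.2
    filter_upwards [h1, h2] with p hp1 hp2
    have h1 := abs_ell_le hη (p.1 - p.2)
    have h2 := norm_sub_le p.1 p.2
    rw [Real.norm_eq_abs]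
    simp only [Function.uncurry]
    linarith

lemma ellEnergy_dirac (η : ℝ) (z : ℂ) (M : Measure ℂ) :
    ellEnergy η (Measure.dirac z) M = ellPot η M z := by
  simp [ellEnergy]

variable {ι : Type*} [Fintype ι] {P : ι → Measure ℂ}

/-- The regularised energy of a signed measure decreases with the regularisation parameter. -/
lemma sum_ellEnergy_anti {η' : ℝ} (hη' : 0 < η') (hle : η' ≤ η) (hP : ∀ i, IsProbIn R (P i))
    (c : ι → ℝ) :
    ∑ i, ∑ j, c i * c j * ellEnergy η (P i) (P j) ≤
      ∑ i, ∑ j, c i * c j * ellEnergy η' (P i) (P j) := by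
  have hη : 0 < η := hη'.trans_le hle
  have := fun i => (hP i).1
  have key := log_ratio_sum_nonneg (a := η' ^ 2) (b := η ^ 2) (by positivity) (by gcongr) P c
  have e : ∀ i j, ∫ z, ∫ w, Real.log ((‖z - w‖ ^ 2 + η ^ 2) / (‖z - w‖ ^ 2 + η' ^ 2)) ∂(P j) ∂(P i) =
      2 * (ellEnergy η' (P i) (P j) - ellEnergy η (P i) (P j)) := by
    intro i j
    have e1 : ∀ z w : ℂ, Real.log ((‖z - w‖ ^ 2 + η ^ 2) / (‖z - w‖ ^ 2 + η' ^ 2)) =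
        2 * (ell η' (z - w) - ell η (z - w)) := by
      intro z w
      rw [Real.log_div (by positivity) (by positivity)]
      unfold ell
      ring
    simp only [e1, integral_const_mul]
    congr 1
    unfold ellEnergy
    rw [← integral_sub ((hP j).integrable_ellPot hη' (hP i)) ((hP j).integrable_ellPot hη (hP i))]
    refine integral_congr_ae (Eventually.of_forall fun z => ?_)
    exact integral_sub ((hP j).integrable_ell hη' z) ((hP j).integrable_ell hη z)
  simp only [e] at key
  have e2 : ∑ i, ∑ j, c i * c j * (2 * (ellEnergy η' (P i) (P j) - ellEnergy η (P i) (P j))) =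
      2 * (∑ i, ∑ j, c i * c j * ellEnergy η' (P i) (P j) -
        ∑ i, ∑ j, c i * c j * ellEnergy η (P i) (P j)) := by
    rw [← Finset.sum_sub_distrib, Finset.mul_sum]
    refine Finset.sum_congr rfl fun i _ => ?_
    rw [← Finset.sum_sub_distrib, Finset.mul_sum]
    exact Finset.sum_congr rfl fun j _ => by ring
  rw [e2] at key
  linarith

/-- The regularised energy of a neutral signed measure is nonnegative. -/
lemma sum_ellEnergy_nonneg (hη : 0 < η) (hP : ∀ i, IsProbIn R (P i)) (c : ι → ℝ)
    (hc : ∑ i, c i = 0) :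
    0 ≤ ∑ i, ∑ j, c i * c j * ellEnergy η (P i) (P j) := by
  have := fun i => (hP i).1
  set T : ℝ := ∑ i, ∑ j, |c i * c j| with hT
  -- Shifted by `log b`, the kernel `ell b` tends to zero uniformly on bounded sets as `b → ∞`.
  have hshift : ∀ b : ℝ, 0 < b → ∀ i j,
      |ellEnergy b (P i) (P j) + Real.log b| ≤ (2 * R) ^ 2 / b ^ 2 := by
    intro b hb i j
    have h1 : ellEnergy b (P i) (P j) + Real.log b =
        ∫ z, ∫ w, (ell b (z - w) + Real.log b) ∂(P j) ∂(P i) := by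
      have : ∀ z, ∫ w, (ell b (z - w) + Real.log b) ∂(P j) = ellPot b (P j) z + Real.log b := by
        intro z
        rw [integral_add ((hP j).integrable_ell hb z) (integrable_const _)]
        simp [ellPot]
      simp only [this]
      rw [integral_add ((hP j).integrable_ellPot hb (hP i)) (integrable_const _)]
      simp [ellEnergy]
    rw [h1, ← Real.norm_eq_abs]
    refine (norm_integral_le_of_norm_le_const (C := (2 * R) ^ 2 / b ^ 2)
      ((hP i).2.mono fun z hz => ?_)).trans (by simp)
    refine (norm_integral_le_of_norm_le_const (C := (2 * R) ^ 2 / b ^ 2)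
      ((hP j).2.mono fun w hw => ?_)).trans (by simp)
    have hzw : ‖z - w‖ ≤ 2 * R := by linarith [norm_sub_le z w]
    have e : ell b (z - w) + Real.log b = -(1 / 2) * Real.log (1 + ‖z - w‖ ^ 2 / b ^ 2) := by
      have : 1 + ‖z - w‖ ^ 2 / b ^ 2 = (‖z - w‖ ^ 2 + b ^ 2) / b ^ 2 := by field_simp; ring
      rw [this, Real.log_div (by positivity) (by positivity), Real.log_pow]
      unfold ell
      push_cast
      ring
    rw [e, Real.norm_eq_abs, abs_mul]
    have h2 : 0 ≤ ‖z - w‖ ^ 2 / b ^ 2 := by positivity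
    have h3 : Real.log (1 + ‖z - w‖ ^ 2 / b ^ 2) ≤ ‖z - w‖ ^ 2 / b ^ 2 := by
      have := Real.log_le_sub_one_of_pos (show 0 < 1 + ‖z - w‖ ^ 2 / b ^ 2 by linarith)
      linarith
    have h4 : 0 ≤ Real.log (1 + ‖z - w‖ ^ 2 / b ^ 2) := Real.log_nonneg (by linarith)
    rw [abs_of_nonneg h4]
    have h5 : ‖z - w‖ ^ 2 / b ^ 2 ≤ (2 * R) ^ 2 / b ^ 2 := by gcongr
    norm_num
    linarith
  -- Neutrality makes the shift by `log b` invisible, so the form is almost nonnegative for large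
  -- `b`. Monotonicity in the regularisation parameter carries this back to `η`.
  have hlow : ∀ b : ℝ, 0 < b → -(T * ((2 * R) ^ 2 / b ^ 2)) ≤
      ∑ i, ∑ j, c i * c j * ellEnergy b (P i) (P j) := by
    intro b hb
    have e : ∑ i, ∑ j, c i * c j * ellEnergy b (P i) (P j) =
        ∑ i, ∑ j, c i * c j * (ellEnergy b (P i) (P j) + Real.log b) := by
      have : ∑ i, ∑ j, c i * c j * Real.log b = 0 := by
        simp only [← Finset.sum_mul, ← Finset.mul_sum, hc, mul_zero, Finset.sum_const_zero, zero_mul]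
      simp only [mul_add, Finset.sum_add_distrib, this, add_zero]
    rw [e, hT, Finset.sum_mul, ← Finset.sum_neg_distrib]
    refine Finset.sum_le_sum fun i _ => ?_
    rw [Finset.sum_mul, ← Finset.sum_neg_distrib]
    refine Finset.sum_le_sum fun j _ => ?_
    have h1 := neg_abs_le (c i * c j * (ellEnergy b (P i) (P j) + Real.log b))
    rw [abs_mul] at h1
    have h2 := mul_le_mul_of_nonneg_left (hshift b hb i j) (abs_nonneg (c i * c j))
    linarith
  have hlim : Tendsto (fun b : ℝ => -(T * ((2 * R) ^ 2 / b ^ 2))) atTop (𝓝 0) := by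
    have : Tendsto (fun b : ℝ => (2 * R) ^ 2 / b ^ 2) atTop (𝓝 0) :=
      tendsto_const_nhds.div_atTop (tendsto_pow_atTop two_ne_zero)
    simpa using (this.const_mul T).neg
  refine le_of_tendsto hlim ?_
  filter_upwards [eventually_ge_atTop η] with b hb
  exact (hlow b (hη.trans_le hb)).trans (sum_ellEnergy_anti hη hb hP c)

end

/-! ### Logarithmic potentials of regular measures -/

/-- A probability measure without atoms, carried by the closed disc of radius `R`, whose potential
for the kernel `|z - w|^(-1/2)` is bounded by `A`. -/
structure IsRegular (R A : ℝ) (ρ : Measure ℂ) : Prop extends IsProbIn R ρ where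
  singleton_eq_zero : ∀ z, ρ {z} = 0
  pot_le : ∀ z, ∫⁻ w, ENNReal.ofReal (‖z - w‖ ^ (-(1 / 2) : ℝ)) ∂ρ ≤ ENNReal.ofReal A
  nonneg : 0 ≤ A

namespace IsRegular

variable {R A η : ℝ} {ρ : Measure ℂ}

lemma measurable_rpow (z : ℂ) : Measurable fun w : ℂ => ‖z - w‖ ^ (-(1 / 2) : ℝ) :=
  (measurable_const.sub measurable_id).norm.pow_const _

lemma measurable_log : Measurable fun p : ℂ × ℂ => Real.log ‖p.1 - p.2‖ :=
  Real.measurable_log.comp (measurable_fst.sub measurable_snd).norm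

lemma integrable_rpow (h : IsRegular R A ρ) (z : ℂ) :
    Integrable (fun w => ‖z - w‖ ^ (-(1 / 2) : ℝ)) ρ := by
  refine ⟨(measurable_rpow z).aestronglyMeasurable, ?_⟩
  rw [hasFiniteIntegral_iff_ofReal
    (Eventually.of_forall fun w => Real.rpow_nonneg (norm_nonneg _) _)]
  exact (h.pot_le z).trans_lt ENNReal.ofReal_lt_top

lemma integral_rpow_le (h : IsRegular R A ρ) (z : ℂ) :
    ∫ w, ‖z - w‖ ^ (-(1 / 2) : ℝ) ∂ρ ≤ A := by
  rw [integral_eq_lintegral_of_nonneg_ae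
    (Eventually.of_forall fun w => Real.rpow_nonneg (norm_nonneg _) _) (measurable_rpow z).aestronglyMeasurable]
  exact ENNReal.toReal_le_of_le_ofReal h.nonneg (h.pot_le z)

lemma ae_ne (h : IsRegular R A ρ) (z : ℂ) : ∀ᵐ w ∂ρ, z - w ≠ 0 := by
  have : ∀ᵐ w ∂ρ, w ≠ z := by simp [ae_iff, h.singleton_eq_zero z]
  exact this.mono fun w hw => sub_ne_zero.2 hw.symm

lemma abs_log_le (z : ℂ) : |Real.log ‖z‖| ≤ ‖z‖ + 2 * ‖z‖ ^ (-(1 / 2) : ℝ) := by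
  have h1 := neg_log_le_ell_add one_pos le_rfl z
  have h2 := ell_le one_pos z
  have h3 := Real.log_le_self (norm_nonneg z)
  have h4 : (0 : ℝ) ≤ ‖z‖ ^ (-(1 / 2) : ℝ) := Real.rpow_nonneg (norm_nonneg _) _
  simp only [Real.log_one, Real.sqrt_one] at *
  rw [abs_le]
  constructor <;> linarith [norm_nonneg z]

lemma integrable_norm_sub (h : IsRegular R A ρ) (z : ℂ) : Integrable (fun w => ‖z - w‖) ρ := by
  have := h.isProbabilityMeasure
  refine Integrable.of_bound (by fun_prop) (‖z‖ + R) (h.carried.mono fun w hw => ?_)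
  rw [norm_norm]
  linarith [norm_sub_le z w]

lemma integrable_log (h : IsRegular R A ρ) (z : ℂ) :
    Integrable (fun w => Real.log ‖z - w‖) ρ :=
  ((h.integrable_norm_sub z).add ((h.integrable_rpow z).const_mul 2)).mono'
    (measurable_log.comp (measurable_const.prodMk measurable_id)).aestronglyMeasurable
    (Eventually.of_forall fun w => abs_log_le (z - w))

lemma integral_abs_log_le (h : IsRegular R A ρ) (z : ℂ) :
    ∫ w, |Real.log ‖z - w‖| ∂ρ ≤ ‖z‖ + R + 2 * A := by
  have := h.isProbabilityMeasure
  have h1 : ∫ w, ‖z - w‖ ∂ρ ≤ ∫ _w, (‖z‖ + R) ∂ρ :=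
    integral_mono_ae (h.integrable_norm_sub z) (integrable_const _) (h.carried.mono fun w hw => by
      simp only
      linarith [norm_sub_le z w])
  calc ∫ w, |Real.log ‖z - w‖| ∂ρ
      ≤ ∫ w, (‖z - w‖ + 2 * ‖z - w‖ ^ (-(1 / 2) : ℝ)) ∂ρ :=
        integral_mono (h.integrable_log z).abs
          ((h.integrable_norm_sub z).add ((h.integrable_rpow z).const_mul 2))
          fun w => abs_log_le (z - w)
    _ = ∫ w, ‖z - w‖ ∂ρ + 2 * ∫ w, ‖z - w‖ ^ (-(1 / 2) : ℝ) ∂ρ := by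
        rw [integral_add (h.integrable_norm_sub z) ((h.integrable_rpow z).const_mul 2),
          integral_const_mul]
    _ ≤ ‖z‖ + R + 2 * A := by
        simp only [integral_const, probReal_univ, one_smul] at h1
        linarith [h.integral_rpow_le z]

lemma ellPot_le_neg_logPot (h : IsRegular R A ρ) (hη : 0 < η) (z : ℂ) :
    ellPot η ρ z ≤ -logPot ρ z := by
  unfold logPot
  rw [← integral_neg]
  exact integral_mono_ae (h.integrable_ell hη z) (h.integrable_log z).neg
    ((h.ae_ne z).mono fun w hw => ell_le_neg_log η hw)

lemma neg_logPot_le (h : IsRegular R A ρ) (hη : 0 < η) (hη1 : η ≤ 1) (z : ℂ) :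
    -logPot ρ z ≤ ellPot η ρ z + 2 * √η * A := by
  have h1 : -logPot ρ z ≤ ∫ w, (ell η (z - w) + 2 * √η * ‖z - w‖ ^ (-(1 / 2) : ℝ)) ∂ρ := by
    unfold logPot
    rw [← integral_neg]
    exact integral_mono (h.integrable_log z).neg
      ((h.integrable_ell hη z).add ((h.integrable_rpow z).const_mul _))
      fun w => neg_log_le_ell_add hη hη1 (z - w)
  rw [integral_add (h.integrable_ell hη z) ((h.integrable_rpow z).const_mul _),
    integral_const_mul] at h1
  have h2 := mul_le_mul_of_nonneg_left (h.integral_rpow_le z) (show 0 ≤ 2 * √η by positivity)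
  unfold ellPot
  linarith

lemma logPot_le (h : IsRegular R A ρ) (z : ℂ) : logPot ρ z ≤ ‖z‖ + R + 2 * A :=
  (integral_mono (h.integrable_log z) (h.integrable_log z).abs fun _ => le_abs_self _).trans
    (h.integral_abs_log_le z)

/-- The potential is the uniform limit of the continuous regularised potentials, with error `2 √η
A`. -/
lemma continuous_logPot (h : IsRegular R A ρ) : Continuous (logPot ρ) := by
  have hu : TendstoUniformly (fun (n : ℕ) z => -ellPot (1 / ((n : ℝ) + 1)) ρ z) (logPot ρ) atTop := by
    rw [Metric.tendstoUniformly_iff]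
    intro ε hε
    have hlim : Tendsto (fun n : ℕ => 2 * √(1 / ((n : ℝ) + 1)) * A) atTop (𝓝 0) := by
      have := (Real.continuous_sqrt.tendsto 0).comp (tendsto_one_div_add_atTop_nhds_zero_nat (𝕜 := ℝ))
      simpa using (this.const_mul 2).mul_const A
    filter_upwards [hlim.eventually (gt_mem_nhds hε)] with n hn z
    have h0 : 0 < 1 / ((n : ℝ) + 1) := by positivity
    have h1 : 1 / ((n : ℝ) + 1) ≤ 1 := by
      rw [div_le_one (by positivity)]
      linarith [(Nat.cast_nonneg n : (0 : ℝ) ≤ n)]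
    have h2 := h.ellPot_le_neg_logPot h0 z
    have h3 := h.neg_logPot_le h0 h1 z
    rw [Real.dist_eq, abs_lt]
    constructor <;> linarith
  exact hu.continuous (Frequently.of_forall fun n => (h.continuous_ellPot (by positivity)).neg)

lemma integrable_logPot (h : IsRegular R A ρ) {R' : ℝ} {P : Measure ℂ} (hP : IsProbIn R' P) :
    Integrable (logPot ρ) P := by
  have := hP.1
  refine Integrable.of_bound h.continuous_logPot.aestronglyMeasurable
    (R' + R + 2 * A) (hP.2.mono fun z hz => ?_)
  refine (norm_integral_le_integral_norm _).trans ?_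
  simp only [Real.norm_eq_abs]
  linarith [h.integral_abs_log_le z]

/-- The logarithm of the distance is integrable for the product of a regular measure with a measure
of bounded support. -/
lemma integrable_log_prod (h : IsRegular R A ρ) {R' : ℝ} {P : Measure ℂ} (hP : IsProbIn R' P) :
    Integrable (fun p : ℂ × ℂ => Real.log ‖p.1 - p.2‖) (P.prod ρ) := by
  have := hP.1
  have := h.isProbabilityMeasure
  rw [integrable_prod_iff measurable_log.aestronglyMeasurable]
  refine ⟨Eventually.of_forall fun z => h.integrable_log z, ?_⟩
  refine Integrable.of_bound (C := R' + R + 2 * A) ?_ (hP.2.mono fun z hz => ?_)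
  · exact (measurable_log.norm.aestronglyMeasurable (μ := P.prod ρ)).integral_prod_right'
  · rw [Real.norm_eq_abs, abs_of_nonneg (integral_nonneg fun _ => norm_nonneg _)]
    simp only [Real.norm_eq_abs]
    linarith [h.integral_abs_log_le z]

end IsRegular

/-! ### Regular measures on curves -/

/-- The bound is uniform in `y`: the integrand is at most `1` at distance at least `1` from `y`, and
each unit interval next to `y` contributes `2`. -/
lemma lintegral_rpow_Icc_le {a b : ℝ} (y : ℝ) :
    ∫⁻ x in Set.Icc a b, ENNReal.ofReal (|y - x| ^ (-(1 / 2) : ℝ)) ≤ ENNReal.ofReal (|b - a| + 4) := by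
  have hr : (-1 : ℝ) < -(1 / 2) := by norm_num
  have half : ∀ (f : ℝ → ℝ) (p q : ℝ), p ≤ q → IntervalIntegrable f volume p q →
      (∀ x, 0 ≤ f x) → ∫ x in p..q, f x = 2 →
      ∫⁻ x in Set.Ioc p q, ENNReal.ofReal (f x) = ENNReal.ofReal 2 := by
    intro f p q hpq hf hf0 hval
    rw [← ofReal_integral_eq_lintegral_ofReal ((intervalIntegrable_iff_integrableOn_Ioc_of_le hpq).1 hf)
      (Eventually.of_forall hf0), ← intervalIntegral.integral_of_le hpq, hval]
  have hone : ∫ x in (0 : ℝ)..1, x ^ (-(1 / 2) : ℝ) = 2 := by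
    rw [integral_rpow (Or.inl hr)]
    norm_num
  have hint : IntervalIntegrable (fun x : ℝ => x ^ (-(1 / 2) : ℝ)) volume 0 1 :=
    intervalIntegral.intervalIntegrable_rpow' hr
  have hcong : ∀ x ∈ Set.uIoc (0 : ℝ) 1, x ^ (-(1 / 2) : ℝ) = |x| ^ (-(1 / 2) : ℝ) := fun x hx => by
    rw [Set.uIoc_of_le zero_le_one] at hx
    rw [abs_of_pos hx.1]
  have hint' : IntervalIntegrable (fun x : ℝ => |x| ^ (-(1 / 2) : ℝ)) volume 0 1 :=
    hint.congr hcong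
  have hone' : ∫ x in (0 : ℝ)..1, |x| ^ (-(1 / 2) : ℝ) = 2 := by
    refine Eq.trans ?_ hone
    exact intervalIntegral.integral_congr_ae (Eventually.of_forall fun x hx => (hcong x hx).symm)
  have h1 : ∫⁻ x in Set.Ioc (y - 1) y, ENNReal.ofReal (|y - x| ^ (-(1 / 2) : ℝ)) =
      ENNReal.ofReal 2 := by
    refine half _ _ _ (by linarith) ?_ (fun x => by positivity) ?_
    · simpa using (hint'.comp_sub_left y).symm
    · rw [intervalIntegral.integral_comp_sub_left (fun x => |x| ^ (-(1 / 2) : ℝ))]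
      simpa using hone'
  have h2 : ∫⁻ x in Set.Ioc y (y + 1), ENNReal.ofReal (|y - x| ^ (-(1 / 2) : ℝ)) =
      ENNReal.ofReal 2 := by
    simp only [abs_sub_comm y]
    refine half _ _ _ (by linarith) ?_ (fun x => by positivity) ?_
    · simpa [add_comm] using (hint'.comp_sub_right y)
    · rw [intervalIntegral.integral_comp_sub_right (fun x => |x| ^ (-(1 / 2) : ℝ))]
      simpa using hone'
  have hpt : ∀ x, ENNReal.ofReal (|y - x| ^ (-(1 / 2) : ℝ)) ≤ 1 +
      ((Set.Ioc (y - 1) y).indicator (fun x => ENNReal.ofReal (|y - x| ^ (-(1 / 2) : ℝ))) x +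
      (Set.Ioc y (y + 1)).indicator (fun x => ENNReal.ofReal (|y - x| ^ (-(1 / 2) : ℝ))) x) := by
    intro x
    by_cases hx1 : x ∈ Set.Ioc (y - 1) y
    · rw [Set.indicator_of_mem hx1]
      exact le_add_left le_self_add
    by_cases hx2 : x ∈ Set.Ioc y (y + 1)
    · rw [Set.indicator_of_mem hx2]
      exact le_add_left le_add_self
    refine le_add_right ?_
    have hx : 1 ≤ |y - x| := by
      rw [le_abs]
      by_contra hcon
      push Not at hcon
      rcases le_or_gt x y with h | h
      · exact hx1 ⟨by linarith, h⟩
      · exact hx2 ⟨h, by linarith⟩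
    rw [← ENNReal.ofReal_one]
    refine ENNReal.ofReal_le_ofReal (Real.rpow_le_one_of_one_le_of_nonpos hx (by norm_num))
  calc ∫⁻ x in Set.Icc a b, ENNReal.ofReal (|y - x| ^ (-(1 / 2) : ℝ))
      ≤ ∫⁻ x in Set.Icc a b, (1 +
      ((Set.Ioc (y - 1) y).indicator (fun x => ENNReal.ofReal (|y - x| ^ (-(1 / 2) : ℝ))) x +
      (Set.Ioc y (y + 1)).indicator (fun x => ENNReal.ofReal (|y - x| ^ (-(1 / 2) : ℝ))) x)) :=
        lintegral_mono hpt
    _ = volume (Set.Icc a b) + ∫⁻ x in Set.Icc a b,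
      ((Set.Ioc (y - 1) y).indicator (fun x => ENNReal.ofReal (|y - x| ^ (-(1 / 2) : ℝ))) x +
      (Set.Ioc y (y + 1)).indicator (fun x => ENNReal.ofReal (|y - x| ^ (-(1 / 2) : ℝ))) x) := by
        rw [lintegral_add_left measurable_const]
        simp
    _ ≤ volume (Set.Icc a b) + ∫⁻ x,
      ((Set.Ioc (y - 1) y).indicator (fun x => ENNReal.ofReal (|y - x| ^ (-(1 / 2) : ℝ))) x +
      (Set.Ioc y (y + 1)).indicator (fun x => ENNReal.ofReal (|y - x| ^ (-(1 / 2) : ℝ))) x) := by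
        gcongr
        exact Measure.restrict_le_self
    _ = volume (Set.Icc a b) + (ENNReal.ofReal 2 + ENNReal.ofReal 2) := by
        rw [lintegral_add_left, lintegral_indicator measurableSet_Ioc,
          lintegral_indicator measurableSet_Ioc, h1, h2]
        refine Measurable.indicator ?_ measurableSet_Ioc
        fun_prop
    _ ≤ ENNReal.ofReal (|b - a| + 4) := by
        rw [Real.volume_Icc, ← ENNReal.ofReal_add (by norm_num) (by norm_num),
          ENNReal.ofReal_add (abs_nonneg _) (by norm_num)]
        gcongr
        · exact le_abs_self _
        · norm_num

/-- The image, under a curve that does not contract distances on `[a, b]`, of a measure of bounded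
density on `[a, b]` is regular. -/
lemma isRegular_map {γ : ℝ → ℂ} (hγ : Continuous γ) {a b c d : ℝ} (hc : 0 < c)
    (hγc : ∀ x ∈ Set.Icc a b, ∀ y ∈ Set.Icc a b, c * |x - y| ≤ ‖γ x - γ y‖)
    {ν : Measure ℝ} [IsProbabilityMeasure ν]
    (hν : ν ≤ ENNReal.ofReal d • volume.restrict (Set.Icc a b)) :
    ∃ R A, IsRegular R A (ν.map γ) := by
  have hac : ν ≪ volume.restrict (Set.Icc a b) :=
    (Measure.absolutelyContinuous_of_le hν).trans Measure.smul_absolutelyContinuous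
  have hmem : ∀ᵐ x ∂ν, x ∈ Set.Icc a b := hac.ae_le (ae_restrict_mem measurableSet_Icc)
  have hne : ∀ y : ℝ, ∀ᵐ x ∂ν, x ≠ y := fun y => by
    have : ∀ᵐ x ∂(volume.restrict (Set.Icc a b)), x ≠ y :=
      ae_restrict_of_ae (by simp [ae_iff])
    exact hac.ae_le this
  have hnonempty : (Set.Icc a b).Nonempty := by
    obtain ⟨x, hx⟩ := hmem.exists
    exact ⟨x, hx⟩
  obtain ⟨R, hR⟩ := isCompact_Icc.exists_bound_of_continuousOn (hγ.continuousOn (s := Set.Icc a b))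
  refine ⟨R, |d| * ((c / 2) ^ (-(1 / 2) : ℝ) * (|b - a| + 4)), ⟨⟨?_, ?_⟩, ?_, ?_, by positivity⟩⟩
  · exact Measure.isProbabilityMeasure_map hγ.aemeasurable
  · rw [ae_map_iff hγ.aemeasurable (measurableSet_le (by fun_prop) (by fun_prop))]
    exact hmem.mono hR
  · intro z
    rw [Measure.map_apply hγ.measurable (measurableSet_singleton z), measure_eq_zero_iff_ae_notMem]
    by_cases hz : ∃ y ∈ Set.Icc a b, γ y = z
    · obtain ⟨y, hy, rfl⟩ := hz
      filter_upwards [hmem, hne y] with x hx hxy hmem'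
      have := hγc x hx y hy
      rw [Set.mem_preimage, Set.mem_singleton_iff] at hmem'
      rw [hmem', sub_self, norm_zero] at this
      have h2 : 0 < |x - y| := abs_pos.2 (sub_ne_zero.2 hxy)
      nlinarith
    · push Not at hz
      filter_upwards [hmem] with x hx
      exact hz x hx
  · intro z
    -- For `z` off the curve, use a nearest point `γ y`: since `|γ y - γ x| ≤ 2 |z - γ x|`, the
    -- constant `c` is only halved.
    obtain ⟨y, hy, hmin⟩ := isCompact_Icc.exists_isMinOn hnonempty
      (f := fun y => ‖z - γ y‖) (by fun_prop)
    have hlow : ∀ x ∈ Set.Icc a b, c / 2 * |y - x| ≤ ‖z - γ x‖ := by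
      intro x hx
      have h1 := hγc y hy x hx
      have h2 : ‖z - γ y‖ ≤ ‖z - γ x‖ := hmin hx
      have h3 : ‖γ y - γ x‖ ≤ ‖z - γ y‖ + ‖z - γ x‖ := by
        have : γ y - γ x = (z - γ x) - (z - γ y) := by ring
        rw [this]
        linarith [norm_sub_le (z - γ x) (z - γ y)]
      linarith
    rw [lintegral_map (IsRegular.measurable_rpow z).ennreal_ofReal hγ.measurable]
    calc ∫⁻ x, ENNReal.ofReal (‖z - γ x‖ ^ (-(1 / 2) : ℝ)) ∂ν
        ≤ ∫⁻ x, ENNReal.ofReal ((c / 2) ^ (-(1 / 2) : ℝ)) *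
            ENNReal.ofReal (|y - x| ^ (-(1 / 2) : ℝ)) ∂ν := by
          refine lintegral_mono_ae ?_
          filter_upwards [hmem, hne y] with x hx hxy
          rw [← ENNReal.ofReal_mul (by positivity), ← Real.mul_rpow (by positivity) (abs_nonneg _)]
          have hpos : 0 < |y - x| := abs_pos.2 (sub_ne_zero.2 hxy.symm)
          exact ENNReal.ofReal_le_ofReal (Real.rpow_le_rpow_of_nonpos (by positivity) (hlow x hx)
            (by norm_num))
      _ ≤ ∫⁻ x, ENNReal.ofReal ((c / 2) ^ (-(1 / 2) : ℝ)) *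
            ENNReal.ofReal (|y - x| ^ (-(1 / 2) : ℝ))
              ∂(ENNReal.ofReal d • volume.restrict (Set.Icc a b)) := lintegral_mono' hν le_rfl
      _ = ENNReal.ofReal d * (ENNReal.ofReal ((c / 2) ^ (-(1 / 2) : ℝ)) *
            ∫⁻ x in Set.Icc a b, ENNReal.ofReal (|y - x| ^ (-(1 / 2) : ℝ))) := by
          rw [lintegral_smul_measure, lintegral_const_mul _ (by fun_prop), smul_eq_mul]
      _ ≤ ENNReal.ofReal |d| * (ENNReal.ofReal ((c / 2) ^ (-(1 / 2) : ℝ)) *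
            ENNReal.ofReal (|b - a| + 4)) := by
          gcongr
          · exact le_abs_self d
          · exact lintegral_rpow_Icc_le y
      _ = _ := by
          rw [← ENNReal.ofReal_mul (by positivity), ← ENNReal.ofReal_mul (by positivity)]

/-! ### Product measures and Jensen's inequality -/

lemma lintegral_pi_prod {N : ℕ} {f : Fin N → ℝ → ℝ≥0∞} (hf : ∀ i, Measurable (f i)) :
    ∫⁻ x : Fin N → ℝ, ∏ i, f i (x i) = ∏ i, ∫⁻ t, f i t := by
  induction N with
  | zero => simp [volume_pi]
  | succ n ih =>
    have hmp := (volume_preserving_piFinSuccAbove (fun _ : Fin (n + 1) => ℝ) 0).symm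
    have hmeas : ∀ {k : ℕ} (F : Fin k → ℝ → ℝ≥0∞), (∀ i, Measurable (F i)) →
        Measurable fun y : Fin k → ℝ => ∏ i, F i (y i) := fun F hF =>
      Finset.measurable_fun_prod _ fun i _ => (hF i).comp (measurable_pi_apply i)
    rw [← hmp.lintegral_comp (hmeas f hf)]
    simp_rw [MeasurableEquiv.piFinSuccAbove_symm_apply, Fin.insertNthEquiv,
      Fin.prod_univ_succ, Fin.insertNth_zero, Equiv.coe_fn_mk, Fin.cons_succ, Fin.cons_zero,
      cast_eq]
    rw [Measure.volume_eq_prod, lintegral_prod_mul (f := f 0)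
      (g := fun y : Fin n → ℝ => ∏ i : Fin n, f i.succ (y i)) (hf 0).aemeasurable
      (hmeas (fun i => f i.succ) fun i => hf i.succ).aemeasurable, ih fun i => hf _]

lemma pi_withDensity_eq (N : ℕ) {g : ℝ → ℝ} (hg : Measurable g) :
    Measure.pi (fun _ : Fin N => (volume : Measure ℝ).withDensity fun t => ENNReal.ofReal (g t)) =
      (volume : Measure (Fin N → ℝ)).withDensity fun x => ∏ i, ENNReal.ofReal (g (x i)) := by
  have hm : Measurable fun t => ENNReal.ofReal (g t) := hg.ennreal_ofReal
  have : SigmaFinite ((volume : Measure ℝ).withDensity fun t => ENNReal.ofReal (g t)) :=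
    SigmaFinite.withDensity_ofReal _
  refine Measure.pi_eq fun s hs => ?_
  rw [withDensity_apply _ (MeasurableSet.univ_pi hs), ← lintegral_indicator (MeasurableSet.univ_pi hs)]
  have e : ∀ x : Fin N → ℝ, (Set.univ.pi s).indicator (fun x => ∏ i, ENNReal.ofReal (g (x i))) x =
      ∏ i, (s i).indicator (fun t => ENNReal.ofReal (g t)) (x i) := by
    intro x
    by_cases hx : x ∈ Set.univ.pi s
    · rw [Set.indicator_of_mem hx]
      exact Finset.prod_congr rfl fun i _ => by rw [Set.indicator_of_mem (hx i trivial)]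
    · rw [Set.indicator_of_notMem hx]
      obtain ⟨i, hi⟩ : ∃ i, x i ∉ s i := by
        by_contra hcon
        push Not at hcon
        exact hx fun i _ => hcon i
      exact (Finset.prod_eq_zero (Finset.mem_univ i) (Set.indicator_of_notMem hi _)).symm
  simp only [e]
  rw [lintegral_pi_prod fun i => hm.indicator (hs i)]
  exact Finset.prod_congr rfl fun i _ => by
    rw [withDensity_apply _ (hs i), lintegral_indicator (hs i)]

lemma exp_integral_le_lintegral {X : Type*} [MeasurableSpace X] {P : Measure X}
    [IsProbabilityMeasure P] {f : X → ℝ} (hf : Integrable f P) :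
    ENNReal.ofReal (Real.exp (∫ x, f x ∂P)) ≤ ∫⁻ x, ENNReal.ofReal (Real.exp (f x)) ∂P := by
  by_cases h : Integrable (fun x => Real.exp (f x)) P
  · rw [← ofReal_integral_eq_lintegral_ofReal h (Eventually.of_forall fun x => (Real.exp_pos _).le)]
    exact ENNReal.ofReal_le_ofReal (convexOn_exp.map_integral_le Real.continuous_exp.continuousOn
      isClosed_univ (by simp) hf h)
  -- If the exponential is not integrable, the right-hand side is infinite and there is nothing to
  -- compare.
  · have : ∫⁻ x, ENNReal.ofReal (Real.exp (f x)) ∂P = ⊤ := by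
      by_contra hne
      refine h ⟨Real.continuous_exp.comp_aestronglyMeasurable hf.1, ?_⟩
      rw [hasFiniteIntegral_iff_ofReal (Eventually.of_forall fun x => (Real.exp_pos _).le)]
      exact lt_top_iff_ne_top.2 hne
    rw [this]
    exact le_top

lemma map_pi_pair {N : ℕ} (ν : Measure ℝ) [IsProbabilityMeasure ν] {a b : Fin N} (hab : a ≠ b) :
    (Measure.pi fun _ : Fin N => ν).map (fun x => (x a, x b)) = ν.prod ν := by
  have h1 := (ProbabilityTheory.iIndepFun_pi (μ := fun _ : Fin N => ν) (X := fun _ t => t)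
    fun _ => aemeasurable_id).indepFun hab
  have h2 := (ProbabilityTheory.indepFun_iff_map_prod_eq_prod_map_map
    (measurable_pi_apply a).aemeasurable (measurable_pi_apply b).aemeasurable).1 h1
  rw [h2]
  have := fun i : Fin N => (measurePreserving_eval (fun _ : Fin N => ν) i).map_eq
  congr 1
  · exact this a
  · exact this b

lemma sum_sum_Ioi {N : ℕ} (f : Fin N → Fin N → ℝ) (hf : ∀ a b, f a b = f b a) :
    ∑ a, ∑ b ∈ Finset.Ioi a, f a b = (∑ a, ∑ b, f a b - ∑ a, f a a) / 2 := by
  have h := Finset.sum_sum_Ioi_add_eq_sum_sum_off_diag f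
  have h1 : ∑ i, ∑ j ∈ Finset.Ioi i, (f j i + f i j) = 2 * ∑ a, ∑ b ∈ Finset.Ioi a, f a b := by
    simp only [Finset.mul_sum]
    exact Finset.sum_congr rfl fun i _ => Finset.sum_congr rfl fun j _ => by rw [hf j i]; ring
  have h2 : ∑ i, ∑ j ∈ ({i} : Finset (Fin N))ᶜ, f j i = ∑ a, ∑ b, f a b - ∑ a, f a a := by
    rw [← Finset.sum_sub_distrib]
    refine Finset.sum_congr rfl fun i _ => ?_
    rw [← Finset.sum_compl_add_sum ({i} : Finset (Fin N)) (fun b => f i b), Finset.sum_singleton,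
      add_sub_cancel_right]
    exact Finset.sum_congr rfl fun j _ => hf j i
  linarith

lemma sum_sum_Ioi_one (N : ℕ) :
    ∑ a : Fin N, ∑ _b ∈ Finset.Ioi a, (1 : ℝ) = ((N : ℝ) ^ 2 - N) / 2 := by
  rw [sum_sum_Ioi (fun _ _ => (1 : ℝ)) fun _ _ => rfl]
  simp [sq]

/-! ### The gas on a curve: Boltzmann factor and discrepancy -/

/-- A probability measure on `[a, b]` with regular image under `γ` and with a density that is
dominated by a multiple of the arc length. -/
structure IsCharge (γ : ℝ → ℂ) (a b : ℝ) (ρ : Measure ℝ) : Prop where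
  isProbabilityMeasure : IsProbabilityMeasure ρ
  regular : ∃ R A, IsRegular R A (ρ.map γ)
  density : ∃ (g : ℝ → ℝ) (c : ℝ), Measurable g ∧ 0 < c ∧ (∀ t, 0 ≤ g t) ∧
    ρ = volume.withDensity (fun t => ENNReal.ofReal (g t)) ∧ (∀ t ∉ Set.Icc a b, g t = 0) ∧
    ∀ t, c * g t ≤ ‖deriv γ t‖

/-- The field on the curve `γ` is the sum of an effective field `E`, of the logarithmic potential
of the charge `ν` and of a constant; the effective field is nonnegative, zero on `[0, 1]`, and
confining. -/
structure IsEffectiveField (V : ℂ[X]) (γ : ℝ → ℂ) (ν : Measure ℝ) (E : ℝ → ℝ) (C₀ : ℝ) : Prop where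
  continuous_curve : Continuous γ
  continuous_deriv : Continuous (deriv γ)
  charge : IsCharge γ 0 1 ν
  field_eq : ∀ x, field V (γ x) = E x + logPot (ν.map γ) (γ x) + C₀
  nonneg : ∀ x, 0 ≤ E x
  eq_zero : ∀ x ∈ Set.Icc (0 : ℝ) 1, E x = 0
  growth : ∃ k : ℝ, ∀ x, ‖γ x‖ ≤ E x + k
  integrable : ∀ c > (0 : ℝ), ∫⁻ x, ENNReal.ofReal (‖deriv γ x‖ * Real.exp (-(c * E x))) < ⊤

/-- The density of the gas with respect to the product of the arc length measures. -/
noncomputable def boltz (V : ℂ[X]) (β : ℕ) (γ : ℝ → ℂ) (N : ℕ) (x : Fin N → ℝ) : ℝ :=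
  (∏ a : Fin N, ∏ b ∈ Finset.Ioi a, ‖γ (x a) - γ (x b)‖ ^ β) *
    ∏ a : Fin N, Real.exp (-(N * β * field V (γ (x a))))

/-- The regularised energy of the signed measure `∑ δ_{γ(x_a)} - N μ`. -/
noncomputable def discrepancy (η : ℝ) (μ : Measure ℂ) (γ : ℝ → ℂ) {N : ℕ} (x : Fin N → ℝ) : ℝ :=
  ∑ a, ∑ b, ell η (γ (x a) - γ (x b)) - 2 * N * ∑ a, ellPot η μ (γ (x a)) +
    (N : ℝ) ^ 2 * ellEnergy η μ μ

lemma continuous_field (V : ℂ[X]) : Continuous (field V) :=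
  Complex.continuous_re.comp V.continuous

lemma boltz_nonneg (V : ℂ[X]) (β : ℕ) (γ : ℝ → ℂ) (N : ℕ) (x : Fin N → ℝ) :
    0 ≤ boltz V β γ N x := by
  unfold boltz
  positivity

lemma continuous_boltz (V : ℂ[X]) (β : ℕ) {γ : ℝ → ℂ} (hγ : Continuous γ) (N : ℕ) :
    Continuous (boltz V β γ N) := by
  have := continuous_field V
  unfold boltz
  fun_prop

lemma weight_eq (V : ℂ[X]) (β : ℕ) (γ : ℝ → ℂ) (N : ℕ) (x : Fin N → ℝ) :
    weight V β γ N x = boltz V β γ N x * ∏ a, ‖deriv γ (x a)‖ := by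
  unfold weight boltz
  rw [Finset.prod_mul_distrib]
  ring

/-- Isolates the pairs containing `i`, whichever of the two indices is the larger, so that one
particle can be moved. -/
lemma prod_Ioi_split {N : ℕ} (f : Fin N → Fin N → ℝ) (hf : ∀ a b, f a b = f b a) (i : Fin N) :
    ∏ a, ∏ b ∈ Finset.Ioi a, f a b =
      (∏ a ∈ Finset.univ.erase i, ∏ b ∈ (Finset.Ioi a).erase i, f a b) *
        ∏ j ∈ Finset.univ.erase i, f i j := by
  have h1 : ∀ a ∈ Finset.univ.erase i, ∏ b ∈ Finset.Ioi a, f a b =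
      (∏ b ∈ (Finset.Ioi a).erase i, f a b) * if a < i then f i a else 1 := by
    intro a _
    split_ifs with h
    · rw [← Finset.prod_erase_mul _ _ (Finset.mem_Ioi.2 h), hf a i]
    · rw [Finset.erase_eq_of_notMem (by simpa using h), mul_one]
  rw [← Finset.mul_prod_erase _ _ (Finset.mem_univ i), Finset.prod_congr rfl h1,
    Finset.prod_mul_distrib]
  have h2 : ∏ j ∈ Finset.univ.erase i, f i j =
      (∏ b ∈ Finset.Ioi i, f i b) * ∏ a ∈ Finset.univ.erase i, if a < i then f i a else 1 := by
    have h3 : ∏ b ∈ Finset.Ioi i, f i b = ∏ a ∈ Finset.univ.erase i, if i < a then f i a else 1 := by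
      rw [← Finset.prod_filter]
      refine Finset.prod_congr ?_ fun _ _ => rfl
      ext j
      simp only [Finset.mem_Ioi, Finset.mem_filter, Finset.mem_erase, Finset.mem_univ, and_true]
      exact ⟨fun h => ⟨h.ne', h⟩, fun h => h.2⟩
    rw [h3, ← Finset.prod_mul_distrib]
    refine Finset.prod_congr rfl fun j hj => ?_
    rcases lt_or_gt_of_ne (Finset.ne_of_mem_erase hj) with h | h
    · rw [if_pos h, if_neg h.not_gt, one_mul]
    · rw [if_pos h, if_neg h.not_gt, mul_one]
  rw [h2]
  ring

namespace IsCharge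

variable {γ : ℝ → ℂ} {a b : ℝ} {ρ : Measure ℝ}

lemma ae_mem (h : IsCharge γ a b ρ) : ∀ᵐ t ∂ρ, t ∈ Set.Icc a b := by
  obtain ⟨g, c, hg, -, -, hρ, hg0, -⟩ := h.density
  rw [hρ, ae_withDensity_iff hg.ennreal_ofReal]
  refine Eventually.of_forall fun t ht => ?_
  by_contra hn
  exact ht (by simp [hg0 t hn])

lemma integrable_continuous (h : IsCharge γ a b ρ) {f : ℝ → ℝ} (hf : Continuous f) :
    Integrable f ρ := by
  have := h.isProbabilityMeasure
  obtain ⟨C, hC⟩ := isCompact_Icc.exists_bound_of_continuousOn (hf.continuousOn (s := Set.Icc a b))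
  exact Integrable.of_bound hf.aestronglyMeasurable C (h.ae_mem.mono hC)

end IsCharge

namespace IsEffectiveField

variable {V : ℂ[X]} {γ : ℝ → ℂ} {ν : Measure ℝ} {E : ℝ → ℝ} {C₀ : ℝ}

lemma continuous (h : IsEffectiveField V γ ν E C₀) : Continuous E := by
  obtain ⟨R, A, hreg⟩ := h.charge.regular
  have : E = fun x => field V (γ x) - logPot (ν.map γ) (γ x) - C₀ := by
    funext x
    rw [h.field_eq x]
    ring
  rw [this]
  exact (((continuous_field V).comp h.continuous_curve).sub
    (hreg.continuous_logPot.comp h.continuous_curve)).sub continuous_const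

/-- `E` vanishes `ν`-almost everywhere, so only the potential and the constant contribute to the
mean field. -/
lemma integral_field (h : IsEffectiveField V γ ν E C₀) :
    ∫ t, field V (γ t) ∂ν = ∫ z, logPot (ν.map γ) z ∂(ν.map γ) + C₀ := by
  obtain ⟨R, A, hreg⟩ := h.charge.regular
  have := h.charge.isProbabilityMeasure
  have hc := hreg.continuous_logPot
  have hE : ∀ᵐ t ∂ν, E t = 0 := h.charge.ae_mem.mono h.eq_zero
  rw [integral_map h.continuous_curve.aemeasurable hc.aestronglyMeasurable]
  have h1 : ∫ t, field V (γ t) ∂ν = ∫ t, (logPot (ν.map γ) (γ t) + C₀) ∂ν := by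
    refine integral_congr_ae (hE.mono fun t ht => ?_)
    simp only
    rw [h.field_eq, ht, zero_add]
  have hi : Integrable (fun t => logPot (ν.map γ) (γ t)) ν :=
    h.charge.integrable_continuous (hc.comp h.continuous_curve)
  rw [h1, integral_add hi (integrable_const _)]
  simp

/-- Upper bound of the Boltzmann factor by the discrepancy. -/
lemma boltz_le (h : IsEffectiveField V γ ν E C₀) {R A : ℝ} (hreg : IsRegular R A (ν.map γ))
    (β : ℕ) {η : ℝ} (hη : 0 < η) (hη1 : η ≤ 1) {N : ℕ} (x : Fin N → ℝ) :
    boltz V β γ N x ≤ Real.exp (-(β * (discrepancy η (ν.map γ) γ x / 2 +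
      (N : ℝ) ^ 2 * (∫ z, logPot (ν.map γ) z ∂(ν.map γ)) / 2 + N * Real.log η / 2 -
      2 * √η * A * (N : ℝ) ^ 2 + N * ∑ a, E (x a) + (N : ℝ) ^ 2 * C₀))) := by
  set μ := ν.map γ with hμ
  have hprob := hreg.isProbabilityMeasure
  have h1 : ∏ a : Fin N, ∏ b ∈ Finset.Ioi a, ‖γ (x a) - γ (x b)‖ ^ β ≤
      Real.exp (-(β * ∑ a, ∑ b ∈ Finset.Ioi a, ell η (γ (x a) - γ (x b)))) := by
    rw [Finset.mul_sum, ← Finset.sum_neg_distrib, Real.exp_sum]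
    refine Finset.prod_le_prod (fun a _ => by positivity) fun a _ => ?_
    rw [Finset.mul_sum, ← Finset.sum_neg_distrib, Real.exp_sum]
    refine Finset.prod_le_prod (fun b _ => by positivity) fun b _ => ?_
    rw [← mul_neg, Real.exp_nat_mul]
    exact pow_le_pow_left₀ (norm_nonneg _) (norm_le_exp_neg_ell η _) β
  have h2 : ∏ a : Fin N, Real.exp (-(N * β * field V (γ (x a)))) =
      Real.exp (-(β * (N * ∑ a, field V (γ (x a))))) := by
    rw [← Real.exp_sum, Finset.sum_neg_distrib, Finset.mul_sum, Finset.mul_sum]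
    congr 2
    exact Finset.sum_congr rfl fun a _ => by ring
  unfold boltz
  rw [h2]
  refine (mul_le_mul_of_nonneg_right h1 (Real.exp_pos _).le).trans ?_
  rw [← Real.exp_add, Real.exp_le_exp, ← neg_add, ← mul_add, neg_le_neg_iff]
  refine mul_le_mul_of_nonneg_left ?_ (Nat.cast_nonneg β)
  -- Passing from pairs to the full double sum adds `N` diagonal terms `ell η 0 = -log η`; they
  -- produce the term `N log η / 2`. The field is compared with the regularised potential at cost `2
  -- √η A` per particle.
  rw [sum_sum_Ioi _ fun a b => by rw [← ell_neg, neg_sub]]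
  simp only [sub_self, ell_zero, Finset.sum_const, Finset.card_univ, Fintype.card_fin, nsmul_eq_mul]
  have h3 : ∑ a, (E (x a) + (-ellPot η μ (γ (x a)) - 2 * √η * A) + C₀) ≤
      ∑ a, field V (γ (x a)) := by
    refine Finset.sum_le_sum fun a _ => ?_
    rw [h.field_eq]
    linarith [hreg.neg_logPot_le hη hη1 (γ (x a))]
  simp only [Finset.sum_add_distrib, Finset.sum_sub_distrib, Finset.sum_neg_distrib,
    Finset.sum_const, Finset.card_univ, Fintype.card_fin, nsmul_eq_mul] at h3
  have h4 : ellEnergy η μ μ ≤ -∫ z, logPot μ z ∂μ := by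
    rw [← integral_neg]
    exact integral_mono (hreg.integrable_ellPot hη hreg.toIsProbIn)
      (hreg.integrable_logPot hreg.toIsProbIn).neg fun z => hreg.ellPot_le_neg_logPot hη z
  have hN : (0 : ℝ) ≤ N := Nat.cast_nonneg N
  have h5 := mul_le_mul_of_nonneg_left h3 hN
  have h6 := mul_le_mul_of_nonneg_left h4 (sq_nonneg (N : ℝ))
  unfold discrepancy
  nlinarith [h5, h6]

lemma log_pair (h : IsEffectiveField V γ ν E C₀) {N : ℕ} {a b : Fin N} (hab : a ≠ b) :
    Integrable (fun x : Fin N → ℝ => Real.log ‖γ (x a) - γ (x b)‖) (Measure.pi fun _ => ν) ∧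
    ∫ x : Fin N → ℝ, Real.log ‖γ (x a) - γ (x b)‖ ∂(Measure.pi fun _ => ν) =
      ∫ z, logPot (ν.map γ) z ∂(ν.map γ) := by
  obtain ⟨R, A, hreg⟩ := h.charge.regular
  have := h.charge.isProbabilityMeasure
  have := hreg.isProbabilityMeasure
  have hγ := h.continuous_curve.measurable
  have hT : Measurable fun x : Fin N → ℝ => (γ (x a), γ (x b)) :=
    (hγ.comp (measurable_pi_apply a)).prodMk (hγ.comp (measurable_pi_apply b))
  have hmap : (Measure.pi fun _ : Fin N => ν).map (fun x => (γ (x a), γ (x b))) =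
      (ν.map γ).prod (ν.map γ) := by
    rw [Measure.map_prod_map ν ν hγ hγ, ← map_pi_pair ν hab, Measure.map_map (hγ.prodMap hγ)
      ((measurable_pi_apply a).prodMk (measurable_pi_apply b))]
    rfl
  have hi := hreg.integrable_log_prod hreg.toIsProbIn
  constructor
  · rw [← hmap] at hi
    exact hi.comp_measurable hT
  · have h1 := integral_prod _ hi
    rw [← hmap, integral_map hT.aemeasurable IsRegular.measurable_log.aestronglyMeasurable] at h1
    exact h1

/-- Absence of atoms excludes coincidences. They matter because `exp (log 0) = 1` is not the factor
`0` of the Boltzmann weight. -/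
lemma ae_distinct (h : IsEffectiveField V γ ν E C₀) {N : ℕ} :
    ∀ᵐ x ∂(Measure.pi fun _ : Fin N => ν), ∀ a b, a ≠ b → γ (x a) - γ (x b) ≠ 0 := by
  obtain ⟨R, A, hreg⟩ := h.charge.regular
  have := h.charge.isProbabilityMeasure
  have hγ := h.continuous_curve.measurable
  refine ae_all_iff.2 fun a => ae_all_iff.2 fun b => ?_
  by_cases hab : a = b
  · simp [hab]
  have hms : MeasurableSet {p : ℝ × ℝ | γ p.1 - γ p.2 ≠ 0} :=
    (((hγ.comp measurable_fst).sub (hγ.comp measurable_snd)) (measurableSet_singleton 0)).compl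
  have h1 : ∀ᵐ p ∂(ν.prod ν), γ p.1 - γ p.2 ≠ 0 := by
    rw [Measure.ae_prod_iff_ae_ae hms]
    refine Eventually.of_forall fun s => ?_
    exact ae_of_ae_map hγ.aemeasurable (hreg.ae_ne (γ s))
  rw [← map_pi_pair ν hab] at h1
  exact (ae_of_ae_map (by fun_prop) h1).mono fun x hx _ => hx

/-- Lower bound of the partition function by Jensen's inequality. -/
lemma le_lintegral_weight (h : IsEffectiveField V γ ν E C₀) (β : ℕ) :
    ∃ c > (0 : ℝ), ∀ N : ℕ, ENNReal.ofReal (c ^ N * Real.exp (-(β *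
      ((N : ℝ) ^ 2 * (∫ z, logPot (ν.map γ) z ∂(ν.map γ)) / 2 + (N : ℝ) ^ 2 * C₀ +
        N * (∫ z, logPot (ν.map γ) z ∂(ν.map γ)) / 2)))) ≤
      ∫⁻ x : Fin N → ℝ, ENNReal.ofReal (weight V β γ N x) := by
  obtain ⟨g, c, hg, hc, hg0, hν, -, hgc⟩ := h.charge.density
  have := h.charge.isProbabilityMeasure
  refine ⟨c, hc, fun N => ?_⟩
  set L := ∫ z, logPot (ν.map γ) z ∂(ν.map γ) with hL
  set P := Measure.pi fun _ : Fin N => ν with hP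
  set F : (Fin N → ℝ) → ℝ := fun x => β * (∑ a, ∑ b ∈ Finset.Ioi a, Real.log ‖γ (x a) - γ (x b)‖ -
    N * ∑ a, field V (γ (x a))) with hF
  have hfield : ∀ a : Fin N, Integrable (fun x : Fin N → ℝ => field V (γ (x a))) P ∧
      ∫ x : Fin N → ℝ, field V (γ (x a)) ∂P = L + C₀ := by
    intro a
    have hcf : Continuous fun t => field V (γ t) := (continuous_field V).comp h.continuous_curve
    have hmp := measurePreserving_eval (fun _ : Fin N => ν) a
    refine ⟨hmp.integrable_comp_of_integrable (h.charge.integrable_continuous hcf), ?_⟩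
    rw [← h.integral_field, ← hmp.map_eq, integral_map hmp.measurable.aemeasurable
      hcf.aestronglyMeasurable]
  have hpair : ∀ a, ∀ b ∈ Finset.Ioi a, _ := fun a b hb =>
    h.log_pair (N := N) (Finset.mem_Ioi.1 hb).ne
  have hI1 : Integrable (fun x : Fin N → ℝ =>
      ∑ a, ∑ b ∈ Finset.Ioi a, Real.log ‖γ (x a) - γ (x b)‖) P :=
    integrable_finsetSum _ fun a _ => integrable_finsetSum _ fun b hb => (hpair a b hb).1
  have hI2 : Integrable (fun x : Fin N → ℝ => (N : ℝ) * ∑ a, field V (γ (x a))) P :=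
    (integrable_finsetSum _ fun a _ => (hfield a).1).const_mul _
  have hFint : Integrable F P := (hI1.sub hI2).const_mul _
  -- Each of the `(N² - N) / 2` pairs has mean `L`, and each of the `N` field terms has mean `L +
  -- C₀` and coefficient `N`.
  have hFval : ∫ x, F x ∂P = -(β * ((N : ℝ) ^ 2 * L / 2 + (N : ℝ) ^ 2 * C₀ + N * L / 2)) := by
    have e1 : ∫ x : Fin N → ℝ, ∑ a, ∑ b ∈ Finset.Ioi a, Real.log ‖γ (x a) - γ (x b)‖ ∂P =
        ((N : ℝ) ^ 2 - N) / 2 * L := by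
      rw [integral_finsetSum _ fun a _ => integrable_finsetSum _ fun b hb => (hpair a b hb).1,
        ← sum_sum_Ioi_one, Finset.sum_mul]
      refine Finset.sum_congr rfl fun a _ => ?_
      rw [integral_finsetSum _ fun b hb => (hpair a b hb).1, Finset.sum_mul]
      exact Finset.sum_congr rfl fun b hb => by rw [(hpair a b hb).2, one_mul]
    have e2 : ∫ x : Fin N → ℝ, (N : ℝ) * ∑ a, field V (γ (x a)) ∂P = N * (N * (L + C₀)) := by
      rw [integral_const_mul, integral_finsetSum _ fun a _ => (hfield a).1]
      simp only [(hfield _).2, Finset.sum_const, Finset.card_univ, Fintype.card_fin, nsmul_eq_mul]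
    rw [hF, integral_const_mul, integral_sub hI1 hI2, e1, e2]
    ring
  have hexp : ∀ᵐ x ∂P, Real.exp (F x) ≤ boltz V β γ N x := by
    filter_upwards [h.ae_distinct (N := N)] with x hx
    refine le_of_eq ?_
    unfold boltz
    rw [hF]
    simp only
    rw [mul_sub, sub_eq_add_neg, Real.exp_add, Real.exp_nat_mul, Real.exp_sum, ← Finset.prod_pow,
      Finset.mul_sum, Finset.mul_sum, ← Finset.sum_neg_distrib, Real.exp_sum]
    congr 1
    · refine Finset.prod_congr rfl fun a _ => ?_
      rw [Real.exp_sum, ← Finset.prod_pow]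
      refine Finset.prod_congr rfl fun b hb => ?_
      rw [Real.exp_log (norm_pos_iff.2 (hx a b (Finset.mem_Ioi.1 hb).ne))]
    · exact Finset.prod_congr rfl fun a _ => by congr 1; ring
  have hmeas : Measurable fun x : Fin N → ℝ => ENNReal.ofReal (boltz V β γ N x) :=
    (continuous_boltz V β h.continuous_curve N).measurable.ennreal_ofReal
  have hprodm : Measurable fun x : Fin N → ℝ => ∏ i, ENNReal.ofReal (g (x i)) :=
    Finset.measurable_fun_prod _ fun i _ => (hg.comp (measurable_pi_apply i)).ennreal_ofReal
  calc ENNReal.ofReal (c ^ N * Real.exp (-(β * ((N : ℝ) ^ 2 * L / 2 + (N : ℝ) ^ 2 * C₀ + N * L / 2))))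
      = ENNReal.ofReal (c ^ N) * ENNReal.ofReal (Real.exp (∫ x, F x ∂P)) := by
        rw [← ENNReal.ofReal_mul (by positivity), hFval]
    _ ≤ ENNReal.ofReal (c ^ N) * ∫⁻ x, ENNReal.ofReal (boltz V β γ N x) ∂P := by
        gcongr
        exact (exp_integral_le_lintegral hFint).trans
          (lintegral_mono_ae (hexp.mono fun x hx => ENNReal.ofReal_le_ofReal hx))
    _ = ∫⁻ x : Fin N → ℝ, ENNReal.ofReal (c ^ N) *
          ((∏ i, ENNReal.ofReal (g (x i))) * ENNReal.ofReal (boltz V β γ N x)) := by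
        rw [lintegral_const_mul _ (by exact hprodm.mul hmeas), hP, hν, pi_withDensity_eq N hg,
          lintegral_withDensity_eq_lintegral_mul _ hprodm hmeas]
        rfl
    _ ≤ ∫⁻ x : Fin N → ℝ, ENNReal.ofReal (weight V β γ N x) := by
        refine lintegral_mono fun x => ?_
        rw [← ENNReal.ofReal_prod_of_nonneg fun i _ => hg0 _,
          ← ENNReal.ofReal_mul (Finset.prod_nonneg fun i _ => hg0 _),
          ← ENNReal.ofReal_mul (by positivity), weight_eq, ← mul_assoc, mul_comm]
        refine ENNReal.ofReal_le_ofReal (mul_le_mul_of_nonneg_left ?_ (boltz_nonneg V β γ N x))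
        have : c ^ N = ∏ _i : Fin N, c := by simp
        rw [this, ← Finset.prod_mul_distrib]
        exact Finset.prod_le_prod (fun i _ => mul_nonneg hc.le (hg0 _)) fun i _ => hgc _

end IsEffectiveField

/-! ### Concentration: the discrepancy is small -/

/-- The regularised energy of `s (∑ δ_{γ(x_a)} - N μ) + p (δ_z - ρ)`. -/
lemma sum_ellEnergy_eq {η R : ℝ} (hη : 0 < η) {μ ρ : Measure ℂ} (hμ : IsProbIn R μ)
    (hρ : IsProbIn R ρ) (γ : ℝ → ℂ) {N : ℕ} (x : Fin N → ℝ) (z : ℂ) (s p : ℝ) :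
    let P : Fin N ⊕ Fin 3 → Measure ℂ :=
      Sum.elim (fun a => Measure.dirac (γ (x a))) ![μ, Measure.dirac z, ρ]
    let c : Fin N ⊕ Fin 3 → ℝ := Sum.elim (fun _ => s) ![-(s * N), p, -p]
    ∑ i, ∑ j, c i * c j * ellEnergy η (P i) (P j) =
      s ^ 2 * discrepancy η μ γ x + 2 * s * p * (∑ a, ell η (γ (x a) - z) -
        ∑ a, ellPot η ρ (γ (x a)) - N * ellPot η μ z + N * ellEnergy η ρ μ) +
      p ^ 2 * (-Real.log η - 2 * ellPot η ρ z + ellEnergy η ρ ρ) := by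
  intro P c
  have hd : ∀ y : ℂ, IsProbIn ‖y‖ (Measure.dirac y) := fun y => IsProbIn.dirac le_rfl
  have e1 : ∀ y, ellEnergy η μ (Measure.dirac y) = ellPot η μ y := fun y => by
    rw [ellEnergy_comm hη hμ (hd y), ellEnergy_dirac]
  have e2 : ∀ y, ellEnergy η ρ (Measure.dirac y) = ellPot η ρ y := fun y => by
    rw [ellEnergy_comm hη hρ (hd y), ellEnergy_dirac]
  have e3 : ∀ y, ell η (z - y) = ell η (y - z) := fun y => by rw [← ell_neg, neg_sub]
  have e4 : ∀ y, ellPot η (Measure.dirac y) z = ell η (z - y) := fun y => by simp [ellPot]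
  have e5 : ∀ y, ellPot η (Measure.dirac z) y = ell η (y - z) := fun y => by simp [ellPot]
  have e6 := ellEnergy_comm hη hμ hρ
  have e7 : ∀ y w, ellPot η (Measure.dirac y) w = ell η (w - y) := fun y w => by simp [ellPot]
  simp only [P, c, Fintype.sum_sum_type, Sum.elim_inl, Sum.elim_inr, Fin.sum_univ_three,
    Matrix.cons_val_zero, Matrix.cons_val_one, Matrix.cons_val, ellEnergy_dirac, e1, e2, e3, e4, e5,
    e6, e7, sub_self, ell_zero, Finset.sum_add_distrib, ← Finset.mul_sum]
  unfold discrepancy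
  ring

section

variable {η R : ℝ} {μ : Measure ℂ} {N : ℕ}

/-- The positivity lemmas ask for one common disc. Its radius depends on the configuration, which is
harmless since their conclusions do not involve it. -/
lemma exists_isProbIn_family (γ : ℝ → ℂ) (x : Fin N → ℝ) (z : ℂ) {ρ : Measure ℂ} {R' : ℝ}
    (hμ : IsProbIn R μ) (hρ : IsProbIn R' ρ) :
    ∃ R₀, ∀ i, IsProbIn R₀ ((Sum.elim (fun a => Measure.dirac (γ (x a)))
      ![μ, Measure.dirac z, ρ] : Fin N ⊕ Fin 3 → Measure ℂ) i) := by
  have h0 : 0 ≤ ∑ a, ‖γ (x a)‖ := Finset.sum_nonneg fun _ _ => norm_nonneg _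
  refine ⟨∑ a, ‖γ (x a)‖ + |R| + |R'| + ‖z‖, ?_⟩
  have hz := norm_nonneg z
  have hR := le_abs_self R
  have hR' := le_abs_self R'
  have hR0 := abs_nonneg R
  have hR0' := abs_nonneg R'
  rintro (a | j)
  · have := Finset.single_le_sum (f := fun a => ‖γ (x a)‖) (fun a _ => norm_nonneg _)
      (Finset.mem_univ a)
    exact IsProbIn.dirac (by linarith)
  · fin_cases j
    · exact hμ.mono (by linarith)
    · exact IsProbIn.dirac (by linarith)
    · exact hρ.mono (by linarith)

/-- The signed measure `∑ δ - N μ` is neutral. In the general identity take `s = 1`, `p = 0`; the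
point `0` and the second copy of `μ` have weight zero. -/
lemma IsProbIn.discrepancy_nonneg (hμ : IsProbIn R μ) (hη : 0 < η) (γ : ℝ → ℂ)
    (x : Fin N → ℝ) : 0 ≤ discrepancy η μ γ x := by
  obtain ⟨R₀, hR₀⟩ := exists_isProbIn_family γ x 0 hμ hμ
  have h1 := sum_ellEnergy_eq hη hμ hμ γ x 0 1 0
  have h2 := sum_ellEnergy_nonneg hη hR₀ (Sum.elim (fun _ => 1) ![-(1 * N), 0, -0]) (by
    simp [Fin.sum_univ_three])
  simp only at h1
  rw [h1] at h2
  linarith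

lemma IsProbIn.discrepancy_anti (hμ : IsProbIn R μ) {η' : ℝ} (hη' : 0 < η') (hle : η' ≤ η)
    (γ : ℝ → ℂ) (x : Fin N → ℝ) : discrepancy η μ γ x ≤ discrepancy η' μ γ x := by
  obtain ⟨R₀, hR₀⟩ := exists_isProbIn_family γ x 0 hμ hμ
  have h1 := sum_ellEnergy_eq (hη'.trans_le hle) hμ hμ γ x 0 1 0
  have h1' := sum_ellEnergy_eq hη' hμ hμ γ x 0 1 0
  have h2 := sum_ellEnergy_anti hη' hle hR₀ (Sum.elim (fun _ => 1) ![-(1 * N), 0, -0])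
  simp only at h1 h1'
  rw [h1, h1'] at h2
  linarith

lemma continuous_discrepancy (hμ : IsProbIn R μ) (hη : 0 < η) {γ : ℝ → ℂ} (hγ : Continuous γ) :
    Continuous fun x : Fin N → ℝ => discrepancy η μ γ x := by
  have h1 := continuous_ell hη
  have h2 := hμ.continuous_ellPot hη
  unfold discrepancy
  fun_prop

/-- The mixed energy of `∑ δ_{γ(x_a)} - N μ` and `δ_z - ρ` is small if the discrepancy is small. -/
lemma IsProbIn.neg_mixed_le (hμ : IsProbIn R μ) {R' : ℝ} {ρ : Measure ℂ} (hρ : IsProbIn R' ρ)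
    (hη : 0 < η) (γ : ℝ → ℂ) (x : Fin N → ℝ) (z : ℂ) {d : ℝ} (hd : 0 < d) (hN : 0 < N)
    (hS : discrepancy η μ γ x ≤ d ^ 2 * (N : ℝ) ^ 2) :
    -(∑ a, ell η (γ (x a) - z) - ∑ a, ellPot η ρ (γ (x a)) - N * ellPot η μ z +
      N * ellEnergy η ρ μ) ≤
      d * N / 2 * (1 + (-Real.log η - 2 * ellPot η ρ z + ellEnergy η ρ ρ)) := by
  obtain ⟨R₀, hR₀⟩ := exists_isProbIn_family γ x z hμ hρ
  have hN' : (0 : ℝ) < N := Nat.cast_pos.2 hN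
  have h1 := sum_ellEnergy_eq hη (hμ.mono (le_max_left R R')) (hρ.mono (le_max_right R R')) γ x z
    1 (d * N)
  have h2 := sum_ellEnergy_nonneg hη hR₀ (Sum.elim (fun _ => 1) ![-(1 * N), d * N, -(d * N)]) (by
    simp [Fin.sum_univ_three])
  simp only at h1
  rw [h1] at h2
  set B := ∑ a, ell η (γ (x a) - z) - ∑ a, ellPot η ρ (γ (x a)) - N * ellPot η μ z +
      N * ellEnergy η ρ μ
  set T := -Real.log η - 2 * ellPot η ρ z + ellEnergy η ρ ρ
  have hdN : 0 < d * N := by positivity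
  -- Positivity at `s = 1`, `p = d N`, with the discrepancy replaced by its bound `d² N²`. Dividing
  -- by `d N` gives the claim.
  have h3 : 0 ≤ (d * N) * (d * N + 2 * B + (d * N) * T) := by nlinarith
  have h4 := nonneg_of_mul_nonneg_right h3 hdN
  linarith

end

namespace IsEffectiveField

variable {V : ℂ[X]} {γ : ℝ → ℂ} {ν : Measure ℝ} {E : ℝ → ℝ} {C₀ : ℝ}

/-- Of the available confinement `N ∑ E` only `∑ E` is kept: one factor `e^{-βE}` per particle
suffices for integrability against arc length, and makes the bound a product. -/
lemma weight_le (h : IsEffectiveField V γ ν E C₀) {R A : ℝ} (hreg : IsRegular R A (ν.map γ))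
    (β : ℕ) {η : ℝ} (hη : 0 < η) (hη1 : η ≤ 1) {N : ℕ} (x : Fin N → ℝ) {s : ℝ}
    (hs : s ≤ discrepancy η (ν.map γ) γ x) :
    weight V β γ N x ≤ Real.exp (-(β * (s / 2 +
      (N : ℝ) ^ 2 * (∫ z, logPot (ν.map γ) z ∂(ν.map γ)) / 2 + N * Real.log η / 2 -
      2 * √η * A * (N : ℝ) ^ 2 + (N : ℝ) ^ 2 * C₀))) *
        ∏ a, (‖deriv γ (x a)‖ * Real.exp (-(β * E (x a)))) := by
  have h1 := h.boltz_le hreg β hη hη1 x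
  have hprod : ∏ a, Real.exp (-(β * E (x a))) = Real.exp (-(β * ∑ a, E (x a))) := by
    rw [← Real.exp_sum, Finset.mul_sum, Finset.sum_neg_distrib]
  have hE : ∑ a, E (x a) ≤ N * ∑ a, E (x a) := by
    rcases Nat.eq_zero_or_pos N with rfl | hN
    · simp
    · have : (1 : ℝ) ≤ N := by exact_mod_cast hN
      have h0 : 0 ≤ ∑ a, E (x a) := Finset.sum_nonneg fun a _ => h.nonneg _
      nlinarith
  rw [weight_eq, Finset.prod_mul_distrib, hprod, mul_comm (∏ a, ‖deriv γ (x a)‖), ← mul_assoc,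
    ← Real.exp_add]
  refine mul_le_mul_of_nonneg_right (h1.trans ?_) (Finset.prod_nonneg fun _ _ => norm_nonneg _)
  rw [Real.exp_le_exp, ← neg_add, neg_le_neg_iff, ← mul_add]
  refine mul_le_mul_of_nonneg_left ?_ (Nat.cast_nonneg β)
  linarith

lemma measurable_confined (h : IsEffectiveField V γ ν E C₀) (c : ℝ) :
    Measurable fun t => ENNReal.ofReal (‖deriv γ t‖ * Real.exp (-(c * E t))) := by
  have h1 := h.continuous
  have h2 := h.continuous_deriv
  exact (by fun_prop : Continuous fun t => ‖deriv γ t‖ * Real.exp (-(c * E t))).measurable.ennreal_ofReal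

lemma lintegral_prod_confined (h : IsEffectiveField V γ ν E C₀) (c : ℝ) (K : ℝ≥0∞) (N : ℕ) :
    ∫⁻ x : Fin N → ℝ, K * ∏ a, ENNReal.ofReal (‖deriv γ (x a)‖ * Real.exp (-(c * E (x a)))) =
      K * (∫⁻ t, ENNReal.ofReal (‖deriv γ t‖ * Real.exp (-(c * E t)))) ^ N := by
  have hm := h.measurable_confined c
  have hpm : Measurable fun x : Fin N → ℝ =>
      ∏ a, ENNReal.ofReal (‖deriv γ (x a)‖ * Real.exp (-(c * E (x a)))) :=
    Finset.measurable_fun_prod _ fun i _ => hm.comp (measurable_pi_apply i)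
  rw [lintegral_const_mul _ hpm, lintegral_pi_prod (f := fun _ t => _) fun _ => hm]
  simp

lemma lintegral_weight_lt_top (h : IsEffectiveField V γ ν E C₀) {β : ℕ} (hβ : 0 < β) (N : ℕ) :
    ∫⁻ x : Fin N → ℝ, ENNReal.ofReal (weight V β γ N x) < ⊤ := by
  obtain ⟨R, A, hreg⟩ := h.charge.regular
  have hβ' : (0 : ℝ) < β := Nat.cast_pos.2 hβ
  refine (lintegral_mono fun x => ENNReal.ofReal_le_ofReal (h.weight_le hreg β one_pos le_rfl x
    (hreg.toIsProbIn.discrepancy_nonneg one_pos γ x))).trans_lt ?_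
  simp only [ENNReal.ofReal_mul (Real.exp_pos _).le]
  simp only [ENNReal.ofReal_prod_of_nonneg fun (a : Fin N) (_ : a ∈ Finset.univ) =>
    mul_nonneg (norm_nonneg _) (Real.exp_pos _).le]
  rw [h.lintegral_prod_confined]
  exact ENNReal.mul_lt_top ENNReal.ofReal_lt_top (ENNReal.pow_lt_top (h.integrable β hβ'))

/-- Configurations of large discrepancy have small probability. -/
lemma lintegral_discrepancy_ge_le (h : IsEffectiveField V γ ν E C₀) {β : ℕ} (hβ : 0 < β)
    {η δ : ℝ} (hη : 0 < η) (hη1 : η ≤ 1) (hδ : 0 < δ) :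
    ∃ K > (0 : ℝ), ∀ N : ℕ,
      ∫⁻ x in {x : Fin N → ℝ | δ * (N : ℝ) ^ 2 ≤ discrepancy η (ν.map γ) γ x},
          ENNReal.ofReal (weight V β γ N x) ≤
        ENNReal.ofReal (K ^ N * Real.exp (-(β * δ / 4 * (N : ℝ) ^ 2))) *
          ∫⁻ x : Fin N → ℝ, ENNReal.ofReal (weight V β γ N x) := by
  obtain ⟨R, A, hreg⟩ := h.charge.regular
  have hβ' : (0 : ℝ) < β := Nat.cast_pos.2 hβ
  obtain ⟨c, hc, hlow⟩ := h.le_lintegral_weight β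
  -- The discrepancy increases when the regularisation decreases, so a finer `η'` may be used. Its
  -- error `δ/4` consumes half of the gain `δ/2`.
  obtain ⟨η', hη', hle, hsmall⟩ : ∃ η' > 0, η' ≤ η ∧ 2 * √η' * A ≤ δ / 4 := by
    have hlim : Tendsto (fun y : ℝ => 2 * √y * A) (𝓝[>] 0) (𝓝 0) := by
      have := (Real.continuous_sqrt.tendsto 0).mono_left (nhdsWithin_le_nhds (s := Set.Ioi 0))
      simpa using (this.const_mul 2).mul_const A
    have h1 := hlim.eventually (gt_mem_nhds (show 0 < δ / 4 by linarith))
    have h2 : ∀ᶠ y in 𝓝[>] (0 : ℝ), y ∈ Set.Ioc 0 η := Ioc_mem_nhdsGT hη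
    obtain ⟨y, hy1, hy2⟩ := (h1.and h2).exists
    exact ⟨y, hy2.1, hy2.2, hy1.le⟩
  set L := ∫ z, logPot (ν.map γ) z ∂(ν.map γ) with hL
  set M := ∫⁻ t, ENNReal.ofReal (‖deriv γ t‖ * Real.exp (-(β * E t))) with hM
  have hMtop : M ≠ ⊤ := (h.integrable β hβ').ne
  -- `k` collects the exponents linear in `N`; the quadratic ones match the Jensen bound `B`. Below,
  -- `M + 1` replaces `M` so that the constant is positive.
  set k := Real.exp (β * (L / 2 - Real.log η' / 2)) with hk
  refine ⟨k * (M.toReal + 1) / c, by positivity, fun N => ?_⟩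
  have hN0 : (0 : ℝ) ≤ N := Nat.cast_nonneg N
  set B := Real.exp (-(β * ((N : ℝ) ^ 2 * L / 2 + (N : ℝ) ^ 2 * C₀ + N * L / 2))) with hB
  have hset : MeasurableSet {x : Fin N → ℝ | δ * (N : ℝ) ^ 2 ≤ discrepancy η (ν.map γ) γ x} :=
    measurableSet_le measurable_const
      (continuous_discrepancy hreg.toIsProbIn hη h.continuous_curve).measurable
  have hpt : ∀ x ∈ {x : Fin N → ℝ | δ * (N : ℝ) ^ 2 ≤ discrepancy η (ν.map γ) γ x},
      ENNReal.ofReal (weight V β γ N x) ≤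
        ENNReal.ofReal (B * k ^ N * Real.exp (-(β * δ / 4 * (N : ℝ) ^ 2))) *
          ∏ a, ENNReal.ofReal (‖deriv γ (x a)‖ * Real.exp (-(β * E (x a)))) := by
    intro x hx
    have hx' : δ * (N : ℝ) ^ 2 ≤ discrepancy η' (ν.map γ) γ x :=
      le_trans hx (hreg.toIsProbIn.discrepancy_anti hη' hle γ x)
    have h1 := h.weight_le hreg β hη' (hle.trans hη1) x hx'
    rw [← ENNReal.ofReal_prod_of_nonneg fun a _ => mul_nonneg (norm_nonneg _) (Real.exp_pos _).le,
      ← ENNReal.ofReal_mul (by positivity)]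
    refine ENNReal.ofReal_le_ofReal (h1.trans ?_)
    refine mul_le_mul_of_nonneg_right ?_
      (Finset.prod_nonneg fun _ _ => mul_nonneg (norm_nonneg _) (Real.exp_pos _).le)
    rw [hB, hk, ← Real.exp_nat_mul, ← Real.exp_add, ← Real.exp_add, Real.exp_le_exp]
    have h2 := mul_le_mul_of_nonneg_right hsmall (sq_nonneg (N : ℝ))
    have h3 := mul_le_mul_of_nonneg_left h2 hβ'.le
    nlinarith [h3]
  calc ∫⁻ x in {x : Fin N → ℝ | δ * (N : ℝ) ^ 2 ≤ discrepancy η (ν.map γ) γ x},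
          ENNReal.ofReal (weight V β γ N x)
      ≤ ∫⁻ x in {x : Fin N → ℝ | δ * (N : ℝ) ^ 2 ≤ discrepancy η (ν.map γ) γ x},
          ENNReal.ofReal (B * k ^ N * Real.exp (-(β * δ / 4 * (N : ℝ) ^ 2))) *
          ∏ a, ENNReal.ofReal (‖deriv γ (x a)‖ * Real.exp (-(β * E (x a)))) :=
        setLIntegral_mono' hset hpt
    _ ≤ ∫⁻ x : Fin N → ℝ,
          ENNReal.ofReal (B * k ^ N * Real.exp (-(β * δ / 4 * (N : ℝ) ^ 2))) *
          ∏ a, ENNReal.ofReal (‖deriv γ (x a)‖ * Real.exp (-(β * E (x a)))) :=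
        setLIntegral_le_lintegral _ _
    _ = ENNReal.ofReal (B * k ^ N * Real.exp (-(β * δ / 4 * (N : ℝ) ^ 2))) * M ^ N := by
        rw [h.lintegral_prod_confined]
    _ ≤ ENNReal.ofReal (B * k ^ N * Real.exp (-(β * δ / 4 * (N : ℝ) ^ 2))) *
          ENNReal.ofReal ((M.toReal + 1) ^ N) := by
        gcongr
        rw [ENNReal.ofReal_pow (by positivity)]
        gcongr
        exact ENNReal.le_ofReal_iff_toReal_le hMtop (by positivity) |>.2 (by linarith)
    _ = ENNReal.ofReal ((k * (M.toReal + 1) / c) ^ N * Real.exp (-(β * δ / 4 * (N : ℝ) ^ 2))) *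
          ENNReal.ofReal (c ^ N * B) := by
        rw [← ENNReal.ofReal_mul (by positivity), ← ENNReal.ofReal_mul (by positivity), div_pow, mul_pow]
        congr 1
        field_simp
    _ ≤ _ := by
        gcongr
        exact hlow N

end IsEffectiveField

/-! ### Moving one particle -/

/-- The Boltzmann factor of all the particles except the `i`-th one. -/
noncomputable def boltzRest (V : ℂ[X]) (β : ℕ) (γ : ℝ → ℂ) (N : ℕ) (i : Fin N)
    (x : Fin N → ℝ) : ℝ :=
  (∏ a ∈ Finset.univ.erase i, ∏ b ∈ (Finset.Ioi a).erase i, ‖γ (x a) - γ (x b)‖ ^ β) *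
    ∏ a ∈ Finset.univ.erase i, Real.exp (-(N * β * field V (γ (x a))))

lemma boltz_update (V : ℂ[X]) (β : ℕ) (γ : ℝ → ℂ) (N : ℕ) (i : Fin N) (x : Fin N → ℝ) (t : ℝ) :
    boltz V β γ N (Function.update x i t) = boltzRest V β γ N i x *
      ((∏ j ∈ Finset.univ.erase i, ‖γ t - γ (x j)‖ ^ β) *
        Real.exp (-(N * β * field V (γ t)))) := by
  have hne : ∀ a ∈ Finset.univ.erase i, Function.update x i t a = x a := fun a ha =>
    Function.update_of_ne (Finset.ne_of_mem_erase ha) _ _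
  unfold boltz boltzRest
  rw [prod_Ioi_split (fun a b => ‖γ (Function.update x i t a) - γ (Function.update x i t b)‖ ^ β)
    (fun a b => by rw [norm_sub_rev]) i, ← Finset.prod_erase_mul _ _ (Finset.mem_univ i)]
  simp only [Function.update_self]
  have e1 : ∏ a ∈ Finset.univ.erase i, ∏ b ∈ (Finset.Ioi a).erase i,
      ‖γ (Function.update x i t a) - γ (Function.update x i t b)‖ ^ β =
      ∏ a ∈ Finset.univ.erase i, ∏ b ∈ (Finset.Ioi a).erase i, ‖γ (x a) - γ (x b)‖ ^ β :=
    Finset.prod_congr rfl fun a ha => Finset.prod_congr rfl fun b hb => by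
      rw [hne a ha, Function.update_of_ne (Finset.ne_of_mem_erase hb)]
  have e2 : ∏ j ∈ Finset.univ.erase i, ‖γ t - γ (Function.update x i t j)‖ ^ β =
      ∏ j ∈ Finset.univ.erase i, ‖γ t - γ (x j)‖ ^ β :=
    Finset.prod_congr rfl fun a ha => by rw [hne a ha]
  have e3 : ∏ a ∈ Finset.univ.erase i, Real.exp (-(N * β * field V (γ (Function.update x i t a)))) =
      ∏ a ∈ Finset.univ.erase i, Real.exp (-(N * β * field V (γ (x a)))) :=
    Finset.prod_congr rfl fun a ha => by rw [hne a ha]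
  rw [e1, e2, e3]
  ring

lemma boltzRest_nonneg (V : ℂ[X]) (β : ℕ) (γ : ℝ → ℂ) (N : ℕ) (i : Fin N) (x : Fin N → ℝ) :
    0 ≤ boltzRest V β γ N i x := by
  unfold boltzRest
  positivity

/-- Converts an average over the trial charge back into an integral against arc length on `[a, b]`,
i.e. over genuine configurations. -/
lemma IsCharge.exists_lintegral_le {γ : ℝ → ℂ} {a b : ℝ} {ρ : Measure ℝ} (h : IsCharge γ a b ρ) :
    ∃ c > (0 : ℝ), ∀ f : ℝ → ℝ≥0∞, Measurable f →
      ENNReal.ofReal c * ∫⁻ t, f t ∂ρ ≤ ∫⁻ t in Set.Icc a b, f t * ENNReal.ofReal ‖deriv γ t‖ := by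
  obtain ⟨g, c, hg, hc, hg0, hρ, hgI, hgc⟩ := h.density
  refine ⟨c, hc, fun f hf => ?_⟩
  rw [hρ, lintegral_withDensity_eq_lintegral_mul _ hg.ennreal_ofReal hf,
    ← lintegral_const_mul _ (by exact hg.ennreal_ofReal.mul hf), ← lintegral_indicator measurableSet_Icc]
  refine lintegral_mono fun t => ?_
  simp only [Pi.mul_apply]
  by_cases ht : t ∈ Set.Icc a b
  · rw [Set.indicator_of_mem ht, ← mul_assoc, ← ENNReal.ofReal_mul hc.le, mul_comm]
    gcongr
    exact hgc t
  · simp [hgI t ht]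

namespace IsEffectiveField

variable {V : ℂ[X]} {γ : ℝ → ℂ} {ν : Measure ℝ} {E : ℝ → ℝ} {C₀ : ℝ}

/-- Jensen's inequality for the replacement of the `i`-th particle by a charge `ρ`. -/
lemma exp_le_lintegral_boltz_update (h : IsEffectiveField V γ ν E C₀) (β : ℕ) {a b : ℝ}
    {ρ : Measure ℝ} (hρ : IsCharge γ a b ρ) {N : ℕ} (i : Fin N) (x : Fin N → ℝ) :
    ENNReal.ofReal (boltzRest V β γ N i x * Real.exp (β *
      (∑ j ∈ Finset.univ.erase i, logPot (ρ.map γ) (γ (x j)) - N * ∫ t, field V (γ t) ∂ρ))) ≤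
      ∫⁻ t, ENNReal.ofReal (boltz V β γ N (Function.update x i t)) ∂ρ := by
  obtain ⟨R, A, hreg⟩ := hρ.regular
  have := hρ.isProbabilityMeasure
  have hγ := h.continuous_curve
  have hcf : Continuous fun t => field V (γ t) := (continuous_field V).comp hγ
  have hlog : ∀ y : ℂ, Integrable (fun t => Real.log ‖γ t - y‖) ρ ∧
      ∫ t, Real.log ‖γ t - y‖ ∂ρ = logPot (ρ.map γ) y := by
    intro y
    have h1 := hreg.integrable_log y
    constructor
    · simpa only [Function.comp_def, norm_sub_rev y] using h1.comp_measurable hγ.measurable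
    · unfold logPot
      rw [integral_map hγ.aemeasurable h1.aestronglyMeasurable]
      simp only [norm_sub_rev y]
  have hI1 : Integrable (fun t => ∑ j ∈ Finset.univ.erase i, Real.log ‖γ t - γ (x j)‖) ρ :=
    integrable_finsetSum _ fun j _ => (hlog _).1
  have hI2 : Integrable (fun t => (N : ℝ) * field V (γ t)) ρ :=
    (hρ.integrable_continuous hcf).const_mul _
  have hint : Integrable (fun t => β * (∑ j ∈ Finset.univ.erase i, Real.log ‖γ t - γ (x j)‖ -
      N * field V (γ t))) ρ := (hI1.sub hI2).const_mul _
  have hval : ∫ t, β * (∑ j ∈ Finset.univ.erase i, Real.log ‖γ t - γ (x j)‖ -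
      N * field V (γ t)) ∂ρ = β * (∑ j ∈ Finset.univ.erase i, logPot (ρ.map γ) (γ (x j)) -
        N * ∫ t, field V (γ t) ∂ρ) := by
    rw [integral_const_mul, integral_sub hI1 hI2, integral_finsetSum _ fun j _ => (hlog _).1,
      integral_const_mul]
    simp only [(hlog _).2]
  have hne : ∀ᵐ t ∂ρ, ∀ j, γ t - γ (x j) ≠ 0 := by
    refine ae_all_iff.2 fun j => ?_
    filter_upwards [ae_of_ae_map hγ.aemeasurable (hreg.ae_ne (γ (x j)))] with t ht ht'
    exact ht (by rw [← neg_sub, ht', neg_zero])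
  rw [← hval, ENNReal.ofReal_mul (boltzRest_nonneg V β γ N i x)]
  refine (mul_le_mul_right (exp_integral_le_lintegral hint) _).trans ?_
  simp only [boltz_update, ENNReal.ofReal_mul (boltzRest_nonneg V β γ N i x)]
  rw [lintegral_const_mul]
  · refine mul_le_mul_right (lintegral_mono_ae ?_) _
    filter_upwards [hne] with t ht
    refine ENNReal.ofReal_le_ofReal (le_of_eq ?_)
    rw [mul_sub, sub_eq_add_neg, Real.exp_add, Real.exp_nat_mul, Real.exp_sum, Finset.prod_pow]
    congr 1
    · congr 1
      exact Finset.prod_congr rfl fun j _ => Real.exp_log (norm_pos_iff.2 (ht j))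
    · congr 1; ring
  · exact (by fun_prop : Continuous fun t => (∏ j ∈ Finset.univ.erase i, ‖γ t - γ (x j)‖ ^ β) *
        Real.exp (-(N * β * field V (γ t)))).measurable.ennreal_ofReal

/-- The logarithm of the ratio of the Boltzmann factors of a particle at `x i` and of a particle
distributed according to `ρ` is given by the effective fields, up to a small error. -/
lemma exists_energy_difference_le (h : IsEffectiveField V γ ν E C₀) {a b : ℝ}
    {ρ : Measure ℝ} (hρ : IsCharge γ a b ρ) {θ : ℝ} (hθ : 0 < θ) :
    ∃ η > (0 : ℝ), η ≤ 1 ∧ ∃ δ > (0 : ℝ), ∃ K : ℝ, ∃ N₀ : ℕ, ∀ N ≥ N₀, 0 < N ∧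
      ∀ (i : Fin N) (x : Fin N → ℝ), discrepancy η (ν.map γ) γ x ≤ δ * (N : ℝ) ^ 2 →
      -∑ j ∈ Finset.univ.erase i, ell η (γ (x i) - γ (x j)) - N * field V (γ (x i)) ≤
        ∑ j ∈ Finset.univ.erase i, logPot (ρ.map γ) (γ (x j)) - N * ∫ t, field V (γ t) ∂ρ +
          K - N * ((1 - θ) * E (x i) - ∫ t, E t ∂ρ - θ) := by
  obtain ⟨R, A, hreg⟩ := h.charge.regular
  obtain ⟨R', A', hreg'⟩ := hρ.regular
  obtain ⟨k, hk⟩ := h.growth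
  have := hρ.isProbabilityMeasure
  have := hreg.isProbabilityMeasure
  have hγ := h.continuous_curve
  set μ := ν.map γ with hμ
  set ρ' := ρ.map γ with hρ'
  -- Half of the tolerance `θ` pays for regularising the potentials of `ν` and of `ρ`; the other
  -- half pays for the discrepancy.
  obtain ⟨η, hη, hη1, hsmall⟩ : ∃ η > 0, η ≤ 1 ∧ 2 * √η * (A + A') ≤ θ / 2 := by
    have hlim : Tendsto (fun y : ℝ => 2 * √y * (A + A')) (𝓝[>] 0) (𝓝 0) := by
      have := (Real.continuous_sqrt.tendsto 0).mono_left (nhdsWithin_le_nhds (s := Set.Ioi 0))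
      simpa using (this.const_mul 2).mul_const (A + A')
    have h1 := hlim.eventually (gt_mem_nhds (show 0 < θ / 2 by linarith))
    have h2 : ∀ᶠ y in 𝓝[>] (0 : ℝ), y ∈ Set.Ioc 0 1 := Ioc_mem_nhdsGT one_pos
    obtain ⟨y, hy1, hy2⟩ := (h1.and h2).exists
    exact ⟨y, hy2.1, hy2.2, hy1.le⟩
  set Λ := -Real.log η with hΛ
  have hΛ0 : 0 ≤ Λ := by have := Real.log_nonpos hη.le hη1; linarith
  set k₁ := |k| + |R'| + 1 with hk₁
  have hk₁0 : 0 < k₁ := by positivity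
  set W := 1 / 2 + Λ + k₁ with hW
  have hW0 : 0 < W := by positivity
  -- The quadratic remainder of the mixed energy is at most `d N (W + E (x i))`, the growth of `E`
  -- controlling the potential of `ρ` far away. This `d` keeps it below `N (θ/2) (1 + E (x i))`.
  set d := θ / 2 / (W + 1) with hd
  have hd0 : 0 < d := by positivity
  have hdW : d * W ≤ θ / 2 := by
    rw [hd, div_mul_eq_mul_div, div_le_iff₀ (by positivity)]
    nlinarith
  have hd1 : d ≤ θ / 2 := by
    rw [hd]
    exact div_le_self (by positivity) (by linarith)
  -- `Λ` is the self-energy of particle `i`, absent from the sums over `j ≠ i`. Its own interaction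
  -- with `ρ` costs `E (x i) + k₁`; `N ≥ 2/θ` absorbs the single `E (x i)` into `N (θ/2) E (x i)`.
  refine ⟨η, hη, hη1, d ^ 2, by positivity, Λ + k₁, ⌈2 / θ⌉₊ + 1, fun N hN => ⟨by omega, ?_⟩⟩
  have hNpos : 0 < N := by omega
  have hN2 : 2 / θ ≤ N := (Nat.le_ceil _).trans (by exact_mod_cast (by omega : ⌈2 / θ⌉₊ ≤ N))
  have hNθ : 1 ≤ N * (θ / 2) := by
    rw [div_le_iff₀ hθ] at hN2
    linarith
  have hN0 : (0 : ℝ) < N := Nat.cast_pos.2 hNpos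
  intro i x hS
  have hmix := hreg.toIsProbIn.neg_mixed_le hreg'.toIsProbIn hη γ x (γ (x i)) hd0 hNpos hS
  have hEi := h.nonneg (x i)
  have hnorm : ‖γ (x i)‖ + R' + η ≤ E (x i) + k₁ := by
    linarith [hk (x i), le_abs_self k, le_abs_self R']
  have hLρ := hreg'.neg_ellPot_le hη (γ (x i))
  have hρρ : ellEnergy η ρ' ρ' ≤ Λ := by
    have := hreg'.isProbabilityMeasure
    calc ellEnergy η ρ' ρ' ≤ ∫ _z, Λ ∂ρ' := integral_mono
          (hreg'.integrable_ellPot hη hreg'.toIsProbIn) (integrable_const _)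
          fun z => hreg'.ellPot_le hη z
      _ = Λ := by simp
  have hu : -logPot μ (γ (x i)) ≤ ellPot η μ (γ (x i)) + 2 * √η * A :=
    hreg.neg_logPot_le hη hη1 _
  have hfield : ∫ t, field V (γ t) ∂ρ ≤ ∫ t, E t ∂ρ - ellEnergy η ρ' μ + C₀ := by
    have hcl := hreg.continuous_logPot
    have h1 : ∫ t, field V (γ t) ∂ρ = ∫ t, E t ∂ρ + ∫ z, logPot μ z ∂ρ' + C₀ := by
      have hi1 := hρ.integrable_continuous h.continuous
      have hi2 : Integrable (fun t => logPot μ (γ t)) ρ := hρ.integrable_continuous (hcl.comp hγ)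
      rw [integral_map hγ.aemeasurable hcl.aestronglyMeasurable]
      simp only [h.field_eq]
      rw [integral_add (by exact hi1.add hi2) (integrable_const _), integral_add hi1 hi2]
      simp
    have h2 : ellEnergy η ρ' μ ≤ -∫ z, logPot μ z ∂ρ' := by
      rw [← integral_neg]
      exact integral_mono (hreg.integrable_ellPot hη hreg'.toIsProbIn)
        (hreg.integrable_logPot hreg'.toIsProbIn).neg fun z => hreg.ellPot_le_neg_logPot hη z
    linarith
  have hsum : -∑ j ∈ Finset.univ.erase i, logPot ρ' (γ (x j)) ≤
      ∑ a, ellPot η ρ' (γ (x a)) - ellPot η ρ' (γ (x i)) + N * (2 * √η * A') := by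
    have h1 : ∑ j ∈ Finset.univ.erase i, -logPot ρ' (γ (x j)) ≤
        ∑ j ∈ Finset.univ.erase i, (ellPot η ρ' (γ (x j)) + 2 * √η * A') :=
      Finset.sum_le_sum fun j _ => hreg'.neg_logPot_le hη hη1 _
    have h2 := Finset.sum_erase_add Finset.univ (fun j => ellPot η ρ' (γ (x j))) (Finset.mem_univ i)
    have h3 : ((Finset.univ.erase i).card : ℝ) ≤ N := by
      have := Finset.card_le_univ (Finset.univ.erase i)
      rw [Fintype.card_fin] at this
      exact_mod_cast this
    have h4 : (0 : ℝ) ≤ 2 * √η * A' := mul_nonneg (by positivity) hreg'.nonneg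
    rw [Finset.sum_neg_distrib, Finset.sum_add_distrib, Finset.sum_const, nsmul_eq_mul] at h1
    have h5 := mul_le_mul_of_nonneg_right h3 h4
    linarith
  have hell : ∑ a, ell η (γ (x a) - γ (x i)) =
      ∑ j ∈ Finset.univ.erase i, ell η (γ (x i) - γ (x j)) + Λ := by
    rw [← Finset.sum_erase_add Finset.univ _ (Finset.mem_univ i), sub_self, ell_zero]
    congr 1
    exact Finset.sum_congr rfl fun j _ => by rw [← ell_neg, neg_sub]
  rw [h.field_eq (x i)]
  have hT : d * N / 2 * (1 + (-Real.log η - 2 * ellPot η ρ' (γ (x i)) + ellEnergy η ρ' ρ')) ≤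
      N * (θ / 2 + θ / 2 * E (x i)) := by
    have h1 : 1 + (-Real.log η - 2 * ellPot η ρ' (γ (x i)) + ellEnergy η ρ' ρ') ≤
        2 * W + 2 * E (x i) := by
      linarith
    have h2 := mul_le_mul_of_nonneg_left h1 (show 0 ≤ d * N / 2 by positivity)
    have h3 : d * W + d * E (x i) ≤ θ / 2 + θ / 2 * E (x i) := by nlinarith
    have h4 := mul_le_mul_of_nonneg_left h3 hN0.le
    linarith
  have hE1 : E (x i) ≤ N * (θ / 2 * E (x i)) := by nlinarith
  have hN1 := mul_le_mul_of_nonneg_left hsmall hN0.le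
  have hN2 := mul_le_mul_of_nonneg_left hu hN0.le
  have hN3 := mul_le_mul_of_nonneg_left hfield hN0.le
  linarith

/-- A configuration of small discrepancy: the Boltzmann factor is bounded by its average over the
displacements of the `i`-th particle, up to the exponential of the effective field. -/
lemma exists_boltz_le_lintegral_update (h : IsEffectiveField V γ ν E C₀) (β : ℕ) {a b : ℝ}
    {ρ : Measure ℝ} (hρ : IsCharge γ a b ρ) {θ : ℝ} (hθ : 0 < θ) :
    ∃ η > (0 : ℝ), η ≤ 1 ∧ ∃ δ > (0 : ℝ), ∃ K > (0 : ℝ), ∃ N₀ : ℕ, ∀ N ≥ N₀, 0 < N ∧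
      ∀ (i : Fin N) (x : Fin N → ℝ), discrepancy η (ν.map γ) γ x < δ * (N : ℝ) ^ 2 →
      ENNReal.ofReal (boltz V β γ N x) ≤
        ENNReal.ofReal (K * Real.exp (-(β * N * ((1 - θ) * E (x i) - ∫ t, E t ∂ρ - θ)))) *
          ∫⁻ t, ENNReal.ofReal (boltz V β γ N (Function.update x i t)) ∂ρ := by
  obtain ⟨η, hη, hη1, δ, hδ, K, N₀, hmain⟩ := h.exists_energy_difference_le hρ hθ
  refine ⟨η, hη, hη1, δ, hδ, Real.exp (β * K), Real.exp_pos _, N₀, fun N hN => ⟨(hmain N hN).1, ?_⟩⟩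
  intro i x hx
  have h1 := (hmain N hN).2 i x hx.le
  refine le_trans ?_ (mul_le_mul_right (h.exp_le_lintegral_boltz_update β hρ i x) _)
  rw [← ENNReal.ofReal_mul (by positivity)]
  refine ENNReal.ofReal_le_ofReal ?_
  have e := boltz_update V β γ N i x (x i)
  rw [Function.update_eq_self] at e
  rw [e, mul_comm, mul_left_comm, mul_comm (boltzRest V β γ N i x)]
  refine mul_le_mul_of_nonneg_right ?_ (boltzRest_nonneg V β γ N i x)
  have h2 : ∏ j ∈ Finset.univ.erase i, ‖γ (x i) - γ (x j)‖ ^ β ≤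
      Real.exp (β * -∑ j ∈ Finset.univ.erase i, ell η (γ (x i) - γ (x j))) := by
    rw [Real.exp_nat_mul, ← Finset.sum_neg_distrib, Real.exp_sum, Finset.prod_pow]
    refine pow_le_pow_left₀ (Finset.prod_nonneg fun _ _ => norm_nonneg _) ?_ β
    exact Finset.prod_le_prod (fun _ _ => norm_nonneg _) fun j _ => norm_le_exp_neg_ell η _
  refine (mul_le_mul_of_nonneg_right h2 (Real.exp_pos _).le).trans ?_
  rw [← Real.exp_add, ← Real.exp_add, ← Real.exp_add, Real.exp_le_exp]
  have h3 := mul_le_mul_of_nonneg_left h1 (Nat.cast_nonneg (α := ℝ) β)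
  linarith

end IsEffectiveField

/-! ### Large deviations of one particle -/

lemma continuous_weight (V : ℂ[X]) (β : ℕ) {γ : ℝ → ℂ} (hγ : Continuous γ)
    (hγ' : Continuous (deriv γ)) (N : ℕ) : Continuous (weight V β γ N) := by
  have := continuous_field V
  unfold weight
  fun_prop

lemma realModel_apply (V : ℂ[X]) (β : ℕ) (γ : ℝ → ℂ) (N : ℕ) {S : Set (Fin N → ℝ)}
    (hS : MeasurableSet S) :
    realModel V β γ N S = (∫⁻ x : Fin N → ℝ, ENNReal.ofReal (weight V β γ N x))⁻¹ *
      ∫⁻ x in S, ENNReal.ofReal (weight V β γ N x) := by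
  have huniv : {x : Fin N → ℝ | ∀ a, x a ∈ (Set.univ : Set ℝ)} = Set.univ := by simp
  rw [realModel, partitionFunction, gibbs, huniv, Measure.restrict_univ, Measure.smul_apply,
    withDensity_apply _ hS, smul_eq_mul]

/-- The factor `N` comes from the union bound over particles; the factor `1/2` leaves room for
configurations of large discrepancy. -/
lemma eventually_mul_exp_le {K τ τ' : ℝ} (hτ : τ < τ') :
    ∀ᶠ N : ℕ in atTop, N * (K * Real.exp (-(τ' * N))) ≤ Real.exp (-(τ * N)) / 2 := by
  have h1 : Tendsto (fun y : ℝ => y * Real.exp (-y)) atTop (𝓝 0) := by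
    simpa using Real.tendsto_pow_mul_exp_neg_atTop_nhds_zero 1
  have h2 : Tendsto (fun N : ℕ => (τ' - τ) * (N : ℝ)) atTop atTop :=
    tendsto_natCast_atTop_atTop.const_mul_atTop (sub_pos.2 hτ)
  have h3 := ((h1.comp h2).const_mul (K / (τ' - τ)))
  rw [mul_zero] at h3
  filter_upwards [h3.eventually (gt_mem_nhds (show (0 : ℝ) < 1 / 2 by norm_num))] with N hN
  have h4 : (0 : ℝ) < τ' - τ := sub_pos.2 hτ
  simp only [Function.comp] at hN
  have e : K / (τ' - τ) * ((τ' - τ) * (N : ℝ) * Real.exp (-((τ' - τ) * N))) =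
      N * (K * Real.exp (-((τ' - τ) * N))) := by field_simp
  rw [e] at hN
  have e2 : Real.exp (-(τ' * N)) = Real.exp (-((τ' - τ) * N)) * Real.exp (-(τ * N)) := by
    rw [← Real.exp_add]; congr 1; ring
  rw [e2]
  have := mul_le_mul_of_nonneg_right hN.le (Real.exp_pos (-(τ * N))).le
  linarith

/-- An `e^{-cN²}` probability beats every exponential rate, so large discrepancies never affect the
large deviation speed `N`. -/
lemma eventually_pow_mul_exp_le {K c τ : ℝ} (hK : 0 < K) (hc : 0 < c) :
    ∀ᶠ N : ℕ in atTop, K ^ N * Real.exp (-(c * (N : ℝ) ^ 2)) ≤ Real.exp (-(τ * N)) / 2 := by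
  have h1 : Tendsto (fun N : ℕ => K * Real.exp τ * Real.exp (-(c * (N : ℝ)))) atTop (𝓝 0) := by
    have : Tendsto (fun N : ℕ => Real.exp (-(c * (N : ℝ)))) atTop (𝓝 0) :=
      Real.tendsto_exp_neg_atTop_nhds_zero.comp (tendsto_natCast_atTop_atTop.const_mul_atTop hc)
    simpa using this.const_mul (K * Real.exp τ)
  filter_upwards [h1.eventually (gt_mem_nhds (show (0 : ℝ) < 1 / 2 by norm_num)),
    eventually_ge_atTop 1] with N hN hN1
  have e : K ^ N * Real.exp (-(c * (N : ℝ) ^ 2)) =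
      (K * Real.exp τ * Real.exp (-(c * (N : ℝ)))) ^ N * Real.exp (-(τ * N)) := by
    rw [mul_pow, mul_pow, ← Real.exp_nat_mul, ← Real.exp_nat_mul, mul_assoc, mul_assoc,
      ← Real.exp_add, ← Real.exp_add]
    congr 2
    ring
  rw [e]
  have h2 : (K * Real.exp τ * Real.exp (-(c * (N : ℝ)))) ^ N ≤ 1 / 2 := by
    calc (K * Real.exp τ * Real.exp (-(c * (N : ℝ)))) ^ N ≤ (1 / 2 : ℝ) ^ N :=
          pow_le_pow_left₀ (by positivity) hN.le N
      _ ≤ (1 / 2 : ℝ) ^ 1 := pow_le_pow_of_le_one (by norm_num) (by norm_num) hN1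
      _ = 1 / 2 := by norm_num
  have := mul_le_mul_of_nonneg_right h2 (Real.exp_pos (-(τ * N))).le
  linarith

namespace IsEffectiveField

variable {V : ℂ[X]} {γ : ℝ → ℂ} {ν : Measure ℝ} {E : ℝ → ℝ} {C₀ : ℝ}

lemma measurable_weight (h : IsEffectiveField V γ ν E C₀) (β N : ℕ) :
    Measurable fun x => ENNReal.ofReal (weight V β γ N x) :=
  (continuous_weight V β h.continuous_curve h.continuous_deriv N).measurable.ennreal_ofReal

lemma lintegral_weight_pos (h : IsEffectiveField V γ ν E C₀) (β N : ℕ) :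
    0 < ∫⁻ x : Fin N → ℝ, ENNReal.ofReal (weight V β γ N x) := by
  obtain ⟨c, hc, hlow⟩ := h.le_lintegral_weight β
  refine lt_of_lt_of_le ?_ (hlow N)
  rw [ENNReal.ofReal_pos]
  positivity

lemma measurableSet_discrepancy (h : IsEffectiveField V γ ν E C₀) {η : ℝ} (hη : 0 < η)
    (N : ℕ) (c : ℝ) :
    MeasurableSet {x : Fin N → ℝ | discrepancy η (ν.map γ) γ x < c} := by
  obtain ⟨R, A, hreg⟩ := h.charge.regular
  exact measurableSet_lt (continuous_discrepancy hreg.toIsProbIn hη h.continuous_curve).measurable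
    measurable_const

/-- Comparison of the weights of the configurations with a particle in `F` and with a particle in
the support of the charge `ρ`. -/
lemma exists_lintegral_weight_le (h : IsEffectiveField V γ ν E C₀) (β : ℕ) {a b : ℝ}
    {ρ : Measure ℝ} (hρ : IsCharge γ a b ρ) {θ : ℝ} (hθ : 0 < θ) :
    ∃ η > (0 : ℝ), η ≤ 1 ∧ ∃ δ > (0 : ℝ), ∃ K > (0 : ℝ), ∃ N₀ : ℕ, ∀ N ≥ N₀, 0 < N ∧
      ∀ (i : Fin N) (F : Set ℝ), MeasurableSet F →
      ∫⁻ x in {x : Fin N → ℝ | x i ∈ F ∧ discrepancy η (ν.map γ) γ x < δ * (N : ℝ) ^ 2},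
          ENNReal.ofReal (weight V β γ N x) ≤
        ENNReal.ofReal (K * Real.exp (β * N * (∫ t, E t ∂ρ + θ))) *
          (∫⁻ t in F, ENNReal.ofReal (‖deriv γ t‖ * Real.exp (-(β * N * (1 - θ) * E t)))) *
          ∫⁻ x in {x : Fin N → ℝ | x i ∈ Set.Icc a b}, ENNReal.ofReal (weight V β γ N x) := by
  obtain ⟨η, hη, hη1, δ, hδ, K, hK, N₀, hmain⟩ := h.exists_boltz_le_lintegral_update β hρ hθ
  obtain ⟨c, hc, hcle⟩ := hρ.exists_lintegral_le
  refine ⟨η, hη, hη1, δ, hδ, K / c, by positivity, N₀, fun N hN => ⟨(hmain N hN).1, ?_⟩⟩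
  intro i F hF
  replace hmain := (hmain N hN).2 i
  have hγ := h.continuous_curve
  have hγ' := h.continuous_deriv
  have hE := h.continuous
  have hwm := h.measurable_weight β N
  set S := {x : Fin N → ℝ | discrepancy η (ν.map γ) γ x < δ * (N : ℝ) ^ 2} with hS
  have hSm : MeasurableSet S := h.measurableSet_discrepancy hη N _
  set G : ℝ → ℝ≥0∞ := fun t =>
    ENNReal.ofReal (‖deriv γ t‖ * Real.exp (-(β * N * (1 - θ) * E t))) with hG
  have hGm : Measurable G := (by fun_prop : Continuous fun t =>
    ‖deriv γ t‖ * Real.exp (-(β * N * (1 - θ) * E t))).measurable.ennreal_ofReal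
  set q := ENNReal.ofReal (K / c * Real.exp (β * N * (∫ t, E t ∂ρ + θ))) with hq
  have hset1 : MeasurableSet {x : Fin N → ℝ | x i ∈ F ∧ x ∈ S} :=
    (hF.preimage (measurable_pi_apply i)).inter hSm
  have hset2 : MeasurableSet {x : Fin N → ℝ | x i ∈ Set.Icc a b} :=
    measurableSet_Icc.preimage (measurable_pi_apply i)
  rw [← lintegral_const_mul _ hwm, ← lintegral_indicator hset2]
  have hset1' : {x : Fin N → ℝ | x i ∈ F ∧ discrepancy η (ν.map γ) γ x < δ * (N : ℝ) ^ 2} =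
      {x : Fin N → ℝ | x i ∈ F ∧ x ∈ S} := rfl
  rw [hset1', ← lintegral_indicator hset1]
  -- It is enough to compare the integrals over the `i`-th coordinate, the other particles being
  -- frozen.
  refine lintegral_le_of_lmarginal_le {i} (hwm.indicator hset1)
    ((hwm.const_mul _).indicator hset2) fun x => ?_
  rw [lmarginal_singleton, lmarginal_singleton]
  set Pr := ∏ j ∈ Finset.univ.erase i, ‖deriv γ (x j)‖ with hPr
  have hPr0 : 0 ≤ Pr := Finset.prod_nonneg fun _ _ => norm_nonneg _
  have hw : ∀ t, ENNReal.ofReal (weight V β γ N (Function.update x i t)) =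
      ENNReal.ofReal Pr * (ENNReal.ofReal (boltz V β γ N (Function.update x i t)) *
        ENNReal.ofReal ‖deriv γ t‖) := by
    intro t
    rw [weight_eq, ← Finset.prod_erase_mul _ _ (Finset.mem_univ i), Function.update_self,
      ← ENNReal.ofReal_mul (boltz_nonneg V β γ N _), ← ENNReal.ofReal_mul hPr0]
    congr 1
    have : ∏ j ∈ Finset.univ.erase i, ‖deriv γ (Function.update x i t j)‖ = Pr :=
      Finset.prod_congr rfl fun j hj => by
        rw [Function.update_of_ne (Finset.ne_of_mem_erase hj)]
    rw [this]
    ring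
  set J := ∫⁻ t, ENNReal.ofReal (boltz V β γ N (Function.update x i t)) ∂ρ with hJ
  have hbm : Measurable fun t => ENNReal.ofReal (boltz V β γ N (Function.update x i t)) :=
    ((continuous_boltz V β hγ N).comp (continuous_const.update i continuous_id)).measurable.ennreal_ofReal
  -- The average `J` over the displaced particle no longer depends on its initial position `t`, so
  -- the `t`-integral over `F` factors out as the integral of `G`.
  have hleft : ∀ t, ({x : Fin N → ℝ | x i ∈ F ∧ x ∈ S}.indicator
      (fun x => ENNReal.ofReal (weight V β γ N x))) (Function.update x i t) ≤
      F.indicator (fun t => (ENNReal.ofReal Pr * J *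
        ENNReal.ofReal (K * Real.exp (β * N * (∫ t, E t ∂ρ + θ)))) * G t) t := by
    intro t
    by_cases ht : t ∈ F ∧ Function.update x i t ∈ S
    · rw [Set.indicator_of_mem (by simpa using ht), Set.indicator_of_mem ht.1, hw t]
      have h1 := hmain (Function.update x i t) ht.2
      simp only [Function.update_idem, Function.update_self] at h1
      rw [mul_assoc, mul_assoc]
      refine mul_le_mul_right ?_ _
      refine (mul_le_mul_left h1 _).trans (le_of_eq ?_)
      rw [hG, mul_comm _ J, mul_assoc, ← ENNReal.ofReal_mul (by positivity),
        ← ENNReal.ofReal_mul (by positivity)]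
      congr 2
      have : Real.exp (-(β * N * ((1 - θ) * E t - ∫ t, E t ∂ρ - θ))) =
          Real.exp (β * N * (∫ t, E t ∂ρ + θ)) * Real.exp (-(β * N * (1 - θ) * E t)) := by
        rw [← Real.exp_add]; congr 1; ring
      rw [this]
      ring
    · rw [Set.indicator_of_notMem (by simpa using ht)]
      exact bot_le
  have hright : ∀ t, ({x : Fin N → ℝ | x i ∈ Set.Icc a b}.indicator
      (fun x => q * (∫⁻ t in F, G t) * ENNReal.ofReal (weight V β γ N x))) (Function.update x i t) =
      (Set.Icc a b).indicator (fun t => (q * (∫⁻ t in F, G t) * ENNReal.ofReal Pr) *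
        (ENNReal.ofReal (boltz V β γ N (Function.update x i t)) * ENNReal.ofReal ‖deriv γ t‖)) t := by
    intro t
    by_cases ht : t ∈ Set.Icc a b
    · rw [Set.indicator_of_mem (by simpa using ht), Set.indicator_of_mem ht, hw t, mul_assoc _ (ENNReal.ofReal Pr)]
    · rw [Set.indicator_of_notMem (by simpa using ht), Set.indicator_of_notMem ht]
  simp only [hright]
  refine (lintegral_mono hleft).trans ?_
  rw [lintegral_indicator hF, lintegral_indicator measurableSet_Icc, lintegral_const_mul _ hGm,
    lintegral_const_mul _ (by exact hbm.mul hγ'.norm.measurable.ennreal_ofReal)]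
  calc ENNReal.ofReal Pr * J * ENNReal.ofReal (K * Real.exp (β * N * (∫ t, E t ∂ρ + θ))) *
        ∫⁻ t in F, G t
      = q * (∫⁻ t in F, G t) * ENNReal.ofReal Pr * (ENNReal.ofReal c * J) := by
        have : ENNReal.ofReal (K * Real.exp (β * N * (∫ t, E t ∂ρ + θ))) = q * ENNReal.ofReal c := by
          rw [hq, ← ENNReal.ofReal_mul (by positivity)]
          congr 1
          field_simp
        rw [this]
        ring
    _ ≤ _ := by
        gcongr
        exact hcle _ hbm

/-- Exponential bound of the integral of the one-particle weight over a set of large field. -/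
lemma lintegral_confined_le (h : IsEffectiveField V γ ν E C₀) {c e : ℝ} (hc : 0 < c)
    {F : Set ℝ} (hF : MeasurableSet F) (hFe : ∀ t ∈ F, e ≤ E t) {N : ℕ} (hN : 0 < N) :
    ∫⁻ t in F, ENNReal.ofReal (‖deriv γ t‖ * Real.exp (-(c * N * E t))) ≤
      ENNReal.ofReal (Real.exp (-(c * (N - 1) * e))) *
        ∫⁻ t, ENNReal.ofReal (‖deriv γ t‖ * Real.exp (-(c * E t))) := by
  rw [← lintegral_const_mul _ (h.measurable_confined c)]
  -- Only `N - 1` of the `N` factors `e^{-cE}` are bounded by `e^{-ce}`; the last one keeps the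
  -- integral finite.
  refine (setLIntegral_mono' hF fun t ht => ?_).trans (setLIntegral_le_lintegral _ _)
  rw [← ENNReal.ofReal_mul (by positivity), mul_left_comm, ← Real.exp_add]
  refine ENNReal.ofReal_le_ofReal (mul_le_mul_of_nonneg_left ?_ (norm_nonneg _))
  rw [Real.exp_le_exp]
  have h1 : (1 : ℝ) ≤ N := by exact_mod_cast hN
  have h2 := mul_le_mul_of_nonneg_left (hFe t ht) (mul_nonneg hc.le (sub_nonneg.2 h1))
  linarith

/-- Upper large deviation bound. -/
lemma eventually_realModel_le (h : IsEffectiveField V γ ν E C₀) {β : ℕ} (hβ : 0 < β)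
    {F : Set ℝ} (hF : MeasurableSet F) {e : ℝ} (hFe : ∀ t ∈ F, e ≤ E t)
    {τ : ℝ} (hτ : τ < β * e) :
    ∀ᶠ N : ℕ in atTop, realModel V β γ N {x | ∃ i, x i ∈ F} ≤
      ENNReal.ofReal (Real.exp (-(τ * N))) := by
  have hβ' : (0 : ℝ) < β := Nat.cast_pos.2 hβ
  obtain ⟨θ, hθ, hθ1, hτθ⟩ : ∃ θ > 0, θ < 1 ∧ τ < β * ((1 - θ) * e - θ) := by
    have hlim : Tendsto (fun θ : ℝ => β * ((1 - θ) * e - θ)) (𝓝[>] 0) (𝓝 (β * e)) := by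
      have : Continuous fun θ : ℝ => (β : ℝ) * ((1 - θ) * e - θ) := by fun_prop
      simpa using (this.tendsto 0).mono_left (nhdsWithin_le_nhds (s := Set.Ioi 0))
    have h2 : ∀ᶠ y in 𝓝[>] (0 : ℝ), y ∈ Set.Ioo 0 1 := Ioo_mem_nhdsGT one_pos
    obtain ⟨θ, h3, h4⟩ := ((hlim.eventually (lt_mem_nhds hτ)).and h2).exists
    exact ⟨θ, h4.1, h4.2, h3⟩
  obtain ⟨η, hη, hη1, δ, hδ, K, hK, N₀, hmain⟩ := h.exists_lintegral_weight_le β h.charge hθ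
  obtain ⟨K₂, hK₂, hdisc⟩ := h.lintegral_discrepancy_ge_le hβ hη hη1 hδ
  -- The trial charge is `ν` itself, on which the effective field vanishes: the replacement particle
  -- costs nothing.
  have hEν : ∫ t, E t ∂ν = 0 := by
    rw [integral_congr_ae (h.charge.ae_mem.mono h.eq_zero : E =ᵐ[ν] fun _ => 0)]
    simp
  have hc : 0 < β * (1 - θ) := mul_pos hβ' (by linarith)
  set M := ∫⁻ t, ENNReal.ofReal (‖deriv γ t‖ * Real.exp (-(β * (1 - θ) * E t))) with hM
  have hMtop : M ≠ ⊤ := (h.integrable _ hc).ne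
  set K₁ := K * Real.exp (β * (1 - θ) * e) * M.toReal with hK₁
  filter_upwards [eventually_ge_atTop N₀, eventually_mul_exp_le (K := K₁) hτθ,
    eventually_pow_mul_exp_le (τ := τ) hK₂ (show 0 < β * δ / 4 by positivity)] with N hN hN1 hN2
  obtain ⟨hNpos, hmainN⟩ := hmain N hN
  set Z := ∫⁻ x : Fin N → ℝ, ENNReal.ofReal (weight V β γ N x) with hZ
  have hZ0 : Z ≠ 0 := (h.lintegral_weight_pos β N).ne'
  have hZtop : Z ≠ ⊤ := (h.lintegral_weight_lt_top hβ N).ne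
  have hmeas : MeasurableSet {x : Fin N → ℝ | ∃ i, x i ∈ F} := by
    have : {x : Fin N → ℝ | ∃ i, x i ∈ F} = ⋃ i, {x | x i ∈ F} := by ext; simp
    rw [this]
    exact MeasurableSet.iUnion fun i => hF.preimage (measurable_pi_apply i)
  rw [realModel_apply V β γ N hmeas, ← hZ, mul_comm, ← div_eq_mul_inv,
    ENNReal.div_le_iff hZ0 hZtop]
  have hone : ∀ i : Fin N, ∫⁻ x in {x : Fin N → ℝ | x i ∈ F ∧
      discrepancy η (ν.map γ) γ x < δ * (N : ℝ) ^ 2}, ENNReal.ofReal (weight V β γ N x) ≤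
      ENNReal.ofReal (K₁ * Real.exp (-(β * ((1 - θ) * e - θ) * N))) * Z := by
    intro i
    refine (hmainN i F hF).trans ?_
    have hconf := h.lintegral_confined_le hc hF hFe hNpos
    have e1 : ∀ t, -(β * N * (1 - θ) * E t) = -(β * (1 - θ) * N * E t) := fun t => by ring
    simp only [e1]
    calc _ ≤ ENNReal.ofReal (K * Real.exp (β * N * (∫ t, E t ∂ν + θ))) *
          (ENNReal.ofReal (Real.exp (-(β * (1 - θ) * (N - 1) * e))) * M) * Z := by
          gcongr
          exact setLIntegral_le_lintegral _ _
      _ = _ := by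
          rw [hEν, ← ENNReal.ofReal_toReal hMtop, ← ENNReal.ofReal_mul (by positivity),
            ← ENNReal.ofReal_mul (by positivity)]
          congr 2
          have : Real.exp (β * N * (0 + θ)) * Real.exp (-(β * (1 - θ) * (N - 1) * e)) =
              Real.exp (β * (1 - θ) * e) * Real.exp (-(β * ((1 - θ) * e - θ) * N)) := by
            rw [← Real.exp_add, ← Real.exp_add]; congr 1; ring
          rw [hK₁, ← mul_assoc, mul_assoc K, this]
          ring
  -- Either some particle lies in `F` in a configuration of small discrepancy, handled by the union
  -- bound, or the discrepancy is large.
  have hcover : {x : Fin N → ℝ | ∃ i, x i ∈ F} ⊆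
      (⋃ i : Fin N, {x : Fin N → ℝ | x i ∈ F ∧ discrepancy η (ν.map γ) γ x < δ * (N : ℝ) ^ 2}) ∪
        {x | δ * (N : ℝ) ^ 2 ≤ discrepancy η (ν.map γ) γ x} := by
    rintro x ⟨i, hi⟩
    rcases lt_or_ge (discrepancy η (ν.map γ) γ x) (δ * (N : ℝ) ^ 2) with hx | hx
    · exact Or.inl (Set.mem_iUnion.2 ⟨i, hi, hx⟩)
    · exact Or.inr hx
  calc ∫⁻ x in {x : Fin N → ℝ | ∃ i, x i ∈ F}, ENNReal.ofReal (weight V β γ N x)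
      ≤ ∫⁻ x in (⋃ i : Fin N, {x : Fin N → ℝ | x i ∈ F ∧
          discrepancy η (ν.map γ) γ x < δ * (N : ℝ) ^ 2}) ∪
        {x | δ * (N : ℝ) ^ 2 ≤ discrepancy η (ν.map γ) γ x}, ENNReal.ofReal (weight V β γ N x) :=
        lintegral_mono_set hcover
    _ ≤ (∑ i : Fin N, ∫⁻ x in {x : Fin N → ℝ | x i ∈ F ∧
          discrepancy η (ν.map γ) γ x < δ * (N : ℝ) ^ 2}, ENNReal.ofReal (weight V β γ N x)) +
        ∫⁻ x in {x | δ * (N : ℝ) ^ 2 ≤ discrepancy η (ν.map γ) γ x},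
          ENNReal.ofReal (weight V β γ N x) := by
        refine (lintegral_union_le _ _ _).trans (add_le_add_left ?_ _)
        refine (lintegral_iUnion_le _ _).trans ?_
        rw [tsum_fintype]
    _ ≤ (∑ _i : Fin N, ENNReal.ofReal (K₁ * Real.exp (-(β * ((1 - θ) * e - θ) * N))) * Z) +
        ENNReal.ofReal (K₂ ^ N * Real.exp (-(β * δ / 4 * (N : ℝ) ^ 2))) * Z := by
        gcongr with i
        · exact hone i
        · exact hdisc N
    _ = ENNReal.ofReal (N * (K₁ * Real.exp (-(β * ((1 - θ) * e - θ) * N))) +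
          K₂ ^ N * Real.exp (-(β * δ / 4 * (N : ℝ) ^ 2))) * Z := by
        rw [ENNReal.ofReal_add (by positivity) (by positivity), add_mul,
          ENNReal.ofReal_mul (Nat.cast_nonneg N), ENNReal.ofReal_natCast]
        simp [mul_assoc]
    _ ≤ ENNReal.ofReal (Real.exp (-(τ * N))) * Z := by
        gcongr
        linarith

/-- Lower large deviation bound. -/
lemma eventually_le_realModel (h : IsEffectiveField V γ ν E C₀) {β : ℕ} (hβ : 0 < β)
    {a b : ℝ} {ρ : Measure ℝ} (hρ : IsCharge γ a b ρ) {U : Set ℝ} (hU : MeasurableSet U)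
    (hsub : Set.Icc a b ⊆ U) {τ : ℝ} (hτ : β * ∫ t, E t ∂ρ < τ) :
    ∀ᶠ N : ℕ in atTop, ENNReal.ofReal (Real.exp (-(τ * N))) ≤
      realModel V β γ N {x | ∃ i, x i ∈ U} := by
  have hβ' : (0 : ℝ) < β := Nat.cast_pos.2 hβ
  obtain ⟨θ, hθ, hθ1, hτθ⟩ : ∃ θ > 0, θ < 1 ∧ β * (∫ t, E t ∂ρ + θ) < τ := by
    have hlim : Tendsto (fun θ : ℝ => β * (∫ t, E t ∂ρ + θ)) (𝓝[>] 0)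
        (𝓝 (β * ∫ t, E t ∂ρ)) := by
      have : Continuous fun θ : ℝ => (β : ℝ) * (∫ t, E t ∂ρ + θ) := by fun_prop
      simpa using (this.tendsto 0).mono_left (nhdsWithin_le_nhds (s := Set.Ioi 0))
    have h2 : ∀ᶠ y in 𝓝[>] (0 : ℝ), y ∈ Set.Ioo 0 1 := Ioo_mem_nhdsGT one_pos
    obtain ⟨θ, h3, h4⟩ := ((hlim.eventually (gt_mem_nhds hτ)).and h2).exists
    exact ⟨θ, h4.1, h4.2, h3⟩
  obtain ⟨η, hη, hη1, δ, hδ, K, hK, N₀, hmain⟩ := h.exists_lintegral_weight_le β hρ hθ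
  obtain ⟨K₂, hK₂, hdisc⟩ := h.lintegral_discrepancy_ge_le hβ hη hη1 hδ
  have hc : 0 < β * (1 - θ) := mul_pos hβ' (by linarith)
  set M := ∫⁻ t, ENNReal.ofReal (‖deriv γ t‖ * Real.exp (-(β * (1 - θ) * E t))) with hM
  have hMtop : M ≠ ⊤ := (h.integrable _ hc).ne
  set K₁ := K * M.toReal with hK₁
  have hK₁0 : 0 ≤ K₁ := by positivity
  filter_upwards [eventually_ge_atTop N₀,
    eventually_mul_exp_le (K := K₁) (neg_lt_neg hτθ),
    eventually_pow_mul_exp_le (τ := 0) hK₂ (show 0 < β * δ / 4 by positivity)] with N hN hN1 hN2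
  obtain ⟨hNpos, hmainN⟩ := hmain N hN
  set Z := ∫⁻ x : Fin N → ℝ, ENNReal.ofReal (weight V β γ N x) with hZ
  have hZ0 : Z ≠ 0 := (h.lintegral_weight_pos β N).ne'
  have hZtop : Z ≠ ⊤ := (h.lintegral_weight_lt_top hβ N).ne
  have hmeas : MeasurableSet {x : Fin N → ℝ | ∃ i, x i ∈ U} := by
    have : {x : Fin N → ℝ | ∃ i, x i ∈ U} = ⋃ i, {x | x i ∈ U} := by ext; simp
    rw [this]
    exact MeasurableSet.iUnion fun i => hU.preimage (measurable_pi_apply i)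
  rw [realModel_apply V β γ N hmeas, ← hZ, mul_comm _ (∫⁻ x in _, _), ← div_eq_mul_inv,
    ENNReal.le_div_iff_mul_le (Or.inl hZ0) (Or.inl hZtop)]
  set i : Fin N := ⟨0, hNpos⟩
  set I := ∫⁻ x in {x : Fin N → ℝ | x i ∈ Set.Icc a b}, ENNReal.ofReal (weight V β γ N x) with hI
  have hIU : I ≤ ∫⁻ x in {x : Fin N → ℝ | ∃ i, x i ∈ U}, ENNReal.ofReal (weight V β γ N x) :=
    lintegral_mono_set fun x hx => ⟨i, hsub hx⟩
  refine le_trans ?_ hIU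
  have hItop : I ≠ ⊤ := ne_top_of_le_ne_top hZtop (setLIntegral_le_lintegral _ _)
  -- The comparison is read backwards: with `F = ℝ` it bounds the whole small-discrepancy mass by
  -- the mass `I` of configurations whose particle `i` is in `[a, b]`.
  have hgood : ∫⁻ x in {x : Fin N → ℝ | x i ∈ Set.univ ∧
      discrepancy η (ν.map γ) γ x < δ * (N : ℝ) ^ 2}, ENNReal.ofReal (weight V β γ N x) ≤
      ENNReal.ofReal (K₁ * Real.exp (β * (∫ t, E t ∂ρ + θ) * N)) * I := by
    refine (hmainN i Set.univ MeasurableSet.univ).trans ?_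
    have hconf := h.lintegral_confined_le hc MeasurableSet.univ (fun t _ => h.nonneg t) hNpos
    have e1 : ∀ t, -(β * N * (1 - θ) * E t) = -(β * (1 - θ) * N * E t) := fun t => by ring
    simp only [e1]
    rw [mul_zero, neg_zero, Real.exp_zero, ENNReal.ofReal_one, one_mul] at hconf
    calc _ ≤ ENNReal.ofReal (K * Real.exp (β * N * (∫ t, E t ∂ρ + θ))) * M * I := by
          gcongr
      _ = _ := by
          rw [← ENNReal.ofReal_toReal hMtop, ← ENNReal.ofReal_mul (by positivity)]
          congr 2
          rw [hK₁]
          ring_nf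
  -- The last term is eventually at most `Z / 2` and is absorbed on the left, as `Z` is finite;
  -- hence `I` is at least `e^{-τN} Z`.
  have hsplit : Z ≤ ENNReal.ofReal (K₁ * Real.exp (β * (∫ t, E t ∂ρ + θ) * N)) * I +
      ENNReal.ofReal (K₂ ^ N * Real.exp (-(β * δ / 4 * (N : ℝ) ^ 2))) * Z := by
    refine le_trans ?_ (add_le_add hgood (hdisc N))
    rw [hZ, ← setLIntegral_univ]
    refine (lintegral_mono_set fun x _ => ?_).trans (lintegral_union_le _ _ _)
    rcases lt_or_ge (discrepancy η (ν.map γ) γ x) (δ * (N : ℝ) ^ 2) with hx | hx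
    · exact Or.inl ⟨trivial, hx⟩
    · exact Or.inr hx
  rw [← ENNReal.ofReal_toReal hZtop, ← ENNReal.ofReal_toReal hItop,
    ← ENNReal.ofReal_mul (by positivity), ← ENNReal.ofReal_mul (by positivity),
    ← ENNReal.ofReal_add (by positivity) (by positivity)] at hsplit
  have hsplit' := (ENNReal.ofReal_le_ofReal_iff (by positivity)).1 hsplit
  rw [← ENNReal.ofReal_toReal hZtop, ← ENNReal.ofReal_toReal hItop,
    ← ENNReal.ofReal_mul (by positivity)]
  refine ENNReal.ofReal_le_ofReal ?_
  simp only [zero_mul, neg_zero, Real.exp_zero] at hN2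
  have hZr : 0 ≤ Z.toReal := ENNReal.toReal_nonneg
  have hIr : 0 ≤ I.toReal := ENNReal.toReal_nonneg
  have h1 : Z.toReal / 2 ≤ K₁ * Real.exp (β * (∫ t, E t ∂ρ + θ) * N) * I.toReal := by
    have := mul_le_mul_of_nonneg_right hN2 hZr
    linarith
  have hNge : (1 : ℝ) ≤ N := by exact_mod_cast hNpos
  have h2 : K₁ * Real.exp (β * (∫ t, E t ∂ρ + θ) * N) ≤ Real.exp (τ * N) / 2 := by
    have h3 : -(-τ * (N : ℝ)) = τ * N := by ring
    have h4 : -(-(β * (∫ t, E t ∂ρ + θ)) * (N : ℝ)) = β * (∫ t, E t ∂ρ + θ) * N := by ring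
    rw [h3, h4] at hN1
    refine le_trans ?_ hN1
    exact le_mul_of_one_le_left (by positivity) hNge
  have h5 := mul_le_mul_of_nonneg_right h2 hIr
  have h6 : Z.toReal ≤ Real.exp (τ * N) * I.toReal := by linarith
  have h7 := mul_le_mul_of_nonneg_left h6 (Real.exp_pos (-(τ * N))).le
  rw [← mul_assoc, ← Real.exp_add, neg_add_cancel, Real.exp_zero, one_mul] at h7
  exact h7

end IsEffectiveField

/-! ### Inversion of the Poisson transform -/

lemma integral_poisson_kernel_mul {f : ℝ → ℝ} {ε : ℝ} (hε : 0 < ε) (s : ℝ) :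
    ∫ t, f t * (ε / ((s - t) ^ 2 + ε ^ 2)) = ∫ y, f (s + ε * y) * (1 + y ^ 2)⁻¹ := by
  have h1 : ∫ t, f t * (ε / ((s - t) ^ 2 + ε ^ 2)) =
      ∫ t, f (s + t) * (ε / (t ^ 2 + ε ^ 2)) := by
    rw [← integral_add_left_eq_self _ s]
    refine integral_congr_ae (Eventually.of_forall fun t => ?_)
    simp
  rw [h1]
  have h2 := Measure.integral_comp_mul_left (fun t => f (s + t) * (ε / (t ^ 2 + ε ^ 2))) ε
  rw [abs_of_pos (inv_pos.2 hε), smul_eq_mul] at h2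
  have h3 : ∫ t, f (s + t) * (ε / (t ^ 2 + ε ^ 2)) =
      ε * ∫ x, f (s + ε * x) * (ε / ((ε * x) ^ 2 + ε ^ 2)) := by
    rw [h2, mul_inv_cancel_left₀ hε.ne']
  rw [h3, ← integral_const_mul]
  refine integral_congr_ae (Eventually.of_forall fun y => ?_)
  have h4 : (1 : ℝ) + y ^ 2 ≠ 0 := by positivity
  have h5 : (ε * y) ^ 2 + ε ^ 2 ≠ 0 := by positivity
  simp only
  have : ε * (ε / ((ε * y) ^ 2 + ε ^ 2)) = (1 + y ^ 2)⁻¹ := by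
    field_simp
    ring
  rw [← this]
  ring

/-- The Poisson kernels form an approximate identity of mass `π`. Fubini moves them onto the
continuous test function, where rescaling by `ε` allows dominated convergence. -/
lemma tendsto_integral_poisson {P : Measure ℝ} [IsProbabilityMeasure P] {f : ℝ → ℝ}
    (hf : Continuous f) (hfs : HasCompactSupport f) :
    Tendsto (fun ε : ℝ => ∫ t, f t * ∫ s, ε / ((s - t) ^ 2 + ε ^ 2) ∂P) (𝓝[>] 0)
      (𝓝 (Real.pi * ∫ s, f s ∂P)) := by
  obtain ⟨B, hB⟩ := hfs.exists_bound_of_continuous hf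
  have hB0 : 0 ≤ B := (norm_nonneg _).trans (hB 0)
  have hswap : ∀ᶠ ε in 𝓝[>] (0 : ℝ), ∫ t, f t * ∫ s, ε / ((s - t) ^ 2 + ε ^ 2) ∂P =
      ∫ s, (∫ y, f (s + ε * y) * (1 + y ^ 2)⁻¹) ∂P := by
    filter_upwards [self_mem_nhdsWithin] with ε hε
    have hε' : 0 < ε := hε
    simp only [← integral_poisson_kernel_mul hε', ← integral_const_mul]
    have hcont : Continuous fun p : ℝ × ℝ => ε / ((p.2 - p.1) ^ 2 + ε ^ 2) :=
      continuous_const.div (by fun_prop) fun p => by positivity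
    refine integral_integral_swap (f := fun t s => f t * (ε / ((s - t) ^ 2 + ε ^ 2))) ?_
    have hfi : Integrable (fun p : ℝ × ℝ => ‖f p.1‖ * (1 / ε)) (volume.prod P) :=
      ((hf.integrable_of_hasCompactSupport hfs).norm.comp_fst P).mul_const _
    refine hfi.mono' ((hf.comp continuous_fst).mul hcont).aestronglyMeasurable
      (Eventually.of_forall fun p => ?_)
    simp only [Function.uncurry]
    rw [norm_mul]
    refine mul_le_mul_of_nonneg_left ?_ (norm_nonneg _)
    rw [Real.norm_eq_abs, abs_of_nonneg (by positivity), div_le_div_iff₀ (by positivity) hε']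
    nlinarith [sq_nonneg (p.2 - p.1)]
  refine (tendsto_congr' hswap).2 ?_
  have hlim : Real.pi * ∫ s, f s ∂P = ∫ s, Real.pi * f s ∂P := (integral_const_mul _ _).symm
  rw [hlim]
  have hbound : ∀ s ε : ℝ, ‖∫ y, f (s + ε * y) * (1 + y ^ 2)⁻¹‖ ≤ B * Real.pi := by
    intro s ε
    calc ‖∫ y, f (s + ε * y) * (1 + y ^ 2)⁻¹‖ ≤ ∫ y : ℝ, B * (1 + y ^ 2)⁻¹ := by
          refine norm_integral_le_of_norm_le (integrable_inv_one_add_sq.const_mul B)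
            (Eventually.of_forall fun y => ?_)
          rw [norm_mul, Real.norm_of_nonneg (by positivity : (0 : ℝ) ≤ (1 + y ^ 2)⁻¹)]
          exact mul_le_mul_of_nonneg_right (hB _) (by positivity)
      _ = B * Real.pi := by rw [integral_const_mul, integral_univ_inv_one_add_sq]
  have hmeas : ∀ ε : ℝ, AEStronglyMeasurable (fun s => ∫ y, f (s + ε * y) * (1 + y ^ 2)⁻¹) P := by
    intro ε
    have hc : Continuous fun p : ℝ × ℝ => f (p.1 + ε * p.2) * (1 + p.2 ^ 2)⁻¹ :=
      (by fun_prop : Continuous fun p : ℝ × ℝ => f (p.1 + ε * p.2)).mul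
        ((by fun_prop : Continuous fun p : ℝ × ℝ => 1 + p.2 ^ 2).inv₀ fun p => by positivity)
    exact (hc.aestronglyMeasurable (μ := P.prod volume)).integral_prod_right'
  refine tendsto_integral_filter_of_dominated_convergence (fun _ => B * Real.pi)
    (Eventually.of_forall hmeas) (Eventually.of_forall fun ε => Eventually.of_forall fun s => hbound s ε)
    (integrable_const _) (Eventually.of_forall fun s => ?_)
  have hval : Real.pi * f s = ∫ y : ℝ, f s * (1 + y ^ 2)⁻¹ := by
    rw [integral_const_mul, integral_univ_inv_one_add_sq, mul_comm]
  rw [hval]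
  refine tendsto_integral_filter_of_dominated_convergence (fun y => B * (1 + y ^ 2)⁻¹)
    (Eventually.of_forall fun ε => ?_) (Eventually.of_forall fun ε => Eventually.of_forall fun y => ?_)
    (integrable_inv_one_add_sq.const_mul B) (Eventually.of_forall fun y => ?_)
  · exact ((by fun_prop : Continuous fun y : ℝ => f (s + ε * y)).mul
        ((by fun_prop : Continuous fun y : ℝ => 1 + y ^ 2).inv₀
          fun p => by positivity)).aestronglyMeasurable
  · rw [norm_mul, Real.norm_of_nonneg (by positivity : (0 : ℝ) ≤ (1 + y ^ 2)⁻¹)]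
    exact mul_le_mul_of_nonneg_right (hB _) (by positivity)
  · refine Tendsto.mul_const _ ?_
    have : Continuous fun ε : ℝ => f (s + ε * y) := by fun_prop
    simpa using (this.tendsto 0).mono_left (nhdsWithin_le_nhds (s := Set.Ioi 0))

/-- If the Poisson transform of `P` is bounded and converges almost everywhere to a function `D` near
the support of `f`, then `π ∫ f dP = ∫ f(t) D(t) dt`. -/
lemma integral_eq_of_tendsto_poisson {P : Measure ℝ} [IsProbabilityMeasure P] {f D : ℝ → ℝ}
    (hf : Continuous f) {S : Set ℝ} (hfs : HasCompactSupport f) (hS : ∀ t ∉ S, f t = 0) {B ε₀ : ℝ}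
    (hε₀ : 0 < ε₀)
    (hB : ∀ ε, 0 < ε → ε ≤ ε₀ → ∀ t ∈ S, |∫ s, ε / ((s - t) ^ 2 + ε ^ 2) ∂P| ≤ B)
    (hD : ∀ᵐ t, t ∈ S →
      Tendsto (fun ε : ℝ => ∫ s, ε / ((s - t) ^ 2 + ε ^ 2) ∂P) (𝓝[>] 0) (𝓝 (D t))) :
    Real.pi * ∫ s, f s ∂P = ∫ t, f t * D t := by
  refine tendsto_nhds_unique (tendsto_integral_poisson hf hfs) ?_
  have hev : ∀ᶠ ε in 𝓝[>] (0 : ℝ), 0 < ε ∧ ε ≤ ε₀ := Ioc_mem_nhdsGT hε₀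
  refine tendsto_integral_filter_of_dominated_convergence (fun t => ‖f t‖ * B) ?_ ?_
    ((hf.integrable_of_hasCompactSupport hfs).norm.mul_const B) ?_
  · filter_upwards [hev] with ε hε
    have hε' := hε.1
    have hcont : Continuous fun p : ℝ × ℝ => ε / ((p.2 - p.1) ^ 2 + ε ^ 2) :=
      continuous_const.div (by fun_prop) fun p => by positivity
    exact hf.aestronglyMeasurable.mul
      (hcont.aestronglyMeasurable (μ := volume.prod P)).integral_prod_right'
  · filter_upwards [hev] with ε hε
    refine Eventually.of_forall fun t => ?_
    by_cases ht : t ∈ S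
    · rw [norm_mul]
      exact mul_le_mul_of_nonneg_left (hB ε hε.1 hε.2 t ht) (norm_nonneg _)
    · simp [hS t ht]
  · filter_upwards [hD] with t ht
    by_cases htS : t ∈ S
    · exact (ht htS).const_mul _
    · simp [hS t htS]

/-! ### The pulled-back equilibrium measure near the cut -/

/-- The open rectangular neighbourhood of `[0, 1]` of size `r`. -/
def cutBox (r : ℝ) : Set ℂ := Set.Ioo (-r) (1 + r) ×ℂ Set.Ioo (-r) r

/-- The closed rectangular neighbourhood of `[0, 1]` of size `r`. -/
def cutClosedBox (r : ℝ) : Set ℂ := Set.Icc (-r) (1 + r) ×ℂ Set.Icc (-r) r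

lemma isOpen_cutBox (r : ℝ) : IsOpen (cutBox r) := isOpen_Ioo.reProdIm isOpen_Ioo

lemma convex_cutBox (r : ℝ) : Convex ℝ (cutBox r) :=
  ((convex_Ioo (-r) (1 + r)).linear_preimage Complex.reLm).inter
    ((convex_Ioo (-r) r).linear_preimage Complex.imLm)

lemma convex_cutClosedBox (r : ℝ) : Convex ℝ (cutClosedBox r) :=
  ((convex_Icc (-r) (1 + r)).linear_preimage Complex.reLm).inter
    ((convex_Icc (-r) r).linear_preimage Complex.imLm)

lemma isCompact_cutClosedBox (r : ℝ) : IsCompact (cutClosedBox r) :=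
  isCompact_Icc.reProdIm isCompact_Icc

lemma cutClosedBox_subset {ρ r : ℝ} (h : ρ < r) : cutClosedBox ρ ⊆ cutBox r := by
  rintro u ⟨⟨h1, h2⟩, h3, h4⟩
  exact ⟨⟨by linarith, by linarith⟩, by linarith, by linarith⟩

lemma ofReal_mem_cutBox {r : ℝ} (hr : 0 < r) {t : ℝ} (ht : t ∈ Set.Icc (0 : ℝ) 1) :
    (t : ℂ) ∈ cutBox r := by
  refine ⟨⟨?_, ?_⟩, ?_, ?_⟩ <;> simp <;> linarith [ht.1, ht.2]

lemma exists_cutBox_subset {D : Set ℂ} (hD : IsOpen D) (hseg : ∀ x ∈ Set.Icc (0 : ℝ) 1, (x : ℂ) ∈ D) :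
    ∃ r > 0, cutBox r ⊆ D := by
  set S : Set ℂ := (fun x : ℝ => (x : ℂ)) '' Set.Icc 0 1
  have hS : IsCompact S := isCompact_Icc.image Complex.continuous_ofReal
  obtain ⟨δ, hδ, hsub⟩ := hS.exists_cthickening_subset_open hD (by rintro _ ⟨x, hx, rfl⟩; exact hseg x hx)
  refine ⟨δ / 2, by positivity, fun u hu => hsub ?_⟩
  obtain ⟨⟨h1, h2⟩, h3, h4⟩ := hu
  set t := max 0 (min 1 u.re) with ht
  have htmem : t ∈ Set.Icc (0 : ℝ) 1 :=
    ⟨le_max_left _ _, max_le zero_le_one (min_le_left _ _)⟩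
  refine Metric.mem_cthickening_of_dist_le u (t : ℂ) δ S ⟨t, htmem, rfl⟩ ?_
  rw [dist_eq_norm]
  refine (Complex.norm_le_abs_re_add_abs_im _).trans ?_
  have hre : |(u - t).re| ≤ δ / 2 := by
    rw [Complex.sub_re, Complex.ofReal_re, abs_le]
    rcases le_total u.re 0 with h | h
    · have : t = 0 := by rw [ht, min_eq_right (by linarith), max_eq_left h]
      rw [this]; constructor <;> linarith
    rcases le_total u.re 1 with h' | h'
    · have : t = u.re := by rw [ht, min_eq_right h', max_eq_right h]
      rw [this]; constructor <;> linarith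
    · have : t = 1 := by rw [ht, min_eq_left h', max_eq_right zero_le_one]
      rw [this]; constructor <;> linarith
  have him : |(u - t).im| ≤ δ / 2 := by
    rw [Complex.sub_im, Complex.ofReal_im, sub_zero, abs_le]
    constructor <;> linarith
  linarith

/-- Quantitative injectivity and first order expansion of a biholomorphic map on a box. -/
lemma exists_bounds_of_injOn {G : ℂ → ℂ} {r ρ : ℝ} (hρ : 0 < ρ) (hρr : ρ < r)
    (hG : DifferentiableOn ℂ G (cutBox r)) (hinj : Set.InjOn G (cutBox r))
    (hG' : ∀ u ∈ cutBox r, deriv G u ≠ 0) :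
    ∃ c > 0, ∃ M ≥ 0, ∀ s ∈ cutClosedBox ρ, ∀ u ∈ cutClosedBox ρ,
      c * ‖s - u‖ ≤ ‖G s - G u‖ ∧ ‖G s - G u - deriv G u * (s - u)‖ ≤ M * ‖s - u‖ ^ 2 := by
  have hO := isOpen_cutBox r
  have hK := isCompact_cutClosedBox ρ
  have hsub := cutClosedBox_subset hρr
  have hne : (cutClosedBox ρ).Nonempty := ⟨0, by
    refine ⟨⟨?_, ?_⟩, ?_, ?_⟩ <;> simp <;> linarith⟩
  have hdG : DifferentiableOn ℂ (deriv G) (cutBox r) := hG.deriv hO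
  have hddG : ContinuousOn (deriv (deriv G)) (cutBox r) := (hdG.deriv hO).continuousOn
  obtain ⟨M, hM⟩ := hK.exists_bound_of_continuousOn (hddG.mono hsub)
  have hM0 : 0 ≤ M := (norm_nonneg _).trans (hM _ hne.some_mem)
  have hlip : ∀ s ∈ cutClosedBox ρ, ∀ u ∈ cutClosedBox ρ, ‖deriv G s - deriv G u‖ ≤ M * ‖s - u‖ :=
    fun s hs u hu => (convex_cutClosedBox ρ).norm_image_sub_le_of_norm_hasDerivWithin_le
      (fun x hx => ((hdG.differentiableAt (hO.mem_nhds (hsub hx))).hasDerivAt).hasDerivWithinAt)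
      hM hu hs
  have htaylor : ∀ s ∈ cutClosedBox ρ, ∀ u ∈ cutClosedBox ρ,
      ‖G s - G u - deriv G u * (s - u)‖ ≤ M * ‖s - u‖ ^ 2 := by
    intro s hs u hu
    have hseg : segment ℝ u s ⊆ cutClosedBox ρ := (convex_cutClosedBox ρ).segment_subset hu hs
    have h1 := (convex_segment u s).norm_image_sub_le_of_norm_hasDerivWithin_le
      (f := fun p => G p - deriv G u * p) (f' := fun p => deriv G p - deriv G u)
      (C := M * ‖s - u‖) (x := u) (y := s)
      (fun x hx => (((hG.differentiableAt (hO.mem_nhds (hsub (hseg hx)))).hasDerivAt).sub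
        (by simpa using (hasDerivAt_id x).const_mul (deriv G u))).hasDerivWithinAt)
      (fun x hx => by
        refine (hlip x (hseg hx) u hu).trans (mul_le_mul_of_nonneg_left ?_ hM0)
        have := norm_sub_le_of_mem_segment hx
        simpa [norm_sub_rev] using this)
      (left_mem_segment ℝ u s) (right_mem_segment ℝ u s)
    calc ‖G s - G u - deriv G u * (s - u)‖
        = ‖G s - deriv G u * s - (G u - deriv G u * u)‖ := by congr 1; ring
      _ ≤ M * ‖s - u‖ * ‖s - u‖ := h1
      _ = M * ‖s - u‖ ^ 2 := by ring
  obtain ⟨u₀, hu₀, hmin⟩ := hK.exists_isMinOn hne (f := fun u => ‖deriv G u‖)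
    ((hdG.continuousOn.mono hsub).norm)
  set c₀ := ‖deriv G u₀‖ with hc₀
  have hc₀0 : 0 < c₀ := norm_pos_iff.2 (hG' u₀ (hsub hu₀))
  -- At scale `d` the quadratic Taylor error is at most half of the linear term; `M + 1` guards
  -- against `M = 0`.
  set d := c₀ / (2 * (M + 1)) with hd
  have hd0 : 0 < d := by positivity
  have hnear : ∀ s ∈ cutClosedBox ρ, ∀ u ∈ cutClosedBox ρ, ‖s - u‖ ≤ d →
      c₀ / 2 * ‖s - u‖ ≤ ‖G s - G u‖ := by
    intro s hs u hu hsu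
    have h1 := htaylor s hs u hu
    have h2 : c₀ ≤ ‖deriv G u‖ := hmin hu
    have h3 : ‖deriv G u * (s - u)‖ ≤ ‖G s - G u‖ + ‖G s - G u - deriv G u * (s - u)‖ := by
      have : deriv G u * (s - u) = (G s - G u) - (G s - G u - deriv G u * (s - u)) := by ring
      rw [this]
      exact (norm_sub_le _ _).trans (by simp)
    rw [norm_mul] at h3
    have h4 : M * ‖s - u‖ ≤ c₀ / 2 := by
      have : M * ‖s - u‖ ≤ M * d := mul_le_mul_of_nonneg_left hsu hM0
      refine this.trans ?_
      rw [hd, ← mul_div_assoc, div_le_div_iff₀ (by positivity) (by positivity)]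
      nlinarith
    have h5 : M * ‖s - u‖ ^ 2 ≤ c₀ / 2 * ‖s - u‖ := by
      have := mul_le_mul_of_nonneg_right h4 (norm_nonneg (s - u))
      nlinarith
    have h6 := mul_le_mul_of_nonneg_right h2 (norm_nonneg (s - u))
    linarith
  -- Away from the diagonal, injectivity and compactness give a positive minimum of the difference
  -- quotient.
  have hfar : ∃ c₁ > 0, ∀ s ∈ cutClosedBox ρ, ∀ u ∈ cutClosedBox ρ, d ≤ ‖s - u‖ →
      c₁ * ‖s - u‖ ≤ ‖G s - G u‖ := by
    set K₂ : Set (ℂ × ℂ) := (cutClosedBox ρ ×ˢ cutClosedBox ρ) ∩ {p | d ≤ ‖p.1 - p.2‖} with hK₂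
    have hK₂c : IsCompact K₂ := (hK.prod hK).inter_right (isClosed_le (by fun_prop) (by fun_prop))
    have hGc := hG.continuousOn.mono hsub
    have hcont : ContinuousOn (fun p : ℂ × ℂ => ‖G p.1 - G p.2‖ / ‖p.1 - p.2‖) K₂ := by
      refine ContinuousOn.div (ContinuousOn.norm (ContinuousOn.sub ?_ ?_)) (by fun_prop) ?_
      · exact hGc.comp continuousOn_fst fun p hp => hp.1.1
      · exact hGc.comp continuousOn_snd fun p hp => hp.1.2
      · intro p hp
        have : d ≤ ‖p.1 - p.2‖ := hp.2
        linarith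
    rcases K₂.eq_empty_or_nonempty with he | hne₂
    · refine ⟨1, one_pos, fun s hs u hu hsu => ?_⟩
      have : (s, u) ∈ K₂ := ⟨⟨hs, hu⟩, hsu⟩
      rw [he] at this
      exact this.elim
    · obtain ⟨p, hp, hpmin⟩ := hK₂c.exists_isMinOn hne₂ hcont
      have hpd : d ≤ ‖p.1 - p.2‖ := hp.2
      refine ⟨‖G p.1 - G p.2‖ / ‖p.1 - p.2‖, div_pos (norm_pos_iff.2 ?_) (by linarith),
        fun s hs u hu hsu => ?_⟩
      · intro h0
        have := hinj (hsub hp.1.1) (hsub hp.1.2) (sub_eq_zero.1 h0)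
        rw [this] at hpd
        simp at hpd
        linarith
      · have h1 : ‖G p.1 - G p.2‖ / ‖p.1 - p.2‖ ≤ ‖G s - G u‖ / ‖s - u‖ :=
          hpmin (show (s, u) ∈ K₂ from ⟨⟨hs, hu⟩, hsu⟩)
        rwa [le_div_iff₀ (by linarith)] at h1
  obtain ⟨c₁, hc₁, hfar⟩ := hfar
  refine ⟨min (c₀ / 2) c₁, lt_min (by positivity) hc₁, M, hM0, fun s hs u hu => ⟨?_, htaylor s hs u hu⟩⟩
  rcases le_total ‖s - u‖ d with h | h
  · exact (mul_le_mul_of_nonneg_right (min_le_left _ _) (norm_nonneg _)).trans (hnear s hs u hu h)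
  · exact (mul_le_mul_of_nonneg_right (min_le_right _ _) (norm_nonneg _)).trans (hfar s hs u hu h)

/-- The branch of `8 √(u (u - 1))` on the strip `0 < Re u < 1`. -/
noncomputable def cutRoot (u : ℂ) : ℂ := 8 * I * (u * (1 - u)) ^ ((2 : ℕ) : ℂ)⁻¹

lemma cutRoot_sq (u : ℂ) : cutRoot u ^ 2 = 64 * u * (u - 1) := by
  rw [cutRoot, mul_pow, Complex.cpow_nat_inv_pow _ two_ne_zero, mul_pow, I_sq]
  ring

lemma mul_one_sub_mem_slitPlane {u : ℂ} (hu : u.re ∈ Set.Ioo (0 : ℝ) 1) : u * (1 - u) ∈ slitPlane := by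
  left
  simp only [mul_re, sub_re, one_re, sub_im, one_im]
  nlinarith [hu.1, hu.2, sq_nonneg u.im, mul_pos hu.1 (sub_pos.2 hu.2)]

lemma continuousAt_cutRoot {u : ℂ} (hu : u.re ∈ Set.Ioo (0 : ℝ) 1) : ContinuousAt cutRoot u := by
  unfold cutRoot
  exact continuousAt_const.mul
    ((by fun_prop : ContinuousAt (fun u : ℂ => u * (1 - u)) u).cpow continuousAt_const
      (mul_one_sub_mem_slitPlane hu))

lemma cutRoot_ne_zero {u : ℂ} (hu : u.re ∈ Set.Ioo (0 : ℝ) 1) : cutRoot u ≠ 0 := by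
  have h1 : cutRoot u ^ 2 ≠ 0 := by
    rw [cutRoot_sq]
    have := slitPlane_ne_zero (mul_one_sub_mem_slitPlane hu)
    intro h0
    apply this
    linear_combination (-1 / 64) * h0
  exact fun h0 => h1 (by rw [h0]; ring)

lemma cutRoot_ofReal {t : ℝ} (ht : t ∈ Set.Ioo (0 : ℝ) 1) :
    cutRoot t = 8 * I * (Real.sqrt (t * (1 - t)) : ℝ) := by
  unfold cutRoot
  congr 1
  have h1 : (t : ℂ) * (1 - t) = ((t * (1 - t) : ℝ) : ℂ) := by push_cast; ring
  have h2 : (((2 : ℕ) : ℂ)⁻¹) = ((1 / 2 : ℝ) : ℂ) := by push_cast; norm_num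
  rw [h1, h2, ← Complex.ofReal_cpow (mul_nonneg ht.1.le (sub_nonneg.2 ht.2.le)), Real.sqrt_eq_rpow]

/-- A function on a convex subset of the strip whose square is `64 u (u - 1)` is a branch of the
root. -/
lemma exists_sign_of_sq_eq {q : ℂ → ℂ} {T : Set ℂ} (hT : Convex ℝ T)
    (hTs : ∀ u ∈ T, u.re ∈ Set.Ioo (0 : ℝ) 1) (hq : ContinuousOn q T)
    (hsq : ∀ u ∈ T, q u ^ 2 = 64 * u * (u - 1)) :
    ∃ σ : ℝ, (σ = 1 ∨ σ = -1) ∧ ∀ u ∈ T, q u = σ * cutRoot u := by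
  rcases hT.isPreconnected.eq_or_eq_neg_of_sq_eq hq
    (fun u hu => (continuousAt_cutRoot (hTs u hu)).continuousWithinAt)
    (fun u hu => by simp only [Pi.pow_apply]; rw [hsq u hu, cutRoot_sq])
    (fun {u} hu => cutRoot_ne_zero (hTs u hu)) with h | h
  · exact ⟨1, Or.inl rfl, fun u hu => by simp [h hu]⟩
  · exact ⟨-1, Or.inr rfl, fun u hu => by simp [h hu]⟩

/-- A curve which is, along `[0, 1]`, the restriction of a biholomorphic map `G`; the constants
`c` and `M` control the injectivity and the first order expansion of `G`. -/
structure IsCutChart (γ : ℝ → ℂ) (G : ℂ → ℂ) (r c M : ℝ) : Prop where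
  continuous_curve : Continuous γ
  eq : ∀ s ∈ Set.Icc (0 : ℝ) 1, γ s = G s
  pos : 0 < r
  differentiableOn : DifferentiableOn ℂ G (cutBox (2 * r))
  const_pos : 0 < c
  const_nonneg : 0 ≤ M
  bounds : ∀ s ∈ cutClosedBox r, ∀ u ∈ cutClosedBox r,
      c * ‖s - u‖ ≤ ‖G s - G u‖ ∧ ‖G s - G u - deriv G u * (s - u)‖ ≤ M * ‖s - u‖ ^ 2

lemma ofReal_mem_cutClosedBox {r : ℝ} (hr : 0 < r) {t : ℝ} (ht : t ∈ Set.Icc (0 : ℝ) 1) :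
    (t : ℂ) ∈ cutClosedBox r := by
  refine ⟨⟨?_, ?_⟩, ?_, ?_⟩ <;> simp <;> linarith [ht.1, ht.2]

lemma ofReal_sub_ne_zero {u : ℂ} (hu : u.im ≠ 0) (s : ℝ) : (s : ℂ) - u ≠ 0 := by
  intro h
  apply hu
  have := congrArg Complex.im h
  simpa using this

namespace IsCutChart

variable {γ : ℝ → ℂ} {G : ℂ → ℂ} {r c M : ℝ}

lemma sub_ne_zero (h : IsCutChart γ G r c M) {s : ℝ} (hs : s ∈ Set.Icc (0 : ℝ) 1) {u : ℂ}
    (hu : u ∈ cutClosedBox r) (hsu : (s : ℂ) - u ≠ 0) : γ s - G u ≠ 0 := by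
  intro h0
  have h1 := (h.bounds s (ofReal_mem_cutClosedBox h.pos hs) u hu).1
  rw [← h.eq s hs, h0, norm_zero] at h1
  have := mul_pos h.const_pos (norm_pos_iff.2 hsu)
  linarith

/-- The poles at `u = s` cancel: the Cauchy kernel in the chart differs from the flat one by a
bounded function, which cannot affect the jump across the cut. -/
lemma norm_kernel_le (h : IsCutChart γ G r c M) {s : ℝ} (hs : s ∈ Set.Icc (0 : ℝ) 1) {u : ℂ}
    (hu : u ∈ cutClosedBox r) (hsu : (s : ℂ) - u ≠ 0) :
    ‖deriv G u * (γ s - G u)⁻¹ - ((s : ℂ) - u)⁻¹‖ ≤ M / c := by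
  obtain ⟨h1, h2⟩ := h.bounds s (ofReal_mem_cutClosedBox h.pos hs) u hu
  have h3 := h.sub_ne_zero hs hu hsu
  rw [← h.eq s hs] at h1 h2
  have h4 : deriv G u * (γ s - G u)⁻¹ - ((s : ℂ) - u)⁻¹ =
      -((γ s - G u - deriv G u * (s - u)) / ((γ s - G u) * (s - u))) := by
    field_simp
    ring
  have h5 : 0 < ‖(s : ℂ) - u‖ := norm_pos_iff.2 hsu
  rw [h4, norm_neg, norm_div, norm_mul]
  calc _ ≤ M * ‖(s : ℂ) - u‖ ^ 2 / (c * ‖(s : ℂ) - u‖ * ‖(s : ℂ) - u‖) := by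
        have := h.const_pos
        have := h.const_nonneg
        gcongr
    _ = M / c := by
        have := h.const_pos.ne'
        field_simp

lemma continuousAt_deriv (h : IsCutChart γ G r c M) {u : ℂ} (hu : u ∈ cutClosedBox r) :
    ContinuousAt G u ∧ ContinuousAt (deriv G) u := by
  have h1 : cutBox (2 * r) ∈ 𝓝 u :=
    (isOpen_cutBox _).mem_nhds (cutClosedBox_subset (by linarith [h.pos]) hu)
  exact ⟨(h.differentiableOn.differentiableAt h1).continuousAt,
    ((h.differentiableOn.deriv (isOpen_cutBox _)).differentiableAt h1).continuousAt⟩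

lemma measurable_inv (h : IsCutChart γ G r c M) (P : Measure ℝ) (z : ℂ) :
    AEStronglyMeasurable (fun s => (γ s - z)⁻¹) P :=
  ((h.continuous_curve.measurable.sub_const z).inv).aestronglyMeasurable

variable {P : Measure ℝ} [IsProbabilityMeasure P]

lemma norm_inv_le (h : IsCutChart γ G r c M) {s : ℝ} (hs : s ∈ Set.Icc (0 : ℝ) 1) {u : ℂ}
    (hu : u ∈ cutClosedBox r) (hui : u.im ≠ 0) : ‖(γ s - G u)⁻¹‖ ≤ (c * |u.im|)⁻¹ := by
  rw [norm_inv]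
  have h1 := (h.bounds s (ofReal_mem_cutClosedBox h.pos hs) u hu).1
  rw [← h.eq s hs] at h1
  have h2 : |u.im| ≤ ‖(s : ℂ) - u‖ := by
    have := Complex.abs_im_le_norm ((s : ℂ) - u)
    simpa using this
  have h3 := h.const_pos
  have h4 : 0 < |u.im| := abs_pos.2 hui
  exact inv_anti₀ (by positivity) ((mul_le_mul_of_nonneg_left h2 h3.le).trans h1)

lemma integrable_inv (h : IsCutChart γ G r c M) (hP : ∀ᵐ s ∂P, s ∈ Set.Icc (0 : ℝ) 1) {u : ℂ}
    (hu : u ∈ cutClosedBox r) (hui : u.im ≠ 0) : Integrable (fun s => (γ s - G u)⁻¹) P :=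
  Integrable.of_bound (h.measurable_inv P _) (c * |u.im|)⁻¹
    (hP.mono fun _ hs => h.norm_inv_le hs hu hui)

lemma continuousAt_integral_inv (h : IsCutChart γ G r c M)
    (hP : ∀ᵐ s ∂P, s ∈ Set.Icc (0 : ℝ) 1) {u : ℂ} (hu : u ∈ cutBox r) (hui : u.im ≠ 0) :
    ContinuousAt (fun u => ∫ s, (γ s - G u)⁻¹ ∂P) u := by
  have hsub : cutBox r ⊆ cutClosedBox r := fun v hv =>
    ⟨⟨hv.1.1.le, hv.1.2.le⟩, hv.2.1.le, hv.2.2.le⟩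
  have hpos : 0 < |u.im| := abs_pos.2 hui
  have hev : ∀ᶠ v in 𝓝 u, v ∈ cutClosedBox r ∧ |u.im| / 2 < |v.im| := by
    refine ((isOpen_cutBox r).mem_nhds hu |> fun h => eventually_of_mem h fun v hv => hsub hv).and ?_
    exact (Complex.continuous_im.abs.continuousAt (x := u)).eventually
      (lt_mem_nhds (by simpa using half_lt_self hpos))
  refine continuousAt_of_dominated (bound := fun _ => (c * (|u.im| / 2))⁻¹)
    (Eventually.of_forall fun v => h.measurable_inv P _) ?_ (integrable_const _) ?_
  · filter_upwards [hev] with v hv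
    refine hP.mono fun s hs => (h.norm_inv_le hs hv.1 ?_).trans ?_
    · exact abs_pos.1 (by linarith [hv.2])
    · have := h.const_pos
      gcongr
      exact hv.2.le
  · refine hP.mono fun s hs => ?_
    exact (continuousAt_const.sub (h.continuousAt_deriv (hsub hu)).1).inv₀
      (h.sub_ne_zero hs (hsub hu) (ofReal_sub_ne_zero hui s))

/-- The Poisson kernel is the difference of the Cauchy kernels at conjugate points, divided by `2i`.
Replacing flat kernels by those of the chart leaves the bounded remainder in the last integral. -/
lemma poisson_eq (h : IsCutChart γ G r c M) (hP : ∀ᵐ s ∂P, s ∈ Set.Icc (0 : ℝ) 1) {u : ℂ}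
    (hu : u ∈ cutClosedBox r) (hu' : (starRingEnd ℂ) u ∈ cutClosedBox r) (hui : u.im ≠ 0) :
    2 * I * ((∫ s, u.im / ((s - u.re) ^ 2 + u.im ^ 2) ∂P : ℝ) : ℂ) =
      deriv G u * (∫ s, (γ s - G u)⁻¹ ∂P) -
        deriv G ((starRingEnd ℂ) u) * (∫ s, (γ s - G ((starRingEnd ℂ) u))⁻¹ ∂P) -
        ∫ s, ((deriv G u * (γ s - G u)⁻¹ - ((s : ℂ) - u)⁻¹) -
          (deriv G ((starRingEnd ℂ) u) * (γ s - G ((starRingEnd ℂ) u))⁻¹ -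
            ((s : ℂ) - (starRingEnd ℂ) u)⁻¹)) ∂P := by
  have hui' : ((starRingEnd ℂ) u).im ≠ 0 := by simpa using hui
  have i1 := (h.integrable_inv hP hu hui).const_mul (deriv G u)
  have i2 := (h.integrable_inv hP hu' hui').const_mul (deriv G ((starRingEnd ℂ) u))
  have hm : ∀ v : ℂ, AEStronglyMeasurable (fun s : ℝ => ((s : ℂ) - v)⁻¹) P := fun v =>
    ((Complex.measurable_ofReal.sub_const v).inv).aestronglyMeasurable
  have i3 : ∀ v : ℂ, v.im ≠ 0 → Integrable (fun s : ℝ => ((s : ℂ) - v)⁻¹) P := fun v hv => by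
    refine Integrable.of_bound (hm v) (|v.im|)⁻¹ (Eventually.of_forall fun s => ?_)
    rw [norm_inv]
    refine inv_anti₀ (abs_pos.2 hv) ?_
    simpa using Complex.abs_im_le_norm ((s : ℂ) - v)
  have i4 : Integrable (fun s : ℝ => deriv G u * (γ s - G u)⁻¹ - ((s : ℂ) - u)⁻¹) P :=
    i1.sub (i3 u hui)
  have i5 : Integrable (fun s : ℝ => deriv G ((starRingEnd ℂ) u) * (γ s - G ((starRingEnd ℂ) u))⁻¹ -
      ((s : ℂ) - (starRingEnd ℂ) u)⁻¹) P := i2.sub (i3 _ hui')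
  rw [integral_sub i4 i5, integral_sub i1 (i3 u hui),
    integral_sub i2 (i3 _ hui'), integral_const_mul, integral_const_mul]
  have h1 : 2 * I * ((∫ s, u.im / ((s - u.re) ^ 2 + u.im ^ 2) ∂P : ℝ) : ℂ) =
      (∫ s : ℝ, ((s : ℂ) - u)⁻¹ ∂P) - ∫ s : ℝ, ((s : ℂ) - (starRingEnd ℂ) u)⁻¹ ∂P := by
    rw [← integral_sub (i3 u hui) (i3 _ hui'), ← integral_complex_ofReal, ← integral_const_mul]
    refine integral_congr_ae (Eventually.of_forall fun s => ?_)
    have e1 := ofReal_sub_ne_zero hui s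
    have e2 := ofReal_sub_ne_zero hui' s
    have e3 : ((s : ℂ) - u) * ((s : ℂ) - (starRingEnd ℂ) u) =
        (((s - u.re) ^ 2 + u.im ^ 2 : ℝ) : ℂ) := by
      apply Complex.ext
      · rw [Complex.ofReal_re]
        simp only [mul_re, sub_re, sub_im, ofReal_re, ofReal_im, conj_re, conj_im]
        ring
      · rw [Complex.ofReal_im]
        simp only [mul_im, sub_re, sub_im, ofReal_re, ofReal_im, conj_re, conj_im]
        ring
    have e4 : u - (starRingEnd ℂ) u = 2 * I * (u.im : ℂ) := by
      apply Complex.ext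
      · simp
      · simp; ring
    simp only
    rw [inv_sub_inv e1 e2, e3, Complex.ofReal_div, sub_sub_sub_cancel_left, e4]
    ring
  rw [h1]
  ring

end IsCutChart

/-! ### The semicircle law -/

lemma integral_sqrt_mul_one_sub : ∫ t in (0 : ℝ)..1, Real.sqrt (t * (1 - t)) = Real.pi / 8 := by
  have h1 := intervalIntegral.integral_comp_mul_sub (a := 0) (b := 1)
    (fun x : ℝ => Real.sqrt (1 - x ^ 2)) (c := 2) two_ne_zero 1
  norm_num at h1
  rw [integral_sqrt_one_sub_sq] at h1
  have h2 : ∀ t : ℝ, Real.sqrt (1 - (2 * t - 1) ^ 2) = 2 * Real.sqrt (t * (1 - t)) := by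
    intro t
    rw [show 1 - (2 * t - 1) ^ 2 = 2 ^ 2 * (t * (1 - t)) by ring, Real.sqrt_mul (by positivity),
      Real.sqrt_sq (by norm_num)]
  simp only [h2] at h1
  rw [intervalIntegral.integral_const_mul] at h1
  linarith

/-- The real square root of a negative number is `0` by convention, so the semicircle density needs
no indicator. -/
lemma sqrt_mul_one_sub_eq_zero {t : ℝ} (ht : t ∉ Set.Icc (0 : ℝ) 1) : Real.sqrt (t * (1 - t)) = 0 := by
  apply Real.sqrt_eq_zero_of_nonpos
  by_contra! h
  apply ht
  constructor <;> nlinarith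

lemma integral_semicircle (f : ℝ → ℝ) :
    ∫ t, f t ∂semicircle = 8 / Real.pi * ∫ t, f t * Real.sqrt (t * (1 - t)) := by
  unfold semicircle
  rw [integral_withDensity_eq_integral_toReal_smul (by fun_prop)
    (Eventually.of_forall fun _ => ENNReal.ofReal_lt_top), ← integral_const_mul,
    ← integral_indicator measurableSet_Icc]
  refine integral_congr_ae (Eventually.of_forall fun t => ?_)
  have hpi := Real.pi_pos
  by_cases ht : t ∈ Set.Icc (0 : ℝ) 1
  · simp only [Set.indicator_of_mem ht, smul_eq_mul]
    rw [ENNReal.toReal_ofReal (by positivity)]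
    ring
  · simp only [Set.indicator_of_notMem ht, sqrt_mul_one_sub_eq_zero ht]
    ring

lemma semicircle_eq : semicircle =
    volume.withDensity fun t => ENNReal.ofReal (8 / Real.pi * Real.sqrt (t * (1 - t))) := by
  unfold semicircle
  rw [← withDensity_indicator measurableSet_Icc]
  congr 1
  ext t
  by_cases ht : t ∈ Set.Icc (0 : ℝ) 1
  · rw [Set.indicator_of_mem ht]
  · rw [Set.indicator_of_notMem ht, sqrt_mul_one_sub_eq_zero ht]
    simp

lemma sqrt_mul_one_sub_le (t : ℝ) : Real.sqrt (t * (1 - t)) ≤ 1 / 2 := by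
  rw [show (1 / 2 : ℝ) = Real.sqrt ((1 / 2) ^ 2) by rw [Real.sqrt_sq (by norm_num)]]
  exact Real.sqrt_le_sqrt (by nlinarith [sq_nonneg (t - 1 / 2)])

lemma semicircle_le :
    semicircle ≤ ENNReal.ofReal (4 / Real.pi) • volume.restrict (Set.Icc (0 : ℝ) 1) := by
  unfold semicircle
  rw [← withDensity_const]
  refine withDensity_mono (Eventually.of_forall fun t => ENNReal.ofReal_le_ofReal ?_)
  have := sqrt_mul_one_sub_le t
  have hpi := Real.pi_pos
  rw [div_mul_eq_mul_div, div_le_div_iff_of_pos_right hpi]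
  linarith

instance : IsProbabilityMeasure semicircle := by
  have hfin : semicircle Set.univ < ⊤ := (semicircle_le _).trans_lt (by
    simp only [Measure.smul_apply, Measure.restrict_apply_univ, Real.volume_Icc, smul_eq_mul]
    exact ENNReal.mul_lt_top ENNReal.ofReal_lt_top ENNReal.ofReal_lt_top)
  have h1 := integral_semicircle fun _ => 1
  have h2 : ∫ t : ℝ, (1 : ℝ) * Real.sqrt (t * (1 - t)) = Real.pi / 8 := by
    rw [← integral_sqrt_mul_one_sub, intervalIntegral.integral_of_le zero_le_one,
      ← integral_Icc_eq_integral_Ioc, ← integral_indicator measurableSet_Icc]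
    refine integral_congr_ae (Eventually.of_forall fun t => ?_)
    by_cases ht : t ∈ Set.Icc (0 : ℝ) 1
    · simp [Set.indicator_of_mem ht]
    · simp [Set.indicator_of_notMem ht, sqrt_mul_one_sub_eq_zero ht]
  rw [h2, integral_const, smul_eq_mul, mul_one, Measure.real, div_mul_div_comm, mul_comm Real.pi,
    div_self (by have := Real.pi_pos; positivity)] at h1
  exact ⟨(ENNReal.toReal_eq_one_iff _).1 h1⟩

/-! ### Recovering the measure on the cut from its Poisson transform. -/

namespace IsCutChart

variable {γ : ℝ → ℂ} {G : ℂ → ℂ} {r c M : ℝ} {P : Measure ℝ} [IsProbabilityMeasure P]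

lemma tendsto_line {f : ℂ → ℂ} {t : ℝ} (hf : ContinuousAt f t) (a : ℂ) :
    Tendsto (fun ε : ℝ => f (t + ε * a)) (𝓝[>] 0) (𝓝 (f t)) := by
  have h1 : Tendsto (fun ε : ℝ => (t : ℂ) + ε * a) (𝓝[>] 0) (𝓝 t) := by
    have : Continuous fun ε : ℝ => (t : ℂ) + ε * a := by fun_prop
    have h2 := this.tendsto 0
    simp only [Complex.ofReal_zero, zero_mul, add_zero] at h2
    exact h2.mono_left nhdsWithin_le_nhds
  exact hf.tendsto.comp h1

lemma add_mul_I_mem {t ε : ℝ} (ht : t ∈ Set.Icc (-r) (1 + r)) (hε : 0 < ε) (hεr : ε ≤ r) :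
    (t : ℂ) + ε * I ∈ cutClosedBox r ∧ (t : ℂ) + ε * (-I) ∈ cutClosedBox r := by
  constructor
  · refine ⟨⟨?_, ?_⟩, ?_, ?_⟩ <;> simp <;> linarith [ht.1, ht.2]
  · refine ⟨⟨?_, ?_⟩, ?_, ?_⟩ <;> simp <;> linarith [ht.1, ht.2]

lemma conj_add_mul_I (t ε : ℝ) : (starRingEnd ℂ) ((t : ℂ) + ε * I) = (t : ℂ) + ε * (-I) := by
  simp

/-- The Poisson transform of a measure in terms of its Cauchy transform in the chart. -/
lemma poisson_line (h : IsCutChart γ G r c M) (hP : ∀ᵐ s ∂P, s ∈ Set.Icc (0 : ℝ) 1) {H q : ℂ → ℂ}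
    (hq : ∀ u, q u = deriv G u * (∫ s, (γ s - G u)⁻¹ ∂P) + H u)
    {t ε : ℝ} (ht : t ∈ Set.Icc (-r) (1 + r)) (hε : 0 < ε) (hεr : ε ≤ r) :
    2 * I * ((∫ s, ε / ((s - t) ^ 2 + ε ^ 2) ∂P : ℝ) : ℂ) =
      q (t + ε * I) - q (t + ε * (-I)) - (H (t + ε * I) - H (t + ε * (-I))) -
        ∫ s, ((deriv G (t + ε * I) * (γ s - G (t + ε * I))⁻¹ - ((s : ℂ) - (t + ε * I))⁻¹) -
          (deriv G (t + ε * (-I)) * (γ s - G (t + ε * (-I)))⁻¹ -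
            ((s : ℂ) - (t + ε * (-I)))⁻¹)) ∂P := by
  obtain ⟨h1, h2⟩ := add_mul_I_mem ht hε hεr
  have h3 := h.poisson_eq hP h1 (by rwa [conj_add_mul_I]) (by simpa using hε.ne')
  rw [conj_add_mul_I] at h3
  have e1 : ((t : ℂ) + ε * I).im = ε := by simp
  have e2 : ((t : ℂ) + ε * I).re = t := by simp
  rw [e1, e2] at h3
  rw [h3, hq, hq]
  ring

lemma im_line_ne_zero {t ε : ℝ} (hε : 0 < ε) :
    ((t : ℂ) + ε * I).im ≠ 0 ∧ ((t : ℂ) + ε * (-I)).im ≠ 0 := by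
  simp [hε.ne']

/-- `q` is bounded because its square is a polynomial, and the other terms are bounded too. This
domination is what rules out a singular part of `P`. -/
lemma exists_poisson_bound (h : IsCutChart γ G r c M) (hP : ∀ᵐ s ∂P, s ∈ Set.Icc (0 : ℝ) 1)
    {H q : ℂ → ℂ} (hH : ContinuousOn H (cutClosedBox r))
    (hq : ∀ u, q u = deriv G u * (∫ s, (γ s - G u)⁻¹ ∂P) + H u)
    (hsq : ∀ u ∈ cutClosedBox r, u.im ≠ 0 → q u ^ 2 = 64 * u * (u - 1)) :
    ∃ B, ∀ ε, 0 < ε → ε ≤ r → ∀ t ∈ Set.Icc (-r) (1 + r),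
      |∫ s, ε / ((s - t) ^ 2 + ε ^ 2) ∂P| ≤ B := by
  obtain ⟨BH, hBH⟩ := (isCompact_cutClosedBox r).exists_bound_of_continuousOn hH
  obtain ⟨Bq, hBq⟩ := (isCompact_cutClosedBox r).exists_bound_of_continuousOn
    (f := fun u : ℂ => 64 * u * (u - 1)) (by fun_prop)
  have hq' : ∀ u ∈ cutClosedBox r, u.im ≠ 0 → ‖q u‖ ≤ 1 + Bq := by
    intro u hu hui
    have h1 := hBq u hu
    rw [← hsq u hu hui, norm_pow] at h1
    nlinarith [norm_nonneg (q u), sq_nonneg (‖q u‖ - 1)]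
  refine ⟨2 * (1 + Bq) + 2 * BH + 2 * (M / c), fun ε hε hεr t ht => ?_⟩
  have h1 := h.poisson_line hP hq ht hε hεr
  obtain ⟨m1, m2⟩ := add_mul_I_mem ht hε hεr
  obtain ⟨n1, n2⟩ := im_line_ne_zero (t := t) hε
  set J := ∫ s, ε / ((s - t) ^ 2 + ε ^ 2) ∂P
  have h2 : ‖2 * I * (J : ℂ)‖ = 2 * |J| := by simp
  have h3 : |J| ≤ ‖2 * I * (J : ℂ)‖ := by rw [h2]; linarith [abs_nonneg J]
  refine h3.trans ?_
  rw [h1]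
  refine (norm_sub_le _ _).trans (add_le_add ((norm_sub_le _ _).trans (add_le_add
    ((norm_sub_le _ _).trans ?_) ((norm_sub_le _ _).trans ?_))) ?_)
  · linarith [hq' _ m1 n1, hq' _ m2 n2]
  · linarith [hBH _ m1, hBH _ m2]
  · refine (norm_integral_le_of_norm_le_const (hP.mono fun s hs => ?_)).trans
      (by rw [probReal_univ, mul_one])
    refine (norm_sub_le _ _).trans ?_
    linarith [h.norm_kernel_le hs m1 (ofReal_sub_ne_zero n1 s),
      h.norm_kernel_le hs m2 (ofReal_sub_ne_zero n2 s)]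

lemma tendsto_poisson_of_notMem (hP : ∀ᵐ s ∂P, s ∈ Set.Icc (0 : ℝ) 1) {t : ℝ}
    (ht : t ∉ Set.Icc (0 : ℝ) 1) :
    Tendsto (fun ε : ℝ => ∫ s, ε / ((s - t) ^ 2 + ε ^ 2) ∂P) (𝓝[>] 0) (𝓝 0) := by
  obtain ⟨d, hd, hdist⟩ : ∃ d > 0, ∀ s ∈ Set.Icc (0 : ℝ) 1, d ≤ |s - t| := by
    rw [Set.mem_Icc, not_and_or, not_le, not_le] at ht
    rcases ht with ht | ht
    · exact ⟨-t, by linarith, fun s hs => le_trans (by linarith [hs.1]) (le_abs_self _)⟩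
    · exact ⟨t - 1, by linarith, fun s hs => by rw [abs_sub_comm]; exact le_trans (by linarith [hs.2]) (le_abs_self _)⟩
  have hlim : Tendsto (fun ε : ℝ => ε / d ^ 2) (𝓝[>] 0) (𝓝 0) := by
    have : Continuous fun ε : ℝ => ε / d ^ 2 := by fun_prop
    simpa using (this.tendsto 0).mono_left (nhdsWithin_le_nhds (s := Set.Ioi 0))
  refine squeeze_zero_norm' ?_ hlim
  filter_upwards [self_mem_nhdsWithin] with ε hε
  have hε : 0 < ε := hε
  refine (norm_integral_le_of_norm_le_const (C := ε / d ^ 2) (hP.mono fun s hs => ?_)).trans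
    (by rw [probReal_univ, mul_one])
  rw [Real.norm_of_nonneg (by positivity)]
  have h1 : d ^ 2 ≤ (s - t) ^ 2 := by
    rw [← sq_abs (s - t)]
    exact pow_le_pow_left₀ hd.le (hdist s hs) 2
  gcongr
  nlinarith

/-- On each half strip `q` is a constant sign times `cutRoot`, while `H` and the bounded kernel have
no jump. The two signs need not be known: they only enter the constant `k`, which total mass
determines later. -/
lemma tendsto_poisson_of_mem (h : IsCutChart γ G r c M) (hP : ∀ᵐ s ∂P, s ∈ Set.Icc (0 : ℝ) 1)
    {H q : ℂ → ℂ} (hH : ContinuousOn H (cutClosedBox r))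
    (hq : ∀ u, q u = deriv G u * (∫ s, (γ s - G u)⁻¹ ∂P) + H u)
    (hsq : ∀ u ∈ cutClosedBox r, u.im ≠ 0 → q u ^ 2 = 64 * u * (u - 1)) :
    ∃ k : ℝ, ∀ t ∈ Set.Ioo (0 : ℝ) 1, P {t} = 0 →
      Tendsto (fun ε : ℝ => ∫ s, ε / ((s - t) ^ 2 + ε ^ 2) ∂P) (𝓝[>] 0)
        (𝓝 (k * Real.sqrt (t * (1 - t)))) := by
  have hr := h.pos
  set T₁ : Set ℂ := Set.Ioo (0 : ℝ) 1 ×ℂ Set.Ioo 0 r with hT₁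
  set T₂ : Set ℂ := Set.Ioo (0 : ℝ) 1 ×ℂ Set.Ioo (-r) 0 with hT₂
  have hc₁ : Convex ℝ T₁ := ((convex_Ioo (0 : ℝ) 1).linear_preimage Complex.reLm).inter
    ((convex_Ioo 0 r).linear_preimage Complex.imLm)
  have hc₂ : Convex ℝ T₂ := ((convex_Ioo (0 : ℝ) 1).linear_preimage Complex.reLm).inter
    ((convex_Ioo (-r) 0).linear_preimage Complex.imLm)
  have hb : ∀ u : ℂ, u.re ∈ Set.Ioo (0 : ℝ) 1 → u.im ∈ Set.Ioo (-r) r → u ∈ cutBox r :=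
    fun u h1 h2 => ⟨⟨by linarith [h1.1], by linarith [h1.2]⟩, h2⟩
  have hb₁ : ∀ u ∈ T₁, u ∈ cutBox r ∧ u.im ≠ 0 := fun u hu =>
    ⟨hb u hu.1 ⟨by linarith [hu.2.1], hu.2.2⟩, hu.2.1.ne'⟩
  have hb₂ : ∀ u ∈ T₂, u ∈ cutBox r ∧ u.im ≠ 0 := fun u hu =>
    ⟨hb u hu.1 ⟨hu.2.1, by linarith [hu.2.2]⟩, hu.2.2.ne⟩
  have hsub : cutBox r ⊆ cutClosedBox r := fun v hv =>
    ⟨⟨hv.1.1.le, hv.1.2.le⟩, hv.2.1.le, hv.2.2.le⟩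
  have hHat : ∀ u ∈ cutBox r, ContinuousAt H u := fun u hu =>
    hH.continuousAt (mem_of_superset ((isOpen_cutBox r).mem_nhds hu) hsub)
  have hqc : ∀ u ∈ cutBox r, u.im ≠ 0 → ContinuousAt q u := fun u hu hui => by
    rw [show q = fun u => deriv G u * (∫ s, (γ s - G u)⁻¹ ∂P) + H u from funext hq]
    exact ((h.continuousAt_deriv (hsub hu)).2.mul (h.continuousAt_integral_inv hP hu hui)).add
      (hHat u hu)
  obtain ⟨σ₁, -, hσ₁⟩ := exists_sign_of_sq_eq hc₁ (fun u hu => hu.1)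
    (fun u hu => (hqc u (hb₁ u hu).1 (hb₁ u hu).2).continuousWithinAt)
    (fun u hu => hsq u (hsub (hb₁ u hu).1) (hb₁ u hu).2)
  obtain ⟨σ₂, -, hσ₂⟩ := exists_sign_of_sq_eq hc₂ (fun u hu => hu.1)
    (fun u hu => (hqc u (hb₂ u hu).1 (hb₂ u hu).2).continuousWithinAt)
    (fun u hu => hsq u (hsub (hb₂ u hu).1) (hb₂ u hu).2)
  refine ⟨(σ₁ - σ₂) * 4, fun t ht hPt => ?_⟩
  have hev : ∀ᶠ ε in 𝓝[>] (0 : ℝ), 0 < ε ∧ ε < r := Ioo_mem_nhdsGT hr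
  have htI : t ∈ Set.Icc (-r) (1 + r) := ⟨by linarith [ht.1], by linarith [ht.2]⟩
  have htb : (t : ℂ) ∈ cutBox r := hb t (by simpa using ht) (by simp [hr])
  have hroot : ContinuousAt cutRoot (t : ℂ) := continuousAt_cutRoot (by simpa using ht)
  have l₁ : Tendsto (fun ε : ℝ => q (t + ε * I)) (𝓝[>] 0) (𝓝 (σ₁ * cutRoot t)) := by
    refine ((tendsto_line hroot I).const_mul (σ₁ : ℂ)).congr' ?_
    filter_upwards [hev] with ε hε
    exact (hσ₁ _ ⟨by simpa using ht, by simpa using hε⟩).symm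
  have l₂ : Tendsto (fun ε : ℝ => q (t + ε * (-I))) (𝓝[>] 0) (𝓝 (σ₂ * cutRoot t)) := by
    refine ((tendsto_line hroot (-I)).const_mul (σ₂ : ℂ)).congr' ?_
    filter_upwards [hev] with ε hε
    exact (hσ₂ _ ⟨by simpa using ht, by simp [hε.1, hε.2]⟩).symm
  have l₃ : Tendsto (fun ε : ℝ => ∫ s,
      ((deriv G (t + ε * I) * (γ s - G (t + ε * I))⁻¹ - ((s : ℂ) - (t + ε * I))⁻¹) -
          (deriv G (t + ε * (-I)) * (γ s - G (t + ε * (-I)))⁻¹ -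
            ((s : ℂ) - (t + ε * (-I)))⁻¹)) ∂P) (𝓝[>] 0) (𝓝 (∫ _ : ℝ, (0 : ℂ) ∂P)) := by
    have hm : ∀ v : ℂ, AEStronglyMeasurable (fun s : ℝ => ((s : ℂ) - v)⁻¹) P := fun v =>
      ((Complex.measurable_ofReal.sub_const v).inv).aestronglyMeasurable
    refine tendsto_integral_filter_of_dominated_convergence (fun _ => M / c + M / c)
      (Eventually.of_forall fun ε => ?_) ?_ (integrable_const _) ?_
    · exact (((h.measurable_inv P _).const_mul _).sub (hm _)).sub
        (((h.measurable_inv P _).const_mul _).sub (hm _))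
    · filter_upwards [hev] with ε hε
      obtain ⟨m1, m2⟩ := add_mul_I_mem htI hε.1 hε.2.le
      obtain ⟨n1, n2⟩ := im_line_ne_zero (t := t) hε.1
      refine hP.mono fun s hs => (norm_sub_le _ _).trans ?_
      exact add_le_add (h.norm_kernel_le hs m1 (ofReal_sub_ne_zero n1 s))
        (h.norm_kernel_le hs m2 (ofReal_sub_ne_zero n2 s))
    -- The kernel difference is only used as a continuous function of `u` at `t` when `s ≠ t`; hence
    -- the requirement that `t` not be an atom.
    · have hne : ∀ᵐ s ∂P, s ≠ t := by
        rw [ae_iff]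
        simpa using hPt
      filter_upwards [hP, hne] with s hs hst
      have hst' : (s : ℂ) - t ≠ 0 := by
        rw [← Complex.ofReal_sub]
        exact_mod_cast _root_.sub_ne_zero.2 hst
      obtain ⟨c1, c2⟩ := h.continuousAt_deriv (hsub htb)
      have hk : ContinuousAt (fun u : ℂ => deriv G u * (γ s - G u)⁻¹ - ((s : ℂ) - u)⁻¹) t :=
        (c2.mul ((continuousAt_const.sub c1).inv₀ (h.sub_ne_zero hs (hsub htb) hst'))).sub
          ((continuousAt_const.sub continuousAt_id).inv₀ hst')
      simpa using (tendsto_line hk I).sub (tendsto_line hk (-I))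
  have l₄ := ((l₁.sub l₂).sub ((tendsto_line (hHat t htb) I).sub
    (tendsto_line (hHat t htb) (-I)))).sub l₃
  have l₅ : Tendsto (fun ε : ℝ => 2 * I * ((∫ s, ε / ((s - t) ^ 2 + ε ^ 2) ∂P : ℝ) : ℂ)) (𝓝[>] 0)
      (𝓝 (2 * I * (((σ₁ - σ₂) * 4 * Real.sqrt (t * (1 - t)) : ℝ) : ℂ))) := by
    refine (l₄.congr' ?_).trans_eq ?_
    · filter_upwards [hev] with ε hε
      exact (h.poisson_line hP hq htI hε.1 hε.2.le).symm
    · congr 1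
      rw [integral_zero, cutRoot_ofReal ht]
      push_cast
      ring
  have l₆ := (Complex.continuous_re.tendsto _).comp (l₅.const_mul (2 * I)⁻¹)
  have hI : (2 * I : ℂ) ≠ 0 := by simp
  simpa only [Function.comp_def, inv_mul_cancel_left₀ hI, Complex.ofReal_re] using l₆

/-- A probability measure on `[0, 1]` whose Cauchy transform in the chart is an algebraic function
with the branch points of the semicircle law is the semicircle law. -/
lemma eq_semicircle (h : IsCutChart γ G r c M) (hP : ∀ᵐ s ∂P, s ∈ Set.Icc (0 : ℝ) 1)
    {H : ℂ → ℂ} (hH : ContinuousOn H (cutClosedBox r))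
    (hsq : ∀ u ∈ cutClosedBox r, u.im ≠ 0 →
      (deriv G u * (∫ s, (γ s - G u)⁻¹ ∂P) + H u) ^ 2 = 64 * u * (u - 1)) :
    P = semicircle := by
  have hr := h.pos
  obtain ⟨B, hB⟩ := h.exists_poisson_bound hP hH (fun u => rfl) hsq
  obtain ⟨k, hk⟩ := h.tendsto_poisson_of_mem hP hH (fun u => rfl) hsq
  -- A probability measure has countably many atoms, hence Lebesgue-almost no point is one.
  have hatoms : ∀ᵐ t : ℝ, P {t} = 0 := by
    have : {t : ℝ | ¬ P {t} = 0}.Countable := by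
      simpa [pos_iff_ne_zero] using Measure.countable_meas_pos_of_disjoint_iUnion
        (μ := P) (As := fun t : ℝ => {t}) (fun _ => measurableSet_singleton _)
        (fun a b hab => by simpa using hab)
    exact this.measure_zero _
  have hends : ∀ᵐ t : ℝ, t ≠ 0 ∧ t ≠ 1 := by
    have : {t : ℝ | ¬ (t ≠ 0 ∧ t ≠ 1)}.Countable :=
      (Set.toFinite ({0, 1} : Set ℝ)).countable.mono fun t ht => by
        by_contra h'
        simp at h'
        exact ht h'
    exact this.measure_zero _
  have hD : ∀ᵐ t : ℝ, t ∈ Set.Icc (-r) (1 + r) → Tendsto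
      (fun ε : ℝ => ∫ s, ε / ((s - t) ^ 2 + ε ^ 2) ∂P) (𝓝[>] 0)
        (𝓝 (k * Real.sqrt (t * (1 - t)))) := by
    filter_upwards [hatoms, hends] with t ht ht' _
    by_cases h01 : t ∈ Set.Icc (0 : ℝ) 1
    · exact hk t ⟨lt_of_le_of_ne h01.1 ht'.1.symm, lt_of_le_of_ne h01.2 ht'.2⟩ ht
    · rw [sqrt_mul_one_sub_eq_zero h01, mul_zero]
      exact tendsto_poisson_of_notMem hP h01
  -- The Poisson bound holds only over the box; a cutoff equal to `1` on `[0, 1]` localises test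
  -- functions there without changing either integral.
  obtain ⟨χ, hχ1, hχ0, hχc, -⟩ := exists_continuous_one_zero_of_isCompact
    (isCompact_Icc (a := (0 : ℝ)) (b := 1)) (isOpen_Ioo (a := -r) (b := 1 + r)).isClosed_compl
    (Set.disjoint_compl_right_iff_subset.2 (Set.Icc_subset_Ioo (by linarith) (by linarith)))
  have key : ∀ g : ℝ → ℝ, Continuous g → ∫ t, g t ∂P = k / 8 * ∫ t, g t ∂semicircle := by
    intro g hg
    have h1 := integral_eq_of_tendsto_poisson (f := fun t => g t * χ t) (hg.mul χ.continuous)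
      (S := Set.Icc (-r) (1 + r)) (hχc.mul_left) (fun t ht => by
        have : χ t = 0 := hχ0 (fun h' => ht (Set.Ioo_subset_Icc_self h'))
        simp [this]) hr (fun ε hε hεr t ht => hB ε hε hεr t ht) hD
    have h2 : ∫ t, g t * χ t ∂P = ∫ t, g t ∂P := integral_congr_ae (hP.mono fun t ht => by
      have : χ t = 1 := hχ1 ht
      simp [this])
    have h3 : ∫ t, g t * χ t * (k * Real.sqrt (t * (1 - t))) =
        k * ∫ t, g t * Real.sqrt (t * (1 - t)) := by
      rw [← integral_const_mul]
      refine integral_congr_ae (Eventually.of_forall fun t => ?_)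
      by_cases ht : t ∈ Set.Icc (0 : ℝ) 1
      · have : χ t = 1 := hχ1 ht
        simp only [this]
        ring
      · simp only [sqrt_mul_one_sub_eq_zero ht]
        ring
    rw [h2, h3] at h1
    rw [integral_semicircle]
    have hpi := Real.pi_pos.ne'
    field_simp
    linarith
  -- Both measures have mass one, so testing against `1` gives `k / 8 = 1`.
  have h1 := key (fun _ => 1) continuous_const
  simp at h1
  refine ext_of_forall_integral_eq_of_IsFiniteMeasure fun f => ?_
  rw [key f f.continuous, ← h1, one_mul]

end IsCutChart

/-! ### Identification of the pulled-back equilibrium measure -/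

/-- The normal direction of an injective curve leaves the curve. -/
lemma eventually_normal_notMem_image {γ : ℝ → ℂ} (hc : Continuous γ) (hinj : Function.Injective γ)
    {s : ℝ} {g : ℂ} (hd : HasDerivAt γ g s) (hg : g ≠ 0) :
    ∀ᶠ t : ℝ in 𝓝[>] 0, γ s + t * (I * g) ∉ γ '' Set.Icc 0 1 := by
  have hg' : 0 < ‖g‖ := norm_pos_iff.2 hg
  have h1 := (hasDerivAt_iff_isLittleO.1 hd).def (half_pos hg')
  obtain ⟨δ, hδ, hball⟩ := Metric.eventually_nhds_iff_ball.1 h1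
  have hK : IsCompact (γ '' (Set.Icc 0 1 \ Metric.ball s δ)) :=
    (isCompact_Icc.diff Metric.isOpen_ball).image hc
  have hs : γ s ∈ (γ '' (Set.Icc 0 1 \ Metric.ball s δ))ᶜ := by
    rintro ⟨x, hx, hxs⟩
    rw [hinj hxs] at hx
    exact hx.2 (Metric.mem_ball_self hδ)
  have hlim : Tendsto (fun t : ℝ => γ s + t * (I * g)) (𝓝[>] 0) (𝓝 (γ s)) := by
    have : Continuous fun t : ℝ => γ s + t * (I * g) := by fun_prop
    have h2 := this.tendsto 0
    simp only [Complex.ofReal_zero, zero_mul, add_zero] at h2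
    exact h2.mono_left nhdsWithin_le_nhds
  filter_upwards [hlim.eventually (hK.isClosed.isOpen_compl.mem_nhds hs), self_mem_nhdsWithin]
    with t ht ht0
  have ht0 : 0 < t := ht0
  rintro ⟨x, hx, hxs⟩
  have hxb : x ∈ Metric.ball s δ := by
    by_contra hxb
    exact ht ⟨x, ⟨hx, hxb⟩, hxs⟩
  have h3 := hball x hxb
  have h4 : γ x - γ s - (x - s) • g = (t * I - (x - s : ℝ)) * g := by
    rw [hxs, Complex.real_smul]
    push_cast
    ring
  rw [h4, norm_mul, Real.norm_eq_abs] at h3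
  -- If the normal meets the curve at `γ x` near `s`, differentiability bounds this modulus by `|x -
  -- s| / 2`, but its real part already has modulus `|x - s|`. So `x = s`, which forces `t = 0`.
  have h5 : ‖(t * I - (x - s : ℝ) : ℂ)‖ ≤ 1 / 2 * |x - s| := by
    by_contra! h6
    have := mul_lt_mul_of_pos_right h6 hg'
    linarith
  have h6 := Complex.abs_re_le_norm (t * I - (x - s : ℝ) : ℂ)
  have h7 := Complex.abs_im_le_norm (t * I - (x - s : ℝ) : ℂ)
  simp at h6 h7
  rw [abs_sub_comm] at h6
  push_cast at h5
  have h8 : |x - s| = 0 := le_antisymm (by linarith) (abs_nonneg _)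
  rw [h8] at h5
  have : 0 < |t| := abs_pos.2 ht0.ne'
  linarith

lemma hasDerivAt_integral_sqrt (x : ℝ) :
    HasDerivAt (fun x => ∫ s in (0 : ℝ)..x, Real.sqrt (s * (1 - s))) (Real.sqrt (x * (1 - x))) x := by
  have hc : Continuous fun s : ℝ => Real.sqrt (s * (1 - s)) := by fun_prop
  exact intervalIntegral.integral_hasDerivAt_right (hc.intervalIntegrable _ _)
    (hc.stronglyMeasurableAtFilter _ _) hc.continuousAt

/-- The boundary values of the density in an analytic parametrisation. -/
lemma ae_boundary_value {f : ℝ → ℂ} (hf : ∀ x ∈ Set.Icc (0 : ℝ) 1, (∫ s in (0 : ℝ)..x, f s) =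
      ((8 / Real.pi * ∫ s in (0 : ℝ)..x, Real.sqrt (s * (1 - s)) : ℝ) : ℂ)) :
    ∀ᵐ x : ℝ, x ∈ Set.Ioo (0 : ℝ) 1 → f x = ((8 / Real.pi * Real.sqrt (x * (1 - x)) : ℝ) : ℂ) := by
  have hint : IntervalIntegrable f volume 0 1 := by
    -- A non-integrable integrand would have integral `0` by convention, whereas the value at `x =
    -- 1` is `1`.
    by_contra hni
    have h1 := hf 1 (by simp)
    rw [intervalIntegral.integral_undef hni, integral_sqrt_mul_one_sub] at h1
    have hpi := Real.pi_pos
    have : (8 / Real.pi * (Real.pi / 8) : ℝ) = 1 := by field_simp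
    rw [this] at h1
    simp at h1
  filter_upwards [hint.ae_hasDerivAt_integral] with x hx hx01
  have h1 := hx (by rw [Set.uIcc_of_le zero_le_one]; exact Set.Ioo_subset_Icc_self hx01) 0 (by simp)
  have h2 : HasDerivAt (fun x => ((8 / Real.pi * ∫ s in (0 : ℝ)..x, Real.sqrt (s * (1 - s)) : ℝ) : ℂ))
      ((8 / Real.pi * Real.sqrt (x * (1 - x)) : ℝ) : ℂ) x :=
    ((hasDerivAt_integral_sqrt x).const_mul (8 / Real.pi)).ofReal_comp
  have h3 : (fun x => ∫ s in (0 : ℝ)..x, f s) =ᶠ[𝓝 x]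
      fun x => ((8 / Real.pi * ∫ s in (0 : ℝ)..x, Real.sqrt (s * (1 - s)) : ℝ) : ℂ) := by
    filter_upwards [Icc_mem_nhds hx01.1 hx01.2] with y hy using hf y hy
  exact h1.unique (h2.congr_of_eventuallyEq h3)

/-- A nonzero boundary value is a root of the algebraic equation of the curve. -/
lemma ae_algebraic_boundary {V R : ℂ[X]} {μ : Measure ℂ} {γ h : ℝ → ℂ} (hγ : ContDiff ℝ ∞ γ)
    (hinj : Function.Injective γ) (hsupp : γ '' Set.Icc 0 1 = μ.support)
    (hR : ∀ z ∉ μ.support, R.eval z = sqrtR V μ z ^ 2)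
    (hlim : ∀ s ∈ Set.Ioo (0 : ℝ) 1,
      Tendsto (fun t : ℝ => sqrtR V μ (γ s + t * (I * deriv γ s))) (𝓝[>] 0) (𝓝 (h s)))
    (hint : ∀ x ∈ Set.Icc (0 : ℝ) 1, (∫ s in (0 : ℝ)..x, 1 / (I * Real.pi) * h s * deriv γ s) =
        ((8 / Real.pi * ∫ s in (0 : ℝ)..x, Real.sqrt (s * (1 - s)) : ℝ) : ℂ)) :
    ∀ᵐ x : ℝ, x ∈ Set.Ioo (0 : ℝ) 1 →
      R.eval (γ x) * deriv γ x ^ 2 = 64 * (x : ℂ) * (x - 1) := by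
  filter_upwards [ae_boundary_value hint] with x hx hx01
  have hpi : (Real.pi : ℂ) ≠ 0 := by exact_mod_cast Real.pi_pos.ne'
  have hpos : 0 < x * (1 - x) := mul_pos hx01.1 (by linarith [hx01.2])
  have h1 : h x * deriv γ x = 8 * I * (Real.sqrt (x * (1 - x)) : ℝ) := by
    have h2 := hx hx01
    push_cast at h2
    have h3 : h x * deriv γ x = (I * Real.pi) * (1 / (I * Real.pi) * h x * deriv γ x) := by
      have := I_ne_zero
      field_simp
    rw [h3, h2]
    field_simp
  -- The boundary value times `γ'` is nonzero, so the curve is regular at `x` and its normal is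
  -- available.
  have h4 : deriv γ x ≠ 0 := by
    intro h0
    rw [h0, mul_zero] at h1
    have : (Real.sqrt (x * (1 - x)) : ℂ) ≠ 0 := by exact_mod_cast (Real.sqrt_pos.2 hpos).ne'
    have h5 : (8 * I : ℂ) ≠ 0 := by simp
    exact mul_ne_zero h5 this h1.symm
  have hd : HasDerivAt γ (deriv γ x) x := (hγ.differentiable (by simp) x).hasDerivAt
  have hline : Tendsto (fun t : ℝ => γ x + t * (I * deriv γ x)) (𝓝[>] 0) (𝓝 (γ x)) := by
    have : Continuous fun t : ℝ => γ x + t * (I * deriv γ x) := by fun_prop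
    have h2 := this.tendsto 0
    simp only [Complex.ofReal_zero, zero_mul, add_zero] at h2
    exact h2.mono_left nhdsWithin_le_nhds
  have h6 : Tendsto (fun t : ℝ => R.eval (γ x + t * (I * deriv γ x))) (𝓝[>] 0)
      (𝓝 (R.eval (γ x))) := (R.continuous.tendsto _).comp hline
  -- Along the normal, eventually off the support, `R` is the square of `sqrtR`; continuity of `R`
  -- identifies the limit.
  have h7 : R.eval (γ x) = h x ^ 2 := by
    refine tendsto_nhds_unique h6 (((hlim x hx01).pow 2).congr' ?_)
    filter_upwards [eventually_normal_notMem_image hγ.continuous hinj hd h4] with t ht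
    rw [hR _ (by rwa [← hsupp])]
  rw [h7, ← mul_pow, h1, mul_pow, mul_pow, I_sq]
  have h8 : ((Real.sqrt (x * (1 - x)) : ℝ) : ℂ) ^ 2 = (x * (1 - x) : ℝ) := by
    exact_mod_cast congrArg (fun y : ℝ => (y : ℂ)) (Real.sq_sqrt hpos.le)
  rw [h8]
  push_cast
  ring

/-- Identity theorem: equality almost everywhere on the segment holds on a dense set of it, hence at
points accumulating at `1/2`. -/
lemma eqOn_cutBox {r : ℝ} (hr : 0 < r) {f g : ℂ → ℂ} (hf : DifferentiableOn ℂ f (cutBox r))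
    (hg : DifferentiableOn ℂ g (cutBox r))
    (hfg : ∀ᵐ x : ℝ, x ∈ Set.Ioo (0 : ℝ) 1 → f x = g x) : Set.EqOn f g (cutBox r) := by
  have hO := isOpen_cutBox r
  refine (hf.analyticOnNhd hO).eqOn_of_preconnected_of_frequently_eq (hg.analyticOnNhd hO)
    (convex_cutBox r).isPreconnected (z₀ := ((1 / 2 : ℝ) : ℂ))
    (ofReal_mem_cutBox hr (by norm_num)) ?_
  have h1 : ∃ᶠ x : ℝ in 𝓝[≠] (1 / 2 : ℝ), f x = g x := by
    rw [frequently_iff]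
    intro U hU
    obtain ⟨O, hO, hhalf, hOU⟩ := mem_nhdsWithin.1 hU
    have hne : ((O ∩ Set.Ioo (0 : ℝ) 1) ∩ {1 / 2}ᶜ).Nonempty := by
      have : (O ∩ Set.Ioo (0 : ℝ) 1) ∩ {1 / 2}ᶜ ∈ 𝓝[≠] (1 / 2 : ℝ) :=
        inter_mem (mem_nhdsWithin_of_mem_nhds
          ((hO.inter isOpen_Ioo).mem_nhds ⟨hhalf, by norm_num⟩)) self_mem_nhdsWithin
      exact nonempty_of_mem this
    have hop : IsOpen ((O ∩ Set.Ioo (0 : ℝ) 1) ∩ {1 / 2}ᶜ) :=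
      (hO.inter isOpen_Ioo).inter isOpen_compl_singleton
    have hdense : Dense {x : ℝ | x ∈ Set.Ioo (0 : ℝ) 1 → f x = g x} := by
      exact Measure.dense_of_ae hfg
    obtain ⟨x, hx1, hx2⟩ := hdense.inter_open_nonempty _ hop hne
    exact ⟨x, hOU ⟨hx1.1.1, hx1.2⟩, hx2 hx1.1.2⟩
  have h2 : Tendsto (fun x : ℝ => (x : ℂ)) (𝓝[≠] (1 / 2 : ℝ)) (𝓝[≠] ((1 / 2 : ℝ) : ℂ)) :=
    tendsto_nhdsWithin_of_tendsto_nhds_of_eventually_within _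
      ((Complex.continuous_ofReal.tendsto _).mono_left nhdsWithin_le_nhds)
      (by filter_upwards [self_mem_nhdsWithin] with x hx h0
          exact hx (Complex.ofReal_injective (Set.mem_singleton_iff.1 h0)))
  exact h2.frequently h1

/-- A zero of `G'` would be a zero of order at least two on the left, while the zeros `0` and `1` on
the right are simple. -/
lemma deriv_ne_zero_of_algebraic {r : ℝ} {G : ℂ → ℂ} {R : ℂ[X]}
    (hG : DifferentiableOn ℂ G (cutBox r))
    (halg : ∀ u ∈ cutBox r, R.eval (G u) * deriv G u ^ 2 = 64 * u * (u - 1)) :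
    ∀ u ∈ cutBox r, deriv G u ≠ 0 := by
  intro u hu h0
  have hnhds := (isOpen_cutBox r).mem_nhds hu
  have h1 := halg u hu
  have hG1 : HasDerivAt G (deriv G u) u := (hG.differentiableAt hnhds).hasDerivAt
  have hG2 : HasDerivAt (deriv G) (deriv (deriv G) u) u :=
    ((hG.deriv (isOpen_cutBox r)).differentiableAt hnhds).hasDerivAt
  have h2 : HasDerivAt (fun u => R.eval (G u) * deriv G u ^ 2) 0 u := by
    exact (((R.hasDerivAt (G u)).comp u hG1).mul (hG2.pow 2)).congr_deriv (by simp [h0])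
  have h3 : HasDerivAt (fun u : ℂ => 64 * u * (u - 1)) (64 * (u - 1) + 64 * u) u := by
    exact (((hasDerivAt_id u).const_mul 64).mul ((hasDerivAt_id u).sub_const 1)).congr_deriv
      (by simp)
  have h4 : (fun u => R.eval (G u) * deriv G u ^ 2) =ᶠ[𝓝 u] fun u : ℂ => 64 * u * (u - 1) := by
    filter_upwards [hnhds] with v hv using halg v hv
  have h5 := (h2.congr_of_eventuallyEq h4.symm).unique h3
  rw [h0] at h1
  have h6 : u * (u - 1) = 0 := by linear_combination (-1 / 64) * h1
  have h7 : 2 * u - 1 = 0 := by linear_combination (-1 / 64) * h5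
  rcases mul_eq_zero.1 h6 with h | h
  · rw [h] at h7
    norm_num at h7
  · rw [sub_eq_zero.1 h] at h7
    norm_num at h7

/-- The chart of the curve around the support of the equilibrium measure. -/
lemma exists_isCutChart {V R : ℂ[X]} {μ : Measure ℂ} {γ : ℝ → ℂ} (hγ : ContDiff ℝ ∞ γ)
    (hinj : Function.Injective γ) (hR : ∀ z ∉ μ.support, R.eval z = sqrtR V μ z ^ 2)
    (hpar : IsAnalyticParametrisation V μ γ) :
    ∃ G r c M, IsCutChart γ G r c M ∧
      (∀ u ∈ cutClosedBox r, R.eval (G u) * deriv G u ^ 2 = 64 * u * (u - 1)) ∧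
      (∀ s ∈ Set.Icc (0 : ℝ) 1, deriv γ s ≠ 0) := by
  obtain ⟨hsupp, ⟨h, hlim, hint⟩, ε, hε, D, G, hD, hGD, hGinj, hG⟩ := hpar
  obtain ⟨r, hr, hrD⟩ := exists_cutBox_subset hD fun x hx =>
    (hG x ⟨by linarith [hx.1], by linarith [hx.2]⟩).1
  have hGr := hGD.mono hrD
  have hderiv : ∀ s ∈ Set.Icc (0 : ℝ) 1, deriv γ s = deriv G s := by
    intro s hs
    have h1 : HasDerivAt G (deriv G s) (s : ℂ) :=
      (hGr.differentiableAt ((isOpen_cutBox r).mem_nhds (ofReal_mem_cutBox hr hs))).hasDerivAt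
    have h2 : HasDerivAt (fun x : ℝ => G x) (deriv G s) s := h1.comp_ofReal
    refine (h2.congr_of_eventuallyEq ?_).deriv
    filter_upwards [Icc_mem_nhds (show -ε < s by linarith [hs.1]) (show s < 1 + ε by linarith [hs.2])]
      with x hx using (hG x hx).2
  have halg : ∀ u ∈ cutBox r, R.eval (G u) * deriv G u ^ 2 = 64 * u * (u - 1) := by
    refine eqOn_cutBox hr ((R.differentiable.comp_differentiableOn hGr).mul
      ((hGr.deriv (isOpen_cutBox r)).pow 2)) (by fun_prop) ?_
    filter_upwards [ae_algebraic_boundary hγ hinj hsupp hR hlim hint] with x hx hx01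
    have hx' := Set.Ioo_subset_Icc_self hx01
    rw [← hx hx01, hderiv x hx', (hG x ⟨by linarith [hx01.1], by linarith [hx01.2]⟩).2]
  have hne := deriv_ne_zero_of_algebraic hGr halg
  obtain ⟨c, hc, M, hM, hb⟩ := exists_bounds_of_injOn (half_pos hr) (half_lt_self hr) hGr
    (hGinj.mono hrD) hne
  refine ⟨G, r / 2, c, M, ⟨hγ.continuous, fun s hs => ?_, half_pos hr, ?_, hc, hM, hb⟩,
    fun u hu => halg u (cutClosedBox_subset (half_lt_self hr) hu), fun s hs => ?_⟩
  · exact (hG s ⟨by linarith [hs.1], by linarith [hs.2]⟩).2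
  · rwa [mul_div_cancel₀ r two_ne_zero]
  · rw [hderiv s hs]
    exact hne s (ofReal_mem_cutBox hr hs)

/-- The equilibrium measure is the push-forward of the semicircle law. -/
lemma eq_map_semicircle {V R : ℂ[X]} {μ : Measure ℂ} [IsProbabilityMeasure μ] {γ : ℝ → ℂ}
    {G : ℂ → ℂ} {r c M : ℝ} (h : IsCutChart γ G r c M) (hinj : Function.Injective γ)
    (hcar : μ (Set.range γ)ᶜ = 0) (hsupp : γ '' Set.Icc 0 1 = μ.support)
    (hR : ∀ z ∉ μ.support, R.eval z = sqrtR V μ z ^ 2)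
    (halg : ∀ u ∈ cutClosedBox r, R.eval (G u) * deriv G u ^ 2 = 64 * u * (u - 1)) :
    μ = semicircle.map γ := by
  have hemb : MeasurableEmbedding γ := h.continuous_curve.measurableEmbedding hinj
  -- `γ` is a measurable embedding carrying `μ`, so pulling back to the line and pushing forward
  -- again loses nothing.
  set P := μ.comap γ with hPdef
  have hmap : P.map γ = μ := by
    rw [hemb.map_comap]
    exact Measure.restrict_eq_self_of_ae_mem (by rw [ae_iff]; exact hcar)
  have : IsProbabilityMeasure P := by
    refine ⟨?_⟩
    have h1 : (P.map γ) Set.univ = 1 := by rw [hmap]; exact measure_univ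
    rwa [Measure.map_apply h.continuous_curve.measurable MeasurableSet.univ, Set.preimage_univ] at h1
  have hP : ∀ᵐ s ∂P, s ∈ Set.Icc (0 : ℝ) 1 := by
    have h1 : ∀ᵐ z ∂(P.map γ), z ∈ μ.support := by
      rw [hmap, ae_iff]
      exact Measure.measure_compl_support
    have h2 := ae_of_ae_map h.continuous_curve.aemeasurable h1
    filter_upwards [h2] with s hs
    rw [← hsupp] at hs
    obtain ⟨x, hx, hxs⟩ := hs
    rwa [← hinj hxs]
  have hsub : cutClosedBox r ⊆ cutBox (2 * r) := cutClosedBox_subset (by linarith [h.pos])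
  have hPs : P = semicircle := by
    refine h.eq_semicircle hP (H := fun u => deriv G u * V.derivative.eval (G u)) ?_ ?_
    · exact ((h.differentiableOn.deriv (isOpen_cutBox _)).continuousOn.mono hsub).mul
        (V.derivative.continuous.comp_continuousOn (h.differentiableOn.continuousOn.mono hsub))
    · intro u hu hui
      rw [← halg u hu, hR (G u) ?_, sqrtR, ← hmap, hemb.integral_map]
      · ring
      · rw [← hsupp]
        rintro ⟨s, hs, hsu⟩
        exact h.sub_ne_zero hs hu (ofReal_sub_ne_zero hui s) (sub_eq_zero.2 hsu)
  rw [← hPs, hmap]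

/-! ### Extended-real potentials and energies of regular measures -/

/-- For an almost everywhere real, integrable function both parts are finite, so the convention for
`∞ - ∞` plays no role. -/
lemma eintegral_eq_integral {X : Type*} [MeasurableSpace X] {μ : Measure X} {f : X → EReal}
    {g : X → ℝ} (hfg : ∀ᵐ x ∂μ, f x = g x) (hg : Integrable g μ) :
    eintegral μ f = ((∫ x, g x ∂μ : ℝ) : EReal) := by
  have h1 : ∫⁻ x, (f x).toENNReal ∂μ = ∫⁻ x, ENNReal.ofReal (g x) ∂μ :=
    lintegral_congr_ae (hfg.mono fun x hx => by simp only [hx, EReal.real_coe_toENNReal])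
  have h2 : ∫⁻ x, (-f x).toENNReal ∂μ = ∫⁻ x, ENNReal.ofReal (-g x) ∂μ :=
    lintegral_congr_ae (hfg.mono fun x hx => by
      simp only [hx, ← EReal.coe_neg, EReal.real_coe_toENNReal])
  have t1 : ∫⁻ x, ENNReal.ofReal (g x) ∂μ ≠ ⊤ := hg.lintegral_lt_top.ne
  have t2 : ∫⁻ x, ENNReal.ofReal (-g x) ∂μ ≠ ⊤ := hg.neg.lintegral_lt_top.ne
  rw [eintegral, h1, h2, integral_eq_lintegral_pos_part_sub_lintegral_neg_part hg, EReal.coe_sub,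
    EReal.coe_ennreal_toReal t1, EReal.coe_ennreal_toReal t2]

lemma logKernel_eq {z w : ℂ} (h : z - w ≠ 0) : logKernel z w = ((-Real.log ‖z - w‖ : ℝ) : EReal) := by
  rw [logKernel, edist_dist, dist_eq_norm, ENNReal.log_ofReal_of_pos (norm_pos_iff.2 h),
    EReal.coe_neg]

lemma potential_eq {R A : ℝ} {ρ : Measure ℂ} (h : IsRegular R A ρ) (z : ℂ) :
    potential ρ z = ((-logPot ρ z : ℝ) : EReal) := by
  rw [potential, eintegral_eq_integral ((h.ae_ne z).mono fun w hw => logKernel_eq hw)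
    (h.integrable_log z).neg, integral_neg, logPot]

/-! ### Energies on a curve and the Euler–Lagrange condition. -/

section Curve

variable {V : ℂ[X]} {γ : ℝ → ℂ} {ν : Measure ℝ} {R A : ℝ}

lemma eintegral_logKernel_curve (hγ : Continuous γ) (h : IsRegular R A (ν.map γ)) (x : ℝ) :
    eintegral ν (fun y => logKernel (γ x) (γ y)) = ((-logPot (ν.map γ) (γ x) : ℝ) : EReal) := by
  have hm := hγ.measurable
  have h1 := (integrable_map_measure (h.integrable_log (γ x)).1 hm.aemeasurable).1
    (h.integrable_log (γ x))
  rw [eintegral_eq_integral ((ae_of_ae_map hm.aemeasurable (h.ae_ne (γ x))).mono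
    fun y hy => logKernel_eq hy) h1.neg]
  congr 1
  have h2 : logPot (ν.map γ) (γ x) = ∫ y, Real.log ‖γ x - γ y‖ ∂ν :=
    integral_map hm.aemeasurable (h.integrable_log (γ x)).1
  rw [h2, ← integral_neg]

/-- The kernel of the energy on the curve. -/
noncomputable def curveKernel (V : ℂ[X]) (γ : ℝ → ℂ) (p : ℝ × ℝ) : ℝ :=
  -Real.log ‖γ p.1 - γ p.2‖ + field V (γ p.1) + field V (γ p.2)

lemma curveKernel_swap (p : ℝ × ℝ) : curveKernel V γ p.swap = curveKernel V γ p := by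
  simp only [curveKernel, Prod.fst_swap, Prod.snd_swap, norm_sub_rev (γ p.2)]
  ring

variable [IsProbabilityMeasure ν]

lemma integrable_field_curve (hγ : Continuous γ) (h : IsRegular R A (ν.map γ)) :
    Integrable (fun x => field V (γ x)) ν := by
  obtain ⟨B, hB⟩ := (isCompact_closedBall (0 : ℂ) R).exists_bound_of_continuousOn
    (continuous_field V).continuousOn
  refine Integrable.of_bound ((continuous_field V).comp hγ).aestronglyMeasurable B ?_
  filter_upwards [ae_of_ae_map hγ.aemeasurable h.carried] with x hx
  exact hB _ (by simpa using hx)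

lemma integrable_log_curve (hγ : Continuous γ) (h : IsRegular R A (ν.map γ)) :
    Integrable (fun p : ℝ × ℝ => Real.log ‖γ p.1 - γ p.2‖) (ν.prod ν) := by
  have hm := hγ.measurable
  have h1 := h.integrable_log_prod h.toIsProbIn
  rw [Measure.map_prod_map _ _ hm hm] at h1
  exact (integrable_map_measure h1.1 (hm.prodMap hm).aemeasurable).1 h1

lemma integrable_curveKernel (hγ : Continuous γ) (h : IsRegular R A (ν.map γ)) :
    Integrable (curveKernel V γ) (ν.prod ν) := by
  have h1 := integrable_field_curve (V := V) hγ h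
  exact ((integrable_log_curve hγ h).neg.add (h1.comp_fst ν)).add (h1.comp_snd ν)

lemma ae_prod_ne (hγ : Continuous γ) (h : IsRegular R A (ν.map γ)) :
    ∀ᵐ p ∂(ν.prod ν), γ p.1 - γ p.2 ≠ 0 := by
  have hms : MeasurableSet {p : ℝ × ℝ | γ p.1 - γ p.2 ≠ 0} :=
    (isOpen_ne_fun (by fun_prop) (by fun_prop)).measurableSet
  refine (Measure.ae_prod_iff_ae_ae hms).2 (Eventually.of_forall fun x => ?_)
  exact ae_of_ae_map hγ.aemeasurable (h.ae_ne (γ x))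

/-- The energy of an absolutely continuous perturbation of the charge. -/
lemma energy_withDensity (hγ : Continuous γ) (h : IsRegular R A (ν.map γ)) {w : ℝ → ℝ}
    (hw : Measurable w) (h0 : ∀ᵐ x ∂ν, 0 ≤ w x) {B : ℝ} (hB : ∀ᵐ x ∂ν, w x ≤ B) :
    energy V ((ν.withDensity fun x => ENNReal.ofReal (w x)).map γ) =
      ((∫ p, w p.1 * w p.2 * curveKernel V γ p ∂(ν.prod ν) : ℝ) : EReal) := by
  have hm := hγ.measurable
  have hwm : Measurable fun x => ENNReal.ofReal (w x) := hw.ennreal_ofReal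
  have hmeas : (((ν.withDensity fun x => ENNReal.ofReal (w x)).map γ).prod
      ((ν.withDensity fun x => ENNReal.ofReal (w x)).map γ)) =
      ((ν.prod ν).withDensity fun p => ENNReal.ofReal (w p.1) * ENNReal.ofReal (w p.2)).map
        (Prod.map γ γ) := by
    rw [Measure.map_prod_map _ _ hm hm, prod_withDensity hwm hwm]
  have hdm : Measurable fun p : ℝ × ℝ => ENNReal.ofReal (w p.1) * ENNReal.ofReal (w p.2) :=
    (hwm.comp measurable_fst).mul (hwm.comp measurable_snd)
  have hdt : ∀ᵐ p ∂(ν.prod ν), ENNReal.ofReal (w p.1) * ENNReal.ofReal (w p.2) < ⊤ :=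
    Eventually.of_forall fun p => ENNReal.mul_lt_top ENNReal.ofReal_lt_top ENNReal.ofReal_lt_top
  set g : ℂ × ℂ → ℝ := fun p => -Real.log ‖p.1 - p.2‖ + field V p.1 + field V p.2 with hg
  have hgm : Measurable g := (IsRegular.measurable_log.neg.add
    ((continuous_field V).measurable.comp measurable_fst)).add
      ((continuous_field V).measurable.comp measurable_snd)
  have hpm : Measurable (Prod.map γ γ) := hm.prodMap hm
  have hfst : ∀ᵐ p ∂(ν.prod ν), 0 ≤ w p.1 ∧ w p.1 ≤ B :=
    (Measure.quasiMeasurePreserving_fst (μ := ν) (ν := ν)).ae (h0.and hB)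
  have hsnd : ∀ᵐ p ∂(ν.prod ν), 0 ≤ w p.2 ∧ w p.2 ≤ B :=
    (Measure.quasiMeasurePreserving_snd (μ := ν) (ν := ν)).ae (h0.and hB)
  have hval : ∀ᵐ p ∂(ν.prod ν),
      (ENNReal.ofReal (w p.1) * ENNReal.ofReal (w p.2)).toReal • g (Prod.map γ γ p) =
        w p.1 * w p.2 * curveKernel V γ p := by
    filter_upwards [hfst, hsnd] with p h1 h2
    rw [ENNReal.toReal_mul, ENNReal.toReal_ofReal h1.1, ENNReal.toReal_ofReal h2.1, smul_eq_mul]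
    rfl
  have hint : Integrable (fun p => w p.1 * w p.2 * curveKernel V γ p) (ν.prod ν) := by
    refine (integrable_curveKernel hγ h).bdd_mul (c := B * B)
      ((hw.comp measurable_fst).mul (hw.comp measurable_snd)).aestronglyMeasurable ?_
    filter_upwards [hfst, hsnd] with p h1 h2
    rw [Real.norm_of_nonneg (mul_nonneg h1.1 h2.1)]
    exact mul_le_mul h1.2 h2.2 h2.1 (h1.1.trans h1.2)
  rw [energy, hmeas, eintegral_eq_integral (g := g)]
  · rw [integral_map hpm.aemeasurable hgm.aestronglyMeasurable,
      integral_withDensity_eq_integral_toReal_smul hdm hdt, integral_congr_ae hval]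
  · rw [ae_map_iff hpm.aemeasurable]
    · have h1 : ∀ᵐ p ∂((ν.prod ν).withDensity fun p =>
          ENNReal.ofReal (w p.1) * ENNReal.ofReal (w p.2)), γ p.1 - γ p.2 ≠ 0 :=
        (withDensity_absolutelyContinuous _ _).ae_le (ae_prod_ne hγ h)
      filter_upwards [h1] with p hp
      simp only [hg, Prod.map_fst, Prod.map_snd]
      rw [logKernel_eq hp]
      norm_cast
    · have hlk : Measurable fun p : ℂ × ℂ => logKernel p.1 p.2 := by
        unfold logKernel
        exact (ENNReal.measurable_log.comp measurable_edist).neg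
      have hf := (continuous_field V).measurable
      refine measurableSet_eq_fun ?_ ?_
      · exact (hlk.add (measurable_coe_real_ereal.comp (hf.comp measurable_fst))).add
          (measurable_coe_real_ereal.comp (hf.comp measurable_snd))
      · exact measurable_coe_real_ereal.comp hgm
  · rw [integrable_map_measure hgm.aestronglyMeasurable hpm.aemeasurable,
      integrable_withDensity_iff_integrable_smul' hdm hdt]
    exact hint.congr (hval.mono fun p hp => hp.symm)

/-- Integrating out the second variable gives the total potential plus the constant `∫ field dν`,
which the mean-zero `ψ` kills. -/
lemma integral_mul_curveKernel (hγ : Continuous γ) (h : IsRegular R A (ν.map γ)) {ψ : ℝ → ℝ}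
    (hψ : Measurable ψ) {B : ℝ} (hB : ∀ᵐ x ∂ν, |ψ x| ≤ B) (hmean : ∫ x, ψ x ∂ν = 0) :
    Integrable (fun p => ψ p.1 * curveKernel V γ p) (ν.prod ν) ∧
    ∫ p, ψ p.1 * curveKernel V γ p ∂(ν.prod ν) =
      ∫ x, ψ x * (field V (γ x) - logPot (ν.map γ) (γ x)) ∂ν := by
  have hm := hγ.measurable
  have hF := integrable_field_curve (V := V) hγ h
  have hψi : Integrable ψ ν := Integrable.of_bound hψ.aestronglyMeasurable B hB
  have hfst : ∀ᵐ p ∂(ν.prod ν), |ψ p.1| ≤ B :=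
    (Measure.quasiMeasurePreserving_fst (μ := ν) (ν := ν)).ae hB
  have hint : Integrable (fun p => ψ p.1 * curveKernel V γ p) (ν.prod ν) :=
    (integrable_curveKernel hγ h).bdd_mul (c := B) (hψ.comp measurable_fst).aestronglyMeasurable hfst
  refine ⟨hint, ?_⟩
  have hlog : ∀ x, Integrable (fun y => Real.log ‖γ x - γ y‖) ν := fun x =>
    (integrable_map_measure (h.integrable_log (γ x)).1 hm.aemeasurable).1 (h.integrable_log (γ x))
  have hpot : ∀ x, ∫ y, Real.log ‖γ x - γ y‖ ∂ν = logPot (ν.map γ) (γ x) := fun x =>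
    (integral_map hm.aemeasurable (h.integrable_log (γ x)).1).symm
  have hL : Integrable (fun x => logPot (ν.map γ) (γ x)) ν :=
    (integrable_map_measure h.continuous_logPot.aestronglyMeasurable hm.aemeasurable).1
      (h.integrable_logPot h.toIsProbIn)
  rw [integral_prod _ hint]
  have h1 : ∀ x, ∫ y, ψ x * curveKernel V γ (x, y) ∂ν =
      ψ x * (field V (γ x) - logPot (ν.map γ) (γ x)) + ψ x * ∫ y, field V (γ y) ∂ν := by
    intro x
    rw [integral_const_mul]
    simp only [curveKernel]
    have e1 : Integrable (fun y => -Real.log ‖γ x - γ y‖) ν := (hlog x).neg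
    have e2 : Integrable (fun y => -Real.log ‖γ x - γ y‖ + field V (γ x)) ν :=
      e1.add (integrable_const _)
    rw [integral_add e2 hF, integral_add e1 (integrable_const _), integral_neg, hpot, integral_const,
      probReal_univ, one_smul]
    ring
  simp only [h1]
  have e3 : Integrable (fun x => ψ x * (field V (γ x) - logPot (ν.map γ) (γ x))) ν :=
    (hF.sub hL).bdd_mul (c := B) hψ.aestronglyMeasurable hB
  rw [integral_add e3 (hψi.mul_const _), integral_mul_const, hmean, zero_mul, add_zero]

/-- First variation: along a mean-zero perturbation which does not decrease the energy, the total
potential has nonnegative derivative. -/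
lemma integral_mul_total_potential_nonpos (hγ : Continuous γ) (h : IsRegular R A (ν.map γ))
    (hmin : ∀ m : Measure ℝ, IsProbabilityMeasure m →
      energy V (ν.map γ) ≤ energy V (m.map γ))
    {ψ : ℝ → ℝ} (hψ : Measurable ψ) {B : ℝ} (hB0 : 0 < B) (hB : ∀ᵐ x ∂ν, |ψ x| ≤ B)
    (hmean : ∫ x, ψ x ∂ν = 0) :
    ∫ x, ψ x * (field V (γ x) - logPot (ν.map γ) (γ x)) ∂ν ≤ 0 := by
  obtain ⟨i1, e1⟩ := integral_mul_curveKernel (V := V) hγ h hψ hB hmean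
  rw [← e1]
  set b := ∫ p, ψ p.1 * curveKernel V γ p ∂(ν.prod ν) with hb
  set a := ∫ p, curveKernel V γ p ∂(ν.prod ν) with ha
  set c := ∫ p, ψ p.1 * ψ p.2 * curveKernel V γ p ∂(ν.prod ν) with hc
  have hfst : ∀ᵐ p ∂(ν.prod ν), |ψ p.1| ≤ B :=
    (Measure.quasiMeasurePreserving_fst (μ := ν) (ν := ν)).ae hB
  have hsnd : ∀ᵐ p ∂(ν.prod ν), |ψ p.2| ≤ B :=
    (Measure.quasiMeasurePreserving_snd (μ := ν) (ν := ν)).ae hB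
  have i0 := integrable_curveKernel (V := V) hγ h
  have i2 : Integrable (fun p => ψ p.2 * curveKernel V γ p) (ν.prod ν) :=
    i0.bdd_mul (c := B) (hψ.comp measurable_snd).aestronglyMeasurable hsnd
  have i3 : Integrable (fun p => ψ p.1 * ψ p.2 * curveKernel V γ p) (ν.prod ν) := by
    simp only [mul_assoc]
    exact i2.bdd_mul (c := B) (hψ.comp measurable_fst).aestronglyMeasurable hfst
  have e2 : ∫ p, ψ p.2 * curveKernel V γ p ∂(ν.prod ν) = b := by
    rw [hb, ← integral_prod_swap]
    simp only [curveKernel_swap, Prod.snd_swap]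
  have hψi : Integrable ψ ν := Integrable.of_bound hψ.aestronglyMeasurable B hB
  -- Competitor with density `1 - tψ`, nonnegative for `t ≤ 1/B`. Its energy `a - 2tb + t²c` is at
  -- least `a`.
  have key : ∀ t : ℝ, 0 < t → t ≤ 1 / B → 2 * b ≤ t * c := by
    intro t ht htB
    have htB' : t * B ≤ 1 := by rwa [le_div_iff₀ hB0] at htB
    have hw0 : ∀ᵐ x ∂ν, 0 ≤ 1 + -t * ψ x := hB.mono fun x hx => by
      have := mul_le_mul_of_nonneg_left ((le_abs_self _).trans hx) ht.le
      linarith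
    have hw2 : ∀ᵐ x ∂ν, 1 + -t * ψ x ≤ 2 := hB.mono fun x hx => by
      have := mul_le_mul_of_nonneg_left ((neg_le_abs _).trans hx) ht.le
      linarith
    have hwm : Measurable fun x => 1 + -t * ψ x := (hψ.const_mul (-t)).const_add 1
    have hwi : Integrable (fun x => 1 + -t * ψ x) ν := (integrable_const _).add (hψi.const_mul _)
    have hprob : IsProbabilityMeasure (ν.withDensity fun x => ENNReal.ofReal (1 + -t * ψ x)) := by
      refine ⟨?_⟩
      rw [withDensity_apply _ MeasurableSet.univ, Measure.restrict_univ,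
        ← ofReal_integral_eq_lintegral_ofReal hwi hw0,
        integral_add (integrable_const _) (hψi.const_mul _), integral_const_mul, hmean]
      simp
    have h1 := hmin _ hprob
    have h2 := energy_withDensity (V := V) hγ h (w := fun _ => 1) measurable_const
      (Eventually.of_forall fun _ => zero_le_one) (Eventually.of_forall fun _ => le_rfl)
    simp only [ENNReal.ofReal_one, one_mul, withDensity_const, one_smul] at h2
    rw [h2, energy_withDensity hγ h hwm hw0 hw2, EReal.coe_le_coe_iff] at h1
    have h3 : ∫ p, (1 + -t * ψ p.1) * (1 + -t * ψ p.2) * curveKernel V γ p ∂(ν.prod ν) =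
        a + -t * b + -t * b + t ^ 2 * c := by
      have e3 : ∀ p : ℝ × ℝ, (1 + -t * ψ p.1) * (1 + -t * ψ p.2) * curveKernel V γ p =
          curveKernel V γ p + -t * (ψ p.1 * curveKernel V γ p) +
            -t * (ψ p.2 * curveKernel V γ p) + t ^ 2 * (ψ p.1 * ψ p.2 * curveKernel V γ p) :=
        fun p => by ring
      simp only [e3]
      have j1 : Integrable (fun p => curveKernel V γ p + -t * (ψ p.1 * curveKernel V γ p))
          (ν.prod ν) := i0.add (i1.const_mul (-t))
      have j2 : Integrable (fun p => curveKernel V γ p + -t * (ψ p.1 * curveKernel V γ p) +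
          -t * (ψ p.2 * curveKernel V γ p)) (ν.prod ν) := j1.add (i2.const_mul (-t))
      rw [integral_add j2 (i3.const_mul (t ^ 2)), integral_add j1 (i2.const_mul (-t)),
        integral_add i0 (i1.const_mul (-t)), integral_const_mul, integral_const_mul,
        integral_const_mul, e2]
    rw [h3] at h1
    have h4 : t * (2 * b) ≤ t * (t * c) := by nlinarith
    exact le_of_mul_le_mul_left h4 ht
  by_contra! hpos
  have hden : 0 < |c| + 1 := by positivity
  -- If `b > 0`, this admissible `t` gives `2b ≤ tc ≤ b`, a contradiction.
  set t := min (1 / B) (b / (|c| + 1)) with ht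
  have ht0 : 0 < t := lt_min (by positivity) (by positivity)
  have h5 := key t ht0 (min_le_left _ _)
  have h6 : t * c ≤ b := by
    calc t * c ≤ t * (|c| + 1) := by
          refine mul_le_mul_of_nonneg_left ?_ ht0.le
          linarith [le_abs_self c]
      _ ≤ b / (|c| + 1) * (|c| + 1) := mul_le_mul_of_nonneg_right (min_le_right _ _) hden.le
      _ = b := div_mul_cancel₀ _ hden.ne'
  linarith

/-- The total potential of a minimiser is almost everywhere constant. -/
lemma exists_ae_total_potential_eq (hγ : Continuous γ) (h : IsRegular R A (ν.map γ))
    (hmin : ∀ m : Measure ℝ, IsProbabilityMeasure m →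
      energy V (ν.map γ) ≤ energy V (m.map γ)) :
    ∃ F, ∀ᵐ x ∂ν, field V (γ x) - logPot (ν.map γ) (γ x) = F := by
  set W : ℝ → ℝ := fun x => field V (γ x) - logPot (ν.map γ) (γ x) with hW
  have hWc : Continuous W := ((continuous_field V).sub h.continuous_logPot).comp hγ
  obtain ⟨B, hB⟩ := (isCompact_closedBall (0 : ℂ) R).exists_bound_of_continuousOn
    ((continuous_field V).sub h.continuous_logPot).continuousOn
  have hBν : ∀ᵐ x ∂ν, |W x| ≤ B := by
    filter_upwards [ae_of_ae_map hγ.aemeasurable h.carried] with x hx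
    exact hB _ (by simpa using hx)
  have hWi : Integrable W ν := Integrable.of_bound hWc.aestronglyMeasurable B hBν
  set F := ∫ x, W x ∂ν with hF
  have hψB : ∀ᵐ x ∂ν, |W x - F| ≤ max 1 (B + |F|) := hBν.mono fun x hx =>
    (abs_sub _ _).trans ((by linarith : |W x| + |F| ≤ B + |F|).trans (le_max_right _ _))
  have hψi : Integrable (fun x => W x - F) ν := hWi.sub (integrable_const _)
  have hmean : ∫ x, (W x - F) ∂ν = 0 := by
    rw [integral_sub hWi (integrable_const _)]
    simp [hF]
  -- The perturbation is the centred total potential itself, so the inequality says that the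
  -- variance of `W` is at most zero.
  have h1 := integral_mul_total_potential_nonpos hγ h hmin (ψ := fun x => W x - F)
    (hWc.sub continuous_const).measurable (B := max 1 (B + |F|)) (by positivity) hψB hmean
  have h2 : ∫ x, (W x - F) * W x ∂ν = ∫ x, (W x - F) ^ 2 ∂ν := by
    have e1 : ∀ x, (W x - F) * W x = (W x - F) ^ 2 + F * (W x - F) := fun x => by ring
    have e2 : Integrable (fun x => (W x - F) ^ 2) ν := by
      simp only [sq]
      exact hψi.bdd_mul (c := max 1 (B + |F|))
        (hWc.sub continuous_const).aestronglyMeasurable hψB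
    simp only [e1]
    rw [integral_add e2 (hψi.const_mul F), integral_const_mul, hmean]
    ring
  have h3 : ∫ x, (W x - F) ^ 2 ∂ν = 0 := le_antisymm (by rw [← h2]; exact h1)
    (integral_nonneg fun x => sq_nonneg _)
  have e2 : Integrable (fun x => (W x - F) ^ 2) ν := by
    simp only [sq]
    exact hψi.bdd_mul (c := max 1 (B + |F|))
      (hWc.sub continuous_const).aestronglyMeasurable hψB
  rw [integral_eq_zero_iff_of_nonneg (fun x => sq_nonneg _) e2] at h3
  refine ⟨F, h3.mono fun x hx => ?_⟩
  have : W x - F = 0 := by simpa using hx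
  linarith

end Curve

/-! ### The effective field of an equilibrium curve -/

/-- On such a ray the leading term of `Re V` is `r^κ / κ`, which dominates every linear function as
`κ ≥ 2`. Slope `2` leaves one `r` after subtracting a logarithmic potential, bounded by `r` plus a
constant. -/
lemma exists_field_ray_ge {V : ℂ[X]} {κ : ℕ} (hκ : 2 ≤ κ) (hdeg : V.natDegree = κ)
    (hlead : V.leadingCoeff = 1 / (κ : ℂ)) (j : ℕ) :
    ∃ k : ℝ, ∀ r : ℝ, 0 ≤ r →
      2 * r - k ≤ field V (r * Complex.exp ((2 * Real.pi * j / κ : ℝ) * I)) := by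
  have hκ0 : (κ : ℂ) ≠ 0 := by exact_mod_cast (by omega : κ ≠ 0)
  have hκpos : (0 : ℝ) < κ := by exact_mod_cast (by omega : 0 < κ)
  set e := Complex.exp ((2 * Real.pi * j / κ : ℝ) * I) with he
  have heκ : e ^ κ = 1 := by
    rw [he, ← Complex.exp_nat_mul, Complex.exp_eq_one_iff]
    refine ⟨j, ?_⟩
    push_cast
    field_simp
  set p : ℝ[X] := ∑ i ∈ Finset.range κ, C ((V.coeff i * e ^ i).re) * X ^ i - C 2 * X with hp
  set q : ℝ[X] := p + C (1 / (κ : ℝ)) * X ^ κ with hq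
  have heval : ∀ r : ℝ, q.eval r = field V (r * e) - 2 * r := by
    intro r
    have h1 : V.eval ((r : ℂ) * e) =
        (∑ i ∈ Finset.range κ, (V.coeff i * e ^ i) * ((r ^ i : ℝ) : ℂ)) +
          ((1 / (κ : ℝ) * r ^ κ : ℝ) : ℂ) := by
      rw [Polynomial.eval_eq_sum_range, hdeg, Finset.sum_range_succ, ← hdeg, ← Polynomial.leadingCoeff,
        hlead, hdeg, mul_pow, heκ]
      congr 1
      · refine Finset.sum_congr rfl fun i _ => ?_
        rw [mul_pow]
        push_cast
        ring
      · push_cast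
        ring
    rw [field, h1, Complex.add_re, Complex.ofReal_re, Complex.re_sum, hq, hp]
    simp only [Complex.re_mul_ofReal, Polynomial.eval_add, Polynomial.eval_sub,
      Polynomial.eval_finsetSum, Polynomial.eval_mul, Polynomial.eval_C, Polynomial.eval_pow,
      Polynomial.eval_X]
    ring
  have hdp : p.degree < (C (1 / (κ : ℝ)) * X ^ κ : ℝ[X]).degree := by
    rw [Polynomial.degree_C_mul_X_pow κ (by positivity : (1 / (κ : ℝ)) ≠ 0)]
    refine (Polynomial.degree_sub_le _ _).trans_lt (max_lt ?_ ?_)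
    · rw [← Polynomial.mem_degreeLT]
      refine Submodule.sum_mem _ fun i hi => Polynomial.mem_degreeLT.2 ?_
      exact (Polynomial.degree_C_mul_X_pow_le i _).trans_lt
        (by exact_mod_cast Finset.mem_range.1 hi)
    · refine (Polynomial.degree_C_mul_X_le _).trans_lt ?_
      exact_mod_cast (by omega : 1 < κ)
  have hqdeg : q.degree = κ := by
    rw [hq, Polynomial.degree_add_eq_right_of_degree_lt hdp,
      Polynomial.degree_C_mul_X_pow κ (by positivity : (1 / (κ : ℝ)) ≠ 0)]
  have hqlead : q.leadingCoeff = 1 / (κ : ℝ) := by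
    rw [hq, Polynomial.leadingCoeff_add_of_degree_lt hdp, Polynomial.leadingCoeff_C_mul_X_pow]
  have hlim : Tendsto (fun r : ℝ => q.eval r) atTop atTop :=
    q.tendsto_atTop_of_leadingCoeff_nonneg (by rw [hqdeg]; exact_mod_cast (by omega : 0 < κ))
      (by rw [hqlead]; positivity)
  obtain ⟨r₀, hr₀⟩ := (hlim.eventually_ge_atTop 0).exists_forall_of_atTop
  obtain ⟨B, hB⟩ := (isCompact_Icc (a := (0 : ℝ)) (b := r₀)).exists_bound_of_continuousOn
    q.continuous.continuousOn
  refine ⟨max B 0, fun r hr => ?_⟩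
  have h1 : -max B 0 ≤ q.eval r := by
    rcases le_total r r₀ with h | h
    · have := hB r ⟨hr, h⟩
      rw [Real.norm_eq_abs, abs_le] at this
      linarith [le_max_left B 0]
    · linarith [hr₀ r h, le_max_right B 0]
  rw [heval] at h1
  linarith

/-- On a ray the length is the variation of the distance to the origin. -/
lemma lintegral_ray_lt_top {γ : ℝ → ℂ} (hγ : ContDiff ℝ ∞ γ) (hinj : Function.Injective γ)
    {S : Set ℝ} (hS : IsOpen S) {θ : ℝ} (hray : ∀ x ∈ S, γ x = ‖γ x‖ * Complex.exp (θ * I))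
    {c : ℝ} (hc : 0 < c) :
    ∫⁻ x in S, ENNReal.ofReal (‖deriv γ x‖ * Real.exp (-(c * ‖γ x‖))) < ⊤ := by
  set e := Complex.exp (θ * I) with he
  have hnorm : ‖e‖ = 1 := Complex.norm_exp_ofReal_mul_I θ
  set f : ℝ → ℝ := fun x => (γ x * (starRingEnd ℂ) e).re with hf
  have hee : e * (starRingEnd ℂ) e = 1 := by
    rw [Complex.mul_conj, Complex.normSq_eq_norm_sq, hnorm]
    norm_num
  have hfx : ∀ x ∈ S, f x = ‖γ x‖ := fun x hx => by
    simp only [hf]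
    conv_lhs => rw [hray x hx]
    rw [mul_assoc, hee, mul_one, Complex.ofReal_re]
  have hd : ∀ x, HasDerivAt γ (deriv γ x) x := fun x =>
    (hγ.differentiable (by simp) x).hasDerivAt
  have hfd : ∀ x, HasDerivAt f ((deriv γ x * (starRingEnd ℂ) e).re) x := fun x => by
    have h1 := (hd x).mul_const ((starRingEnd ℂ) e)
    exact (Complex.reCLM.hasFDerivAt.comp_hasDerivAt x h1)
  have hderiv : ∀ x ∈ S, ‖deriv γ x‖ = |(deriv γ x * (starRingEnd ℂ) e).re| := fun x hx => by
    have h1 : HasDerivAt (fun y : ℝ => (f y : ℂ) * e)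
        (((deriv γ x * (starRingEnd ℂ) e).re : ℂ) * e) x := (hfd x).ofReal_comp.mul_const e
    have h2 : γ =ᶠ[𝓝 x] fun y : ℝ => (f y : ℂ) * e := by
      filter_upwards [hS.mem_nhds hx] with y hy
      rw [hfx y hy]
      exact hray y hy
    rw [(h1.congr_of_eventuallyEq h2).deriv, norm_mul, hnorm, mul_one, Complex.norm_real,
      Real.norm_eq_abs]
    congr 1
    rw [mul_assoc, hee, mul_one, Complex.ofReal_re]
  have hfinj : Set.InjOn f S := fun x hx y hy hxy => by
    apply hinj
    rw [hray x hx, hray y hy, ← hfx x hx, ← hfx y hy, hxy]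
  have h1 := lintegral_image_eq_lintegral_abs_deriv_mul hS.measurableSet
    (fun x _ => (hfd x).hasDerivWithinAt) hfinj fun y => ENNReal.ofReal (Real.exp (-(c * y)))
  have h2 : ∫⁻ x in S, ENNReal.ofReal (‖deriv γ x‖ * Real.exp (-(c * ‖γ x‖))) =
      ∫⁻ y in f '' S, ENNReal.ofReal (Real.exp (-(c * y))) := by
    rw [h1]
    refine setLIntegral_congr_fun hS.measurableSet fun x hx => ?_
    rw [ENNReal.ofReal_mul (norm_nonneg _), hderiv x hx, hfx x hx]
  rw [h2]
  have h3 : f '' S ⊆ Set.Ici 0 := by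
    rintro _ ⟨x, hx, rfl⟩
    rw [hfx x hx]
    exact norm_nonneg _
  refine (lintegral_mono_set h3).trans_lt ?_
  have h4 : IntegrableOn (fun y : ℝ => Real.exp (-(c * y))) (Set.Ici 0) := by
    rw [integrableOn_Ici_iff_integrableOn_Ioi]
    simpa only [neg_mul] using integrableOn_exp_mul_Ioi (neg_lt_zero.2 hc) 0
  have h5 := h4.lintegral_lt_top
  exact h5

/-! ### Coercivity and integrability along the unbounded ends of the curve. -/

section Nice

variable {V : ℂ[X]} {κ α α' : ℕ} {γ : ℝ → ℂ} {W : ℝ → ℝ}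

lemma exists_norm_le_add {L : ℂ → ℝ} {b : ℝ} (hκ : 2 ≤ κ) (hdeg : V.natDegree = κ)
    (hlead : V.leadingCoeff = 1 / (κ : ℂ)) (hγ : IsNiceCurve κ α α' γ) (hL : Continuous L)
    (hLb : ∀ z, L z ≤ ‖z‖ + b) : ∃ k : ℝ, ∀ x, ‖γ x‖ ≤ field V (γ x) - L (γ x) + k := by
  obtain ⟨K, hK, hleft, hright⟩ := hγ.direction
  obtain ⟨k₁, hk₁⟩ := exists_field_ray_ge hκ hdeg hlead α
  obtain ⟨k₂, hk₂⟩ := exists_field_ray_ge hκ hdeg hlead α'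
  have hc : Continuous fun x => ‖γ x‖ - (field V (γ x) - L (γ x)) := by
    have h1 := hγ.smooth.continuous
    have h2 := continuous_field V
    fun_prop
  obtain ⟨B, hB⟩ := (isCompact_Icc (a := -K) (b := K)).exists_bound_of_continuousOn hc.continuousOn
  refine ⟨max B (max (k₁ + b) (k₂ + b)), fun x => ?_⟩
  have m1 := le_max_left B (max (k₁ + b) (k₂ + b))
  have m2 := (le_max_left (k₁ + b) (k₂ + b)).trans (le_max_right B _)
  have m3 := (le_max_right (k₁ + b) (k₂ + b)).trans (le_max_right B _)
  have h0 := hLb (γ x)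
  rcases le_total x (-K) with h | h
  · have h1 := hk₁ ‖γ x‖ (norm_nonneg _)
    rw [← hleft x h] at h1
    linarith
  rcases le_total x K with h' | h'
  · have h1 := hB x ⟨h, h'⟩
    rw [Real.norm_eq_abs, abs_le] at h1
    linarith [h1.2]
  · have h1 := hk₂ ‖γ x‖ (norm_nonneg _)
    rw [← hright x h'] at h1
    linarith

/-- Growth reduces the ends to exponentials in the distance along rays; the parameter speed is
arbitrary there, so arc length is essential. The middle part is compact. -/
lemma lintegral_exp_lt_top {E : ℝ → ℝ} (hγ : IsNiceCurve κ α α' γ) (hE : Continuous E) {k : ℝ}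
    (hk : ∀ x, ‖γ x‖ ≤ E x + k) {c : ℝ} (hc : 0 < c) :
    ∫⁻ x, ENNReal.ofReal (‖deriv γ x‖ * Real.exp (-(c * E x))) < ⊤ := by
  obtain ⟨K, hK, hleft, hright⟩ := hγ.direction
  have hle : ∀ S : Set ℝ, ∫⁻ x in S, ENNReal.ofReal (‖deriv γ x‖ * Real.exp (-(c * E x))) ≤
      ENNReal.ofReal (Real.exp (c * k)) *
        ∫⁻ x in S, ENNReal.ofReal (‖deriv γ x‖ * Real.exp (-(c * ‖γ x‖))) := by
    intro S
    rw [← lintegral_const_mul' _ _ ENNReal.ofReal_ne_top]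
    refine lintegral_mono fun x => ?_
    rw [← ENNReal.ofReal_mul (Real.exp_pos _).le]
    refine ENNReal.ofReal_le_ofReal ?_
    have h1 : Real.exp (-(c * E x)) ≤ Real.exp (c * k) * Real.exp (-(c * ‖γ x‖)) := by
      rw [← Real.exp_add, Real.exp_le_exp]
      have := mul_le_mul_of_nonneg_left (hk x) hc.le
      linarith
    have := mul_le_mul_of_nonneg_left h1 (norm_nonneg (deriv γ x))
    linarith
  have hcover : (Set.univ : Set ℝ) ⊆ Set.Iio (-K) ∪ (Set.Icc (-K) K ∪ Set.Ioi K) := by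
    intro x _
    simp only [Set.mem_union, Set.mem_Iio, Set.mem_Icc, Set.mem_Ioi]
    by_contra! h
    exact absurd (h.2.1 h.1) (not_lt.2 h.2.2)
  have hmid : ∫⁻ x in Set.Icc (-K) K, ENNReal.ofReal (‖deriv γ x‖ * Real.exp (-(c * E x))) < ⊤ := by
    have hcont : Continuous fun x => ‖deriv γ x‖ * Real.exp (-(c * E x)) := by
      have := hγ.smooth.continuous_deriv (by simp)
      fun_prop
    exact (hcont.continuousOn.integrableOn_compact isCompact_Icc).lintegral_lt_top
  rw [← setLIntegral_univ]
  refine (lintegral_mono_set hcover).trans_lt ((lintegral_union_le _ _ _).trans_lt ?_)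
  refine ENNReal.add_lt_top.2 ⟨(hle _).trans_lt (ENNReal.mul_lt_top ENNReal.ofReal_lt_top ?_),
    (lintegral_union_le _ _ _).trans_lt (ENNReal.add_lt_top.2 ⟨hmid,
      (hle _).trans_lt (ENNReal.mul_lt_top ENNReal.ofReal_lt_top ?_)⟩)⟩
  · exact lintegral_ray_lt_top hγ.smooth hγ.injective isOpen_Iio
      (fun x hx => hleft x (le_of_lt hx)) hc
  · exact lintegral_ray_lt_top hγ.smooth hγ.injective isOpen_Ioi
      (fun x hx => hright x (le_of_lt hx)) hc

end Nice

lemma IsCutChart.isCharge {γ : ℝ → ℂ} {G : ℂ → ℂ} {r c M : ℝ} (h : IsCutChart γ G r c M)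
    (hc : Continuous (deriv γ)) (hne : ∀ s ∈ Set.Icc (0 : ℝ) 1, deriv γ s ≠ 0) :
    IsCharge γ 0 1 semicircle := by
  refine ⟨inferInstance, ?_, ?_⟩
  · refine isRegular_map h.continuous_curve h.const_pos (fun x hx y hy => ?_) semicircle_le
    have h1 := (h.bounds x (ofReal_mem_cutClosedBox h.pos hx) y (ofReal_mem_cutClosedBox h.pos hy)).1
    rw [← h.eq x hx, ← h.eq y hy, ← Complex.ofReal_sub, Complex.norm_real, Real.norm_eq_abs] at h1
    exact h1
  · obtain ⟨s, hs, hmin⟩ := (isCompact_Icc (a := (0 : ℝ)) (b := 1)).exists_isMinOn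
      ⟨0, by simp⟩ hc.norm.continuousOn
    have hm : 0 < ‖deriv γ s‖ := norm_pos_iff.2 (hne s hs)
    have hpi := Real.pi_pos
    -- The density is at most `4/π` as `√(t(1-t)) ≤ 1/2`, and the speed of the curve on `[0, 1]` is
    -- at least its minimum, attained at `s`.
    refine ⟨fun t => 8 / Real.pi * Real.sqrt (t * (1 - t)), ‖deriv γ s‖ * (Real.pi / 4),
      by fun_prop, by positivity, fun t => by positivity, semicircle_eq, fun t ht => ?_, fun t => ?_⟩
    · simp only [sqrt_mul_one_sub_eq_zero ht, mul_zero]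
    · by_cases ht : t ∈ Set.Icc (0 : ℝ) 1
      · have h1 : ‖deriv γ s‖ ≤ ‖deriv γ t‖ := hmin ht
        have h2 := sqrt_mul_one_sub_le t
        calc ‖deriv γ s‖ * (Real.pi / 4) * (8 / Real.pi * Real.sqrt (t * (1 - t)))
            = ‖deriv γ s‖ * (2 * Real.sqrt (t * (1 - t))) := by
              field_simp
              ring
          _ ≤ ‖deriv γ s‖ * 1 := mul_le_mul_of_nonneg_left (by linarith) hm.le
          _ ≤ ‖deriv γ t‖ := by rw [mul_one]; exact h1
      · simp only [sqrt_mul_one_sub_eq_zero ht, mul_zero]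
        exact norm_nonneg _

/-- The density is positive on `(0, 1)`, so the exceptional open set is empty there; continuity adds
the endpoints. -/
lemma eq_on_Icc_of_ae_semicircle {W : ℝ → ℝ} (hW : Continuous W) {F : ℝ}
    (h : ∀ᵐ x ∂semicircle, W x = F) : ∀ x ∈ Set.Icc (0 : ℝ) 1, W x = F := by
  rw [semicircle_eq, ae_withDensity_iff (by fun_prop)] at h
  have h1 : Set.EqOn W (fun _ => F) (Set.Ioo 0 1) := by
    intro x hx
    by_contra hne
    have hop : IsOpen ({y | W y ≠ F} ∩ Set.Ioo (0 : ℝ) 1) :=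
      (isOpen_ne_fun hW continuous_const).inter isOpen_Ioo
    obtain ⟨y, hy, hy'⟩ := (Measure.dense_of_ae h).inter_open_nonempty _ hop ⟨x, hne, hx⟩
    refine hy.1 (hy' ?_)
    have hpi := Real.pi_pos
    have h2 : 0 < y * (1 - y) := mul_pos hy.2.1 (by linarith [hy.2.2])
    have h3 := Real.sqrt_pos.2 h2
    have : 0 < 8 / Real.pi * Real.sqrt (y * (1 - y)) := by positivity
    simpa using this
  have h2 := h1.closure hW continuous_const
  rw [closure_Ioo zero_ne_one] at h2
  exact h2

/-- The effective field of an equilibrium curve. -/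
theorem exists_isEffectiveField {κ α α' : ℕ} (hκ : 2 ≤ κ) {V : ℂ[X]} (hdeg : V.natDegree = κ)
    (hlead : V.leadingCoeff = 1 / (κ : ℂ)) {μ : Measure ℂ} {γ : ℝ → ℂ}
    (hreg : IsOneCutRegular V κ α α' μ) (hγ : IsEquilibriumCurve V κ α α' μ γ) :
    ∃ (E : ℝ → ℝ) (C₀ : ℝ), IsEffectiveField V γ semicircle E C₀ ∧
      (∀ x ∉ Set.Icc (0 : ℝ) 1, 0 < E x) ∧
      ∀ x, pulledBackPotential V μ γ x = ((E x : ℝ) : EReal) := by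
  obtain ⟨-, -, -, -, S, hS, -⟩ := hreg
  have hprob := hγ.equilibrium.isProbabilityMeasure
  have hsm := hγ.nice.smooth
  have hcd : Continuous (deriv γ) := hsm.continuous_deriv (by simp)
  obtain ⟨G, r, c, M, hchart, halg, hne⟩ := exists_isCutChart hsm hγ.nice.injective hS hγ.analytic
  have hμ : μ = semicircle.map γ := eq_map_semicircle hchart hγ.nice.injective
    hγ.equilibrium.carried hγ.analytic.1 hS halg
  have hch := hchart.isCharge hcd hne
  obtain ⟨R, A, hR⟩ := hch.regular
  set W : ℝ → ℝ := fun x => field V (γ x) - logPot (semicircle.map γ) (γ x) with hW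
  have hWc : Continuous W := ((continuous_field V).sub hR.continuous_logPot).comp hsm.continuous
  have hmin : ∀ m : Measure ℝ, IsProbabilityMeasure m →
      energy V (semicircle.map γ) ≤ energy V (m.map γ) := by
    intro m hm
    rw [← hμ, hγ.equilibrium.energy_eq]
    have hmp : IsProbabilityMeasure (m.map γ) :=
      Measure.isProbabilityMeasure_map hsm.continuous.aemeasurable
    have hcar : (m.map γ) (Set.range γ)ᶜ = 0 := by
      have hemb := hsm.continuous.measurableEmbedding hγ.nice.injective
      rw [Measure.map_apply hsm.continuous.measurable hemb.measurableSet_range.compl]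
      simp
    exact iInf_le_of_le (m.map γ) (iInf_le_of_le hmp (iInf_le _ hcar))
  obtain ⟨F, hF⟩ := exists_ae_total_potential_eq hsm.continuous hR hmin
  have hWF := eq_on_Icc_of_ae_semicircle hWc hF
  obtain ⟨k, hk⟩ := exists_norm_le_add hκ hdeg hlead hγ.nice hR.continuous_logPot
    (b := R + 2 * A) (fun z => by linarith [hR.logPot_le z])
  have hk' : ∀ x, ‖γ x‖ ≤ W x + k := hk
  have hWlim : Tendsto W (cocompact ℝ) atTop := by
    rw [cocompact_eq_atBot_atTop]
    refine Tendsto.sup ?_ ?_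
    · exact tendsto_atTop_mono (fun x => (by linarith [hk' x] : ‖γ x‖ + -k ≤ W x))
        (tendsto_atTop_add_const_right _ _ hγ.nice.tendsto_atBot)
    · exact tendsto_atTop_mono (fun x => (by linarith [hk' x] : ‖γ x‖ + -k ≤ W x))
        (tendsto_atTop_add_const_right _ _ hγ.nice.tendsto_atTop)
  obtain ⟨x₀, hx₀⟩ := hWc.exists_forall_le hWlim
  have hpot : ∀ x, (field V (γ x) : EReal) + potential μ (γ x) = ((W x : ℝ) : EReal) := fun x => by
    rw [hμ, potential_eq hR, ← EReal.coe_add, hW]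
    simp only [sub_eq_add_neg]
  -- Coercivity makes the infimum a minimum, so the constant is finite and subtracting it in the
  -- extended reals is harmless.
  have hC : equilibriumConstant V (Set.range γ) μ = ((W x₀ : ℝ) : EReal) := by
    rw [equilibriumConstant, iInf_range]
    simp only [hpot]
    exact le_antisymm (iInf_le _ x₀) (le_iInf fun x => EReal.coe_le_coe_iff.2 (hx₀ x))
  have hpos : ∀ x ∉ Set.Icc (0 : ℝ) 1, W x₀ < W x := by
    intro x hx
    have hns : γ x ∉ μ.support := by
      rw [← hγ.analytic.1]
      rintro ⟨y, hy, hyx⟩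
      exact hx (hγ.nice.injective hyx ▸ hy)
    have h1 := hγ.effective_pos (γ x) ⟨⟨x, rfl⟩, hns⟩
    rw [effectivePotential, hpot, hC, ← EReal.coe_sub, ← EReal.coe_zero, EReal.coe_lt_coe_iff] at h1
    linarith
  -- The effective potential vanishes at the minimiser and is positive off the support. Hence the
  -- Euler–Lagrange constant `F` equals the minimum of `W`.
  have hx₀mem : x₀ ∈ Set.Icc (0 : ℝ) 1 := by
    by_contra hx
    exact lt_irrefl _ (hpos x₀ hx)
  have hF₀ : W x₀ = F := hWF x₀ hx₀mem
  refine ⟨fun x => W x - F, F, ⟨hsm.continuous, hcd, hch, fun x => ?_, fun x => ?_, fun x hx => ?_,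
    ⟨k + F, fun x => ?_⟩, fun c hc => ?_⟩, fun x hx => ?_, fun x => ?_⟩
  · simp only [hW]
    ring
  · rw [← hF₀]
    exact sub_nonneg.2 (hx₀ x)
  · exact sub_eq_zero.2 (hWF x hx)
  · linarith [hk' x]
  · exact lintegral_exp_lt_top (E := fun x => W x - F) hγ.nice (hWc.sub continuous_const) (k := k + F)
      (fun x => by linarith [hk' x]) hc
  · rw [← hF₀]
    exact sub_pos.2 (hpos x hx)
  · rw [pulledBackPotential, eintegral_logKernel_curve hsm.continuous hR, hC, ← EReal.coe_add,
      ← EReal.coe_sub, hF₀]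
    simp only [hW, sub_eq_add_neg]

/-! ### The large deviation estimates -/

/-- A smooth curve carries charges near each of its regular points. -/
lemma exists_isCharge {γ : ℝ → ℂ} (hγ : ContDiff ℝ ∞ γ) {x₀ : ℝ} (hx₀ : deriv γ x₀ ≠ 0)
    {O : Set ℝ} (hO : IsOpen O) (hxO : x₀ ∈ O) :
    ∃ a b ρ, Set.Icc a b ⊆ O ∧ IsCharge γ a b ρ := by
  set m := ‖deriv γ x₀‖ with hm
  have hm0 : 0 < m := norm_pos_iff.2 hx₀
  -- Strict differentiability controls pairs of points near `x₀`, giving `|γ x - γ y| ≥ (m/2) |x -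
  -- y|`, the hypothesis of `isRegular_map`.
  have hstrict : HasStrictDerivAt γ (deriv γ x₀) x₀ :=
    hγ.contDiffAt.hasStrictDerivAt (by simp)
  have h1 := hstrict.hasStrictFDerivAt.isLittleO.def (half_pos hm0)
  rw [nhds_prod_eq] at h1
  have hcd : Continuous (deriv γ) := hγ.continuous_deriv (by simp)
  have h2 : ∀ᶠ x in 𝓝 x₀, m / 2 < ‖deriv γ x‖ :=
    (hcd.norm.tendsto x₀).eventually (lt_mem_nhds (half_lt_self hm0))
  obtain ⟨t, ht, hlip⟩ := (eventually_prod_self_iff (r := fun x y : ℝ => ‖γ x - γ y -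
    (ContinuousLinearMap.toSpanSingleton ℝ (deriv γ x₀)) (x - y)‖ ≤ m / 2 * ‖x - y‖)).1 h1
  obtain ⟨δ', hδ', hball⟩ := Metric.eventually_nhds_iff_ball.1
    ((eventually_mem_set.2 ht).and (h2.and (hO.mem_nhds hxO)))
  set δ := δ' / 2 with hδ
  have hδ0 : 0 < δ := half_pos hδ'
  have hI : ∀ x ∈ Set.Icc (x₀ - δ) (x₀ + δ), x ∈ t ∧ m / 2 < ‖deriv γ x‖ ∧ x ∈ O := by
    intro x hx
    refine hball x ?_
    rw [Metric.mem_ball, Real.dist_eq, abs_lt]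
    constructor <;> linarith [hx.1, hx.2]
  set g : ℝ → ℝ := (Set.Icc (x₀ - δ) (x₀ + δ)).indicator fun _ => 1 / (2 * δ) with hg
  -- Uniform law on a small interval; the constant `m δ` scales its density to `m/2`, below the
  -- speed there.
  set ρ : Measure ℝ := ENNReal.ofReal (1 / (2 * δ)) • volume.restrict (Set.Icc (x₀ - δ) (x₀ + δ))
    with hρ
  have hprob : IsProbabilityMeasure ρ := by
    refine ⟨?_⟩
    rw [hρ, Measure.smul_apply, Measure.restrict_apply_univ, Real.volume_Icc, smul_eq_mul,
      ← ENNReal.ofReal_mul (by positivity)]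
    rw [show 1 / (2 * δ) * (x₀ + δ - (x₀ - δ)) = 1 by field_simp; ring, ENNReal.ofReal_one]
  have hg0 : ∀ x, 0 ≤ g x := Set.indicator_nonneg fun _ _ => by positivity
  refine ⟨x₀ - δ, x₀ + δ, ρ, fun x hx => (hI x hx).2.2, hprob, ?_, g, m * δ, ?_, by positivity, hg0,
    ?_, fun x hx => Set.indicator_of_notMem hx _, fun x => ?_⟩
  · refine isRegular_map hγ.continuous (half_pos hm0) (fun x hx y hy => ?_) le_rfl
    have h3 := hlip x (hI x hx).1 y (hI y hy).1
    simp only [ContinuousLinearMap.toSpanSingleton_apply, Real.norm_eq_abs] at h3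
    have h4 : ‖(x - y) • deriv γ x₀‖ = m * |x - y| := by
      rw [norm_smul, Real.norm_eq_abs, mul_comm]
    have h5 : ‖(x - y) • deriv γ x₀‖ ≤ ‖γ x - γ y‖ + ‖γ x - γ y - (x - y) • deriv γ x₀‖ := by
      have : (x - y) • deriv γ x₀ = (γ x - γ y) - (γ x - γ y - (x - y) • deriv γ x₀) := by abel
      conv_lhs => rw [this]
      exact norm_sub_le _ _
    linarith
  · exact measurable_const.indicator measurableSet_Icc
  · rw [hρ, ← withDensity_const, ← withDensity_indicator measurableSet_Icc]
    congr 1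
    ext x
    by_cases hx : x ∈ Set.Icc (x₀ - δ) (x₀ + δ)
    · simp only [hg, Set.indicator_of_mem hx]
    · simp only [hg, Set.indicator_of_notMem hx, ENNReal.ofReal_zero]
  · by_cases hx : x ∈ Set.Icc (x₀ - δ) (x₀ + δ)
    · simp only [hg, Set.indicator_of_mem hx]
      have := (hI x hx).2.1
      rw [show m * δ * (1 / (2 * δ)) = m / 2 by field_simp]
      exact this.le
    · simp only [hg, Set.indicator_of_notMem hx, mul_zero]
      exact norm_nonneg _

/-- The regular points of an injective smooth curve are dense. -/
lemma exists_deriv_ne_zero {γ : ℝ → ℂ} (hγ : ContDiff ℝ ∞ γ) (hinj : Function.Injective γ)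
    {O : Set ℝ} (hO : IsOpen O) {x : ℝ} (hx : x ∈ O) : ∃ y ∈ O, deriv γ y ≠ 0 := by
  by_contra! h0
  obtain ⟨δ, hδ, hball⟩ := Metric.isOpen_iff.1 hO x hx
  have h1 := (convex_ball x δ).is_const_of_fderivWithin_eq_zero (𝕜 := ℝ) (f := γ)
    ((hγ.differentiable (by simp)).differentiableOn) (fun y hy => by
      rw [fderivWithin_of_isOpen Metric.isOpen_ball hy]
      ext
      simp [h0 y (hball hy)]) (Metric.mem_ball_self hδ)
    (show x + δ / 2 ∈ Metric.ball x δ by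
      rw [Metric.mem_ball, Real.dist_eq, add_sub_cancel_left, abs_of_pos (half_pos hδ)]
      exact half_lt_self hδ)
  have := hinj h1
  linarith

section

variable {V : ℂ[X]} {γ : ℝ → ℂ} {ν : Measure ℝ} {E : ℝ → ℝ} {C₀ : ℝ}

namespace IsEffectiveField

lemma partitionFunction_univ_eq (V : ℂ[X]) (β : ℕ) (γ : ℝ → ℂ) (N : ℕ) :
    partitionFunction V β γ Set.univ N = ∫⁻ x : Fin N → ℝ, ENNReal.ofReal (weight V β γ N x) := by
  simp [partitionFunction]

lemma isProbabilityMeasure_realModel (h : IsEffectiveField V γ ν E C₀) {β : ℕ} (hβ : 0 < β)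
    (N : ℕ) : IsProbabilityMeasure (realModel V β γ N) := by
  refine ⟨?_⟩
  rw [realModel_apply V β γ N MeasurableSet.univ, Measure.restrict_univ]
  exact ENNReal.inv_mul_cancel (h.lintegral_weight_pos β N).ne'
    (h.lintegral_weight_lt_top hβ N).ne

/-- The infimum is `+∞` when `F` is empty, so the bound is tested against real rates `τ` below `β`
times a real `e` that lies below the infimum. -/
lemma limsup_realModel_le (h : IsEffectiveField V γ ν E C₀) {β : ℕ} (hβ : 0 < β) {F : Set ℝ}
    (hF : MeasurableSet F) :
    limsup (fun N : ℕ => ((1 / N : ℝ) : EReal) *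
        ENNReal.log (realModel V β γ N {x | ∃ i, x i ∈ F})) atTop
      ≤ -((β : EReal) * ⨅ x ∈ F, ((E x : ℝ) : EReal)) := by
  have hβ' : (0 : EReal) < (β : EReal) := by exact_mod_cast hβ
  have hβt : (β : EReal) ≠ ⊤ := EReal.natCast_ne_top β
  rw [EReal.le_neg]
  by_contra! hlt
  obtain ⟨τ, hτ1, hτ2⟩ := EReal.lt_iff_exists_real_btwn.1 hlt
  rw [mul_comm, ← EReal.div_lt_iff hβ' hβt] at hτ2
  obtain ⟨e, he1, he2⟩ := EReal.lt_iff_exists_real_btwn.1 hτ2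
  rw [EReal.div_lt_iff hβ' hβt] at he1
  have hτe : τ < β * e := by
    rw [mul_comm]
    exact_mod_cast he1
  have hFe : ∀ t ∈ F, e ≤ E t := fun t ht => by
    have h1 : (⨅ x ∈ F, ((E x : ℝ) : EReal)) ≤ ((E t : ℝ) : EReal) := iInf₂_le t ht
    exact (EReal.coe_lt_coe_iff.1 (he2.trans_le h1)).le
  refine absurd ?_ (not_le.2 hτ1)
  rw [EReal.le_neg]
  refine limsup_le_of_le (h := ?_)
  filter_upwards [h.eventually_realModel_le hβ hF hFe hτe, eventually_gt_atTop 0] with N hN hN0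
  have hN' : (0 : ℝ) < N := by exact_mod_cast hN0
  have h1 := ENNReal.log_monotone hN
  rw [ENNReal.log_ofReal_of_pos (Real.exp_pos _), Real.log_exp] at h1
  have h2 : ((1 / N : ℝ) : EReal) * ENNReal.log (realModel V β γ N {x | ∃ i, x i ∈ F}) ≤
      ((1 / N : ℝ) : EReal) * ((-(τ * N) : ℝ) : EReal) :=
    mul_le_mul_of_nonneg_left h1 (EReal.coe_nonneg.2 (by positivity))
  refine h2.trans_eq ?_
  rw [← EReal.coe_mul, ← EReal.coe_neg]
  congr 1
  field_simp

/-- Near an almost minimiser of `E` the set `U ∩ {E < e}` is open, so it contains a regular point of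
the curve and carries a charge of mean field at most `e`. -/
lemma le_liminf_realModel (h : IsEffectiveField V γ ν E C₀) (hγ : ContDiff ℝ ∞ γ)
    (hinj : Function.Injective γ) {β : ℕ} (hβ : 0 < β) {U : Set ℝ} (hU : IsOpen U) :
    -((β : EReal) * ⨅ x ∈ U, ((E x : ℝ) : EReal)) ≤
      liminf (fun N : ℕ => ((1 / N : ℝ) : EReal) *
        ENNReal.log (realModel V β γ N {x | ∃ i, x i ∈ U})) atTop := by
  have hβ' : (0 : EReal) < (β : EReal) := by exact_mod_cast hβ
  have hβt : (β : EReal) ≠ ⊤ := EReal.natCast_ne_top β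
  rw [EReal.neg_le]
  by_contra! hlt
  obtain ⟨τ, hτ1, hτ2⟩ := EReal.lt_iff_exists_real_btwn.1 hlt
  refine absurd ?_ (not_le.2 hτ2)
  rw [EReal.neg_le]
  rw [mul_comm, ← EReal.lt_div_iff hβ' hβt] at hτ1
  obtain ⟨x, hx⟩ := iInf_lt_iff.1 hτ1
  obtain ⟨hxU, hxτ⟩ := iInf_lt_iff.1 hx
  obtain ⟨e, he1, he2⟩ := EReal.lt_iff_exists_real_btwn.1 hxτ
  rw [EReal.lt_div_iff hβ' hβt] at he2
  have hτe : β * e < τ := by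
    rw [mul_comm]
    exact_mod_cast he2
  have hO : IsOpen (U ∩ {y | E y < e}) := hU.inter (isOpen_lt h.continuous continuous_const)
  obtain ⟨y, hy, hyd⟩ := exists_deriv_ne_zero hγ hinj hO ⟨hxU, EReal.coe_lt_coe_iff.1 he1⟩
  obtain ⟨a, b, ρ, hsub, hρ⟩ := exists_isCharge hγ hyd hO hy
  have hρp := hρ.isProbabilityMeasure
  have hEρ : ∫ t, E t ∂ρ ≤ e := by
    have h1 : ∫ t, E t ∂ρ ≤ ∫ _, e ∂ρ :=
      integral_mono_ae (hρ.integrable_continuous h.continuous) (integrable_const _)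
        (hρ.ae_mem.mono fun t ht => (hsub ht).2.le)
    simpa using h1
  have hτE : β * ∫ t, E t ∂ρ < τ :=
    (mul_le_mul_of_nonneg_left hEρ (Nat.cast_nonneg β)).trans_lt hτe
  refine le_liminf_of_le (h := ?_)
  filter_upwards [h.eventually_le_realModel hβ hρ hU.measurableSet
    (hsub.trans Set.inter_subset_left) hτE, eventually_gt_atTop 0] with N hN hN0
  have hN' : (0 : ℝ) < N := by exact_mod_cast hN0
  have h1 := ENNReal.log_monotone hN
  rw [ENNReal.log_ofReal_of_pos (Real.exp_pos _), Real.log_exp] at h1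
  have h2 : ((1 / N : ℝ) : EReal) * ((-(τ * N) : ℝ) : EReal) ≤
      ((1 / N : ℝ) : EReal) * ENNReal.log (realModel V β γ N {x | ∃ i, x i ∈ U}) :=
    mul_le_mul_of_nonneg_left h1 (EReal.coe_nonneg.2 (by positivity))
  refine le_trans (le_of_eq ?_) h2
  rw [← EReal.coe_mul, ← EReal.coe_neg]
  congr 1
  field_simp

/-- Restricting the model to a set off which the effective field is bounded below by a positive
constant changes the partition function by an exponentially small factor. -/
lemma exists_partitionFunction_eq (h : IsEffectiveField V γ ν E C₀) {β : ℕ} (hβ : 0 < β)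
    {J : Set ℝ} (hJ : MeasurableSet J) {e : ℝ} (he : 0 < e) (hJe : ∀ t ∉ J, e ≤ E t) :
    ∃ C > (0 : ℝ), ∃ r : ℕ → ℝ, r =O[atTop] (fun N : ℕ => Real.exp (-(C * N))) ∧
      ∀ N : ℕ, (partitionFunction V β γ J N).toReal =
        (partitionFunction V β γ Set.univ N).toReal * (1 + r N) := by
  have hβ' : (0 : ℝ) < β := Nat.cast_pos.2 hβ
  -- The ratio of partition functions is the probability that no particle leaves `J`. The rate is
  -- halved because the upper bound needs one strictly below `β e`.
  refine ⟨β * e / 2, by positivity,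
    fun N => -(realModel V β γ N {x | ∃ i, x i ∈ Jᶜ}).toReal, ?_, fun N => ?_⟩
  · refine Asymptotics.IsBigO.of_bound 1 ?_
    have h1 : β * e / 2 < β * e := half_lt_self (by positivity)
    filter_upwards [h.eventually_realModel_le hβ hJ.compl hJe h1] with N hN
    rw [norm_neg, Real.norm_of_nonneg ENNReal.toReal_nonneg, one_mul, Real.norm_of_nonneg
      (Real.exp_pos _).le]
    exact ENNReal.toReal_le_of_le_ofReal (Real.exp_pos _).le hN
  · have hp := h.isProbabilityMeasure_realModel hβ N
    have hms : MeasurableSet {x : Fin N → ℝ | ∀ a, x a ∈ J} :=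
      MeasurableSet.univ_pi (fun _ => hJ) |> fun hs => by simpa [Set.pi] using hs
    have hcompl : {x : Fin N → ℝ | ∃ i, x i ∈ Jᶜ} = {x : Fin N → ℝ | ∀ a, x a ∈ J}ᶜ := by
      ext x
      simp
    have h1 := probReal_compl_eq_one_sub (μ := realModel V β γ N) hms
    simp only [Measure.real] at h1
    simp only
    rw [hcompl, h1, realModel_apply V β γ N hms, ENNReal.toReal_mul, ENNReal.toReal_inv,
      partitionFunction_univ_eq, partitionFunction]
    have hZ : (∫⁻ x : Fin N → ℝ, ENNReal.ofReal (weight V β γ N x)).toReal ≠ 0 :=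
      (ENNReal.toReal_pos (h.lintegral_weight_pos β N).ne'
        (h.lintegral_weight_lt_top hβ N).ne).ne'
    field_simp
    ring

end IsEffectiveField

end

end DysonGas

theorem mainTheorem5 (κ α α' β : ℕ) (hκ : 2 ≤ κ) (hα : α < κ) (hα' : α' < κ) (hαα' : α ≠ α')
    (hβ : 0 < β) (hβ_even : Even β)
    (V : ℂ[X]) (hV_deg : V.natDegree = κ) (hV_lead : V.leadingCoeff = 1 / (κ : ℂ))
    (μ : Measure ℂ) (γ : ℝ → ℂ)
    (hreg : DysonGas.IsOneCutRegular V κ α α' μ)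
    (hγ : DysonGas.IsEquilibriumCurve V κ α α' μ γ) :
    (∀ N : ℕ, 0 < DysonGas.partitionFunction V β γ Set.univ N ∧
      DysonGas.partitionFunction V β γ Set.univ N < ⊤ ∧
      IsProbabilityMeasure (DysonGas.realModel V β γ N)) ∧
    (∀ F : Set ℝ, IsClosed F →
      limsup (fun N : ℕ => ((1 / N : ℝ) : EReal) *
          ENNReal.log (DysonGas.realModel V β γ N {x | ∃ i, x i ∈ F})) atTop
        ≤ -((β : EReal) * ⨅ x ∈ F, DysonGas.pulledBackPotential V μ γ x)) ∧
    (∀ U : Set ℝ, IsOpen U →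
      -((β : EReal) * ⨅ x ∈ U, DysonGas.pulledBackPotential V μ γ x)
        ≤ liminf (fun N : ℕ => ((1 / N : ℝ) : EReal) *
          ENNReal.log (DysonGas.realModel V β γ N {x | ∃ i, x i ∈ U})) atTop) ∧
    (∀ ε > (0 : ℝ), ∃ C > (0 : ℝ), ∃ r : ℕ → ℝ,
      r =O[atTop] (fun N : ℕ => Real.exp (-(C * N))) ∧
      ∀ N : ℕ, (DysonGas.partitionFunction V β γ (Set.Icc (-ε) (1 + ε)) N).toReal =
        (DysonGas.partitionFunction V β γ Set.univ N).toReal * (1 + r N)) := by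
  obtain ⟨E, C₀, hE, hpos, hpb⟩ := DysonGas.exists_isEffectiveField hκ hV_deg hV_lead hreg hγ
  simp only [hpb]
  refine ⟨fun N => ?_, fun F hF => hE.limsup_realModel_le hβ hF.measurableSet,
    fun U hU => hE.le_liminf_realModel hγ.nice.smooth hγ.nice.injective hβ hU, fun ε hε => ?_⟩
  · rw [DysonGas.IsEffectiveField.partitionFunction_univ_eq]
    exact ⟨hE.lintegral_weight_pos β N, hE.lintegral_weight_lt_top hβ N,
      hE.isProbabilityMeasure_realModel hβ N⟩
  · obtain ⟨k, hk⟩ := hE.growth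
    have hlim : Tendsto E (cocompact ℝ) atTop := by
      rw [cocompact_eq_atBot_atTop]
      refine Tendsto.sup ?_ ?_
      · exact tendsto_atTop_mono (fun x => (by linarith [hk x] : ‖γ x‖ + -k ≤ E x))
          (tendsto_atTop_add_const_right _ _ hγ.nice.tendsto_atBot)
      · exact tendsto_atTop_mono (fun x => (by linarith [hk x] : ‖γ x‖ + -k ≤ E x))
          (tendsto_atTop_add_const_right _ _ hγ.nice.tendsto_atTop)
    have hcl : IsClosed (Set.Iic (-ε) ∪ Set.Ici (1 + ε)) := isClosed_Iic.union isClosed_Ici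
    -- Coercivity gives a minimum of `E` on this closed set, positive since the set misses `[0, 1]`.
    obtain ⟨x, hx, hmin⟩ := hE.continuous.continuousOn.exists_isMinOn' hcl
      (Or.inl (Set.self_mem_Iic (a := -ε)))
      (hlim.eventually_ge_atTop (E (-ε)) |>.filter_mono inf_le_left)
    have hxe : 0 < E x := by
      refine hpos x fun h01 => ?_
      rcases hx with h | h
      · have : x ≤ -ε := h
        linarith [h01.1]
      · have : 1 + ε ≤ x := h
        linarith [h01.2]
    refine hE.exists_partitionFunction_eq hβ measurableSet_Icc hxe fun t ht => hmin ?_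
    by_contra hnot
    simp only [Set.mem_union, Set.mem_Iic, Set.mem_Ici, not_or, not_le] at hnot
    exact ht ⟨hnot.1.le, hnot.2.le⟩
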